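/- Let $(M,g)$ be a nonempty compact smooth Riemannian manifold (without boundary) of dimension $n\ge 3$, with volume measure $\mathrm{d}g$, let $\varepsilon\in\mathbb{R}$, and let $\chi:M\to\mathbb{R}$ be smooth. Let $L^2_1M$ be the completion of the space of smooth functions $M\to\mathbb{R}$ in the Sobolev norm $\|\varphi\|_{2,1}=\big(\int_M(|\nabla\varphi|^2+\varphi^2)\,\mathrm{d}g\big)^{1/2}$, identified with a subspace of $L^2M$: a function $\varphi\in L^2M$ belongs to $L^2_1M$, with gradient $\nabla\varphi$, if some sequence of smooth functions $f_j$ satisfies $f_j\to\varphi$ in $L^2$ and $\nabla f_j\to\nabla\varphi$ in $L^2$. For $\varphi\in L^2_1M$ set $$I(\varphi)=\int_M\big(\varepsilon|\nabla\varphi|^2-\varphi^2\log|\varphi|+\chi\varphi^2\big)\,\mathrm{d}g,$$ where $\varphi\log|\varphi|$ is by definition $0$ on the zero set of $\varphi$. Then: (a) The functional $I:L^2_1M\to\mathbb{R}$ is well defined: for every $\varphi\in L^2_1M$ the gradient $\nabla\varphi$ is unique almost everywhere, $\varphi^2\log|\varphi|\in L^1M$, and the whole integrand above is integrable. (b) $I$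 is continuous with respect to the norm $\|\cdot\|_{2,1}$. (c) If $\varepsilon>0$, then $I$ assumes a minimum value $\kappa$ on the set $\Sigma=\{\varphi\in L^2_1M:\|\varphi\|_2=1\}$. Moreover, if $\varepsilon>0$, every $\varphi\in\Sigma$ with $I(\varphi)=\kappa$ is a distributional solution of $$\varepsilon\Delta\varphi+\varphi\log|\varphi|+(\kappa-\chi)\varphi=0,$$ that is, $\varphi$ and $\varphi\log|\varphi|+(\kappa-\chi)\varphi$ are integrable and $$\int_M\big(\varepsilon\,\varphi\,\Delta\psi+[\varphi\log|\varphi|+(\kappa-\chi)\varphi]\,\psi\big)\,\mathrm{d}g=0\quad\text{for every smooth }\psi:M\to\mathbb{R}.$$ -/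

import Mathlib

open MeasureTheory Filter Topology Manifold
open scoped ContDiff ENNReal

/-- A smooth Riemannian metric on a smooth `n`-manifold `M` (without boundary). -/
abbrev RMetric (n : ℕ) (M : Type*) [TopologicalSpace M] [ChartedSpace (EuclideanSpace ℝ (Fin n)) M]
    [IsManifold (𝓡 n) ∞ M] : Type _ :=
  Bundle.ContMDiffRiemannianMetric (𝓡 n) ∞ (EuclideanSpace ℝ (Fin n))
    (fun x : M => TangentSpace (𝓡 n) x)

namespace RMetric

noncomputable section

variable {n : ℕ} {M : Type*} [TopologicalSpace M] [ChartedSpace (EuclideanSpace ℝ (Fin n)) M]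
  [IsManifold (𝓡 n) ∞ M]

/-- The inner product `g_x` as a bilinear form on the tangent space at `x`. -/
def bilin (g : RMetric n M) (x : M) : LinearMap.BilinForm ℝ (TangentSpace (𝓡 n) x) :=
  LinearMap.mk₂ ℝ (fun v w => g.inner x v w) (by intros; simp) (by intros; simp)
    (by intros; simp) (by intros; simp)

theorem bilin_nondegenerate (g : RMetric n M) (x : M) : (g.bilin x).Nondegenerate := by
  constructor
  · intro v hv
    by_contra h
    exact (g.pos x v h).ne' (hv v)
  · intro v hv
    by_contra h
    exact (g.pos x v h).ne' (hv v)

instance finiteDimensional_tangentSpace (x : M) :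
    FiniteDimensional ℝ (TangentSpace (𝓡 n) x) :=
  inferInstanceAs (FiniteDimensional ℝ (EuclideanSpace ℝ (Fin n)))

/-- The squared length `|v|² = g_x(v, v)` of a tangent vector. -/
def normSq (g : RMetric n M) (x : M) (v : TangentSpace (𝓡 n) x) : ℝ := g.inner x v v

/-- The gradient of a function: the vector field with `g(∇f, v) = df(v)`. -/
def grad (g : RMetric n M) (f : M → ℝ) (x : M) : TangentSpace (𝓡 n) x :=
  ((g.bilin x).toDual (g.bilin_nondegenerate x)).symm
    (mfderiv (𝓡 n) 𝓘(ℝ, ℝ) f x : TangentSpace (𝓡 n) x →L[ℝ] ℝ).toLinearMap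

theorem inner_grad (g : RMetric n M) (f : M → ℝ) (x : M) (v : TangentSpace (𝓡 n) x) :
    g.inner x (g.grad f x) v = (mfderiv (𝓡 n) 𝓘(ℝ, ℝ) f x : TangentSpace (𝓡 n) x →L[ℝ] ℝ) v :=
  LinearMap.BilinForm.apply_toDual_symm_apply (B := g.bilin x) (hB := g.bilin_nondegenerate x) _ v

/-- The `i`-th coordinate vector field of the chart at `p`, at the point of `M` with coordinates
`u`. -/
def coordVec (p : M) (u : EuclideanSpace ℝ (Fin n)) (i : Fin n) :
    TangentSpace (𝓡 n) ((chartAt (EuclideanSpace ℝ (Fin n)) p).symm u) :=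
  mfderiv (𝓡 n) (𝓡 n) (chartAt (EuclideanSpace ℝ (Fin n)) p).symm u
    (EuclideanSpace.single i (1 : ℝ) : EuclideanSpace ℝ (Fin n))

/-- `√det (g_ij)` in the chart at `p`, as a function of the coordinates `u`. -/
def sqrtDet (g : RMetric n M) (p : M) (u : EuclideanSpace ℝ (Fin n)) : ℝ :=
  Real.sqrt (Matrix.det (Matrix.of fun i j : Fin n =>
    g.inner ((chartAt (EuclideanSpace ℝ (Fin n)) p).symm u) (coordVec p u i) (coordVec p u j)))

/-- The components, in the chart at `p`, of a vector field `X`. -/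
def components (p : M) (X : ∀ x : M, TangentSpace (𝓡 n) x) (x : M) : EuclideanSpace ℝ (Fin n) :=
  mfderiv (𝓡 n) (𝓡 n) (chartAt (EuclideanSpace ℝ (Fin n)) p) x (X x)

/-- The divergence of a vector field, `div X = (det g)^(-1/2) ∑ᵢ ∂ᵢ ((det g)^(1/2) Xⁱ)`, computed
at `x` in the chart at `x`. -/
def divergence (g : RMetric n M) (X : ∀ x : M, TangentSpace (𝓡 n) x) (x : M) : ℝ :=
  (g.sqrtDet x (chartAt (EuclideanSpace ℝ (Fin n)) x x))⁻¹ *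
    ∑ i : Fin n, fderiv ℝ
      (fun u => g.sqrtDet x u *
        components x X ((chartAt (EuclideanSpace ℝ (Fin n)) x).symm u) i)
      (chartAt (EuclideanSpace ℝ (Fin n)) x x) (EuclideanSpace.single i (1 : ℝ))

/-- The Laplacian of a function, `Δf = div ∇f`. -/
def laplacian (g : RMetric n M) (f : M → ℝ) (x : M) : ℝ := g.divergence (g.grad f) x

variable [MeasurableSpace M] [BorelSpace M]

/-- The volume measure of `g` on the domain of the chart at `p` (extended by zero to `M`):
the measure which reads `√det (g_ij) du` in coordinates. -/
def chartVolume (g : RMetric n M) (p : M) : Measure M :=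
  Measure.map (chartAt (EuclideanSpace ℝ (Fin n)) p).symm
    ((volume.restrict (chartAt (EuclideanSpace ℝ (Fin n)) p).target).withDensity
      fun u => ENNReal.ofReal (g.sqrtDet p u))

/-- The Riemannian volume measure. On the domain of each chart it coincides with the measure
`√det (g_ij) du`; being determined by these restrictions, it is their least upper bound. -/
def vol (g : RMetric n M) : Measure M := ⨆ p : M, g.chartVolume p

/-- Measurability (almost everywhere) of a vector field: its components in charts are
measurable. -/
def AEMeasurableField (g : RMetric n M) (X : ∀ x : M, TangentSpace (𝓡 n) x) : Prop :=
  ∀ p : M, AEMeasurable (components p X)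
    (g.vol.restrict (chartAt (EuclideanSpace ℝ (Fin n)) p).source)

/-- `X` is the gradient of `φ ∈ L²M`, in the sense of the completion of the space of smooth
functions in the first Sobolev norm: some sequence of smooth functions converges to `φ` in `L²`,
while the gradients converge to `X` in `L²`. -/
def HasSobolevGrad (g : RMetric n M) (φ : Lp ℝ 2 g.vol) (X : ∀ x : M, TangentSpace (𝓡 n) x) :
    Prop :=
  g.AEMeasurableField X ∧ ∃ f : ℕ → M → ℝ,
    (∀ j, ContMDiff (𝓡 n) 𝓘(ℝ, ℝ) ∞ (f j)) ∧
    Tendsto (fun j => eLpNorm (fun x => f j x - φ x) 2 g.vol) atTop (𝓝 0) ∧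
    Tendsto (fun j => ∫⁻ x, ENNReal.ofReal (g.normSq x (g.grad (f j) x - X x)) ∂g.vol)
      atTop (𝓝 0)

/-- The Sobolev space `L²₁M`: the completion of the space of smooth functions in the norm
`(∫ |∇f|² + f²)^(1/2)`, viewed as a subspace of `L²M`. -/
def sobolevSpace (g : RMetric n M) : Set (Lp ℝ 2 g.vol) :=
  {φ | ∃ X : ∀ x : M, TangentSpace (𝓡 n) x, g.HasSobolevGrad φ X}

open Classical in
/-- The gradient of a function in `L²₁M` (and zero for other functions in `L²M`). -/
def sobolevGrad (g : RMetric n M) (φ : Lp ℝ 2 g.vol) : ∀ x : M, TangentSpace (𝓡 n) x :=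
  if h : ∃ X : ∀ x : M, TangentSpace (𝓡 n) x, g.HasSobolevGrad φ X then h.choose else fun _ => 0

/-- The Sobolev norm `‖φ‖_{2,1} = (∫ |∇φ|² + φ²)^(1/2)` of `φ ∈ L²₁M`. -/
def sobolevNorm (g : RMetric n M) (φ : Lp ℝ 2 g.vol) : ℝ :=
  Real.sqrt (∫ x, (g.normSq x (g.sobolevGrad φ x) + φ x ^ 2) ∂g.vol)

/-- The integrand `ε|∇φ|² - φ² log|φ| + χφ²`; note that `Real.log 0 = 0`. -/
def logIntegrand (g : RMetric n M) (ε : ℝ) (χ : M → ℝ) (φ : Lp ℝ 2 g.vol) (x : M) : ℝ :=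
  ε * g.normSq x (g.sobolevGrad φ x) - φ x ^ 2 * Real.log |φ x| + χ x * φ x ^ 2

/-- The functional `I(φ) = ∫ (ε|∇φ|² - φ² log|φ| + χφ²)`. -/
def logFunctional (g : RMetric n M) (ε : ℝ) (χ : M → ℝ) (φ : Lp ℝ 2 g.vol) : ℝ :=
  ∫ x, g.logIntegrand ε χ φ x ∂g.vol

/-- The unit `L²`-sphere `{φ ∈ L²₁M : ‖φ‖₂ = 1}` in the Sobolev space. -/
def unitSphere (g : RMetric n M) : Set (Lp ℝ 2 g.vol) := {φ ∈ g.sobolevSpace | ‖φ‖ = 1}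

/-- `φ` is a distributional solution of `εΔφ + F = 0` on the compact manifold `M`, the functions
`φ` and `F` being integrable. -/
def IsDistribSolution (g : RMetric n M) (ε : ℝ) (φ F : M → ℝ) : Prop :=
  Integrable φ g.vol ∧ Integrable F g.vol ∧
    ∀ ψ : M → ℝ, ContMDiff (𝓡 n) 𝓘(ℝ, ℝ) ∞ ψ →
      ∫ x, (ε * (φ x * g.laplacian ψ x) + F x * ψ x) ∂g.vol = 0

end

end RMetric

/-!
The theorem is an instance of the direct method of the calculus of variations. The potential
`-t² log|t| + χ t²` is subcritical, so that the Sobolev inequality makes it a lower order perturbation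
of the Dirichlet form `∫ |∇φ|²`; this gives continuity of the functional and, on the unit sphere,
coercivity. Rellich's theorem supplies a limit of a minimizing sequence.

*Geometry.* In a chart the Riemannian volume has the density `√det(gᵢⱼ)`, independently of the chart
(`RMetric.sqrtDet_transition`, `RMetric.vol_apply`). With a partition of unity, Green's formula
`∫ f Δψ = -∫ g(∇f, ∇ψ)` for the Laplacian of the coordinate formula is thus reduced to the vanishing
of the integral of a derivative of a compactly supported function (`RMetric.integral_mul_laplacian`).

*The Sobolev space.* Green's formula yields a weak formulation of the gradient which does not involve
the gradient itself (`RMetric.HasSobolevGrad.integral_mul_inner_grad`). As finitely many smooth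
gradients span all tangent spaces (`RMetric.exists_gradient_frame`), the gradient of an element of the
Sobolev space is unique (`RMetric.HasSobolevGrad.ae_eq`), and square integrable vector fields form a
complete space, so that the Dirichlet form is closed (`RMetric.exists_sobolev_limit`). The Sobolev
inequality (`RMetric.exists_eLpNorm_le`) is the Gagliardo–Nirenberg–Sobolev inequality in charts.
Rellich's theorem is used as an inequality: up to a small multiple of the energy, the `L²`-norm is
controlled by finitely many continuous linear functionals (`RMetric.exists_norm_sq_le`). In Euclidean
space these are Fourier coefficients: high frequencies are controlled by the gradient, and the Fourier
transform of a function with support in a fixed compact set is uniformly continuous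
(`exists_integral_sq_le_fourier`).

*The variational argument* uses these facts only, and is carried out for an abstract `SobolevForm`.
The derivative of the potential grows less than `|t|^r` for every `r > 1`, hence the potential energy
is Lipschitz in the `L²`-norm on sets of bounded energy (`SobolevForm.exists_abs_potential_sub_le`).
Tangent lines of the logarithm give coercivity (`SobolevForm.exists_functional_ge`). A minimizing
sequence has a subsequence which converges in `L²`; since the potential energy is continuous in `L²`
along it and `I(l φ) = l² I(φ) - l² log l ‖φ‖²`, the parallelogram law shows that the subsequence
converges in energy too (`SobolevForm.tendsto_form_sub`), and its limit is a minimizer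
(`SobolevForm.exists_minimizer`). Scaling also turns the constrained problem into the free minimum
at `φ` of `I(ψ) - κ ‖ψ‖² + ‖ψ‖² log ‖ψ‖`; differentiation yields the weak Euler–Lagrange equation
(`SobolevForm.form_eq_of_minimizer`), from which Green's formula moves both derivatives to the test
function (`RMetric.isDistribSolution_of_form_eq`).
-/

namespace RMetric

section ChartGeometry

variable {n : ℕ} {M : Type*} [TopologicalSpace M] [ChartedSpace (EuclideanSpace ℝ (Fin n)) M]
  [IsManifold (𝓡 n) ∞ M]

/-! ### Linear algebra in the tangent spaces -/

theorem normSq_nonneg (g : RMetric n M) (x : M) (v : TangentSpace (𝓡 n) x) :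
    0 ≤ g.normSq x v := by
  by_cases h : v = 0
  · simp [normSq, h]
  · exact (g.pos x v h).le

/-- The length `|v| = g_x(v, v)^(1/2)` of a tangent vector. -/
noncomputable def gnorm (g : RMetric n M) (x : M) (v : TangentSpace (𝓡 n) x) : ℝ :=
  Real.sqrt (g.normSq x v)

theorem gnorm_nonneg (g : RMetric n M) (x : M) (v : TangentSpace (𝓡 n) x) : 0 ≤ g.gnorm x v :=
  Real.sqrt_nonneg _

theorem gnorm_sq (g : RMetric n M) (x : M) (v : TangentSpace (𝓡 n) x) :
    g.gnorm x v ^ 2 = g.normSq x v :=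
  Real.sq_sqrt (g.normSq_nonneg x v)

theorem abs_inner_le (g : RMetric n M) (x : M) (v w : TangentSpace (𝓡 n) x) :
    |g.inner x v w| ≤ g.gnorm x v * g.gnorm x w := by
  have h := LinearMap.BilinForm.apply_mul_apply_le_of_forall_zero_le (g.bilin x)
    (fun v => g.normSq_nonneg x v) v w
  have h' : g.inner x v w ^ 2 ≤ g.normSq x v * g.normSq x w := by
    have e : (g.bilin x) v w * (g.bilin x) w v = g.inner x v w ^ 2 := by
      change g.inner x v w * g.inner x w v = _
      rw [g.symm x w v, sq]
    rw [← e]; exact h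
  unfold gnorm
  rw [← Real.sqrt_mul (g.normSq_nonneg x v)]
  exact Real.abs_le_sqrt h'

theorem normSq_add (g : RMetric n M) (x : M) (v w : TangentSpace (𝓡 n) x) :
    g.normSq x (v + w) = g.normSq x v + 2 * g.inner x v w + g.normSq x w := by
  simp only [normSq, map_add, _root_.add_apply]
  rw [g.symm x w v]; ring

theorem normSq_sub (g : RMetric n M) (x : M) (v w : TangentSpace (𝓡 n) x) :
    g.normSq x (v - w) = g.normSq x v - 2 * g.inner x v w + g.normSq x w := by
  simp only [normSq, map_sub, _root_.sub_apply]
  rw [g.symm x w v]; ring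

theorem normSq_smul (g : RMetric n M) (x : M) (c : ℝ) (v : TangentSpace (𝓡 n) x) :
    g.normSq x (c • v) = c ^ 2 * g.normSq x v := by
  simp only [normSq, map_smul, _root_.smul_apply, smul_eq_mul]; ring

theorem gnorm_add_le (g : RMetric n M) (x : M) (v w : TangentSpace (𝓡 n) x) :
    g.gnorm x (v + w) ≤ g.gnorm x v + g.gnorm x w := by
  refine Real.sqrt_le_iff.2 ⟨add_nonneg (g.gnorm_nonneg _ _) (g.gnorm_nonneg _ _), ?_⟩
  have := (abs_le.1 (g.abs_inner_le x v w)).2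
  rw [normSq_add, ← gnorm_sq, ← gnorm_sq]
  nlinarith

/-! ### The metric in a chart -/

/-- The derivative at `u` of the inverse of the chart at `p`. -/
noncomputable def coordMap (p : M) (u : EuclideanSpace ℝ (Fin n)) :
    EuclideanSpace ℝ (Fin n) →L[ℝ]
      TangentSpace (𝓡 n) ((chartAt (EuclideanSpace ℝ (Fin n)) p).symm u) :=
  mfderiv (𝓡 n) (𝓡 n) (chartAt (EuclideanSpace ℝ (Fin n)) p).symm u

/-- The derivative at `x` of the chart at `p`. -/
noncomputable def chartMap (p x : M) :
    TangentSpace (𝓡 n) x →L[ℝ] EuclideanSpace ℝ (Fin n) :=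
  mfderiv (𝓡 n) (𝓡 n) (chartAt (EuclideanSpace ℝ (Fin n)) p) x

theorem isManifold_one : IsManifold (𝓡 n) 1 M :=
  IsManifold.of_le (n := ∞) (by exact_mod_cast le_top)

theorem chartMap_coordMap (p : M) {u : EuclideanSpace ℝ (Fin n)}
    (hu : u ∈ (chartAt (EuclideanSpace ℝ (Fin n)) p).target) (v : EuclideanSpace ℝ (Fin n)) :
    chartMap p ((chartAt (EuclideanSpace ℝ (Fin n)) p).symm u) (coordMap p u v) = v := by
  have : IsManifold (𝓡 n) 1 M := isManifold_one
  have h := (mdifferentiable_chart (I := 𝓡 n) p).comp_symm_deriv hu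
  exact congrArg (fun L => L v) h

theorem coordMap_chartMap (p : M) {u : EuclideanSpace ℝ (Fin n)}
    (hu : u ∈ (chartAt (EuclideanSpace ℝ (Fin n)) p).target)
    (v : TangentSpace (𝓡 n) ((chartAt (EuclideanSpace ℝ (Fin n)) p).symm u)) :
    coordMap p u (chartMap p ((chartAt (EuclideanSpace ℝ (Fin n)) p).symm u) v) = v := by
  have : IsManifold (𝓡 n) 1 M := isManifold_one
  have h := (mdifferentiable_chart (I := 𝓡 n) p).symm_comp_deriv
    ((chartAt (EuclideanSpace ℝ (Fin n)) p).map_target hu)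
  rw [(chartAt (EuclideanSpace ℝ (Fin n)) p).right_inv hu] at h
  exact congrArg (fun L => L v) h

/-- The metric at the point with coordinates `u` in the chart at `p`, as a bilinear form on the
model space. -/
noncomputable def coordMetric (g : RMetric n M) (p : M) (u v w : EuclideanSpace ℝ (Fin n)) : ℝ :=
  g.inner ((chartAt (EuclideanSpace ℝ (Fin n)) p).symm u) (coordMap p u v) (coordMap p u w)

theorem contMDiffOn_coordMap (p : M) (v : EuclideanSpace ℝ (Fin n)) :
    ContMDiffOn (𝓡 n) ((𝓡 n).prod 𝓘(ℝ, EuclideanSpace ℝ (Fin n))) ∞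
      (fun u => (⟨(chartAt (EuclideanSpace ℝ (Fin n)) p).symm u, coordMap p u v⟩ :
        TangentBundle (𝓡 n) M))
      (chartAt (EuclideanSpace ℝ (Fin n)) p).target := by
  have : IsManifold (𝓡 n) 1 M := isManifold_one
  have h1 := (contMDiffOn_chart_symm (I := 𝓡 n) (n := ∞) (x := p))
  have ho := (chartAt (EuclideanSpace ℝ (Fin n)) p).open_target
  have h2 := h1.contMDiffOn_tangentMapWithin (m := ∞) (by simp) ho.uniqueMDiffOn
  have h3 : ContMDiff (𝓡 n) (𝓡 n).tangent ∞
      (fun u : EuclideanSpace ℝ (Fin n) =>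
        (⟨u, v⟩ : TangentBundle (𝓡 n) (EuclideanSpace ℝ (Fin n)))) := by
    exact contMDiff_vectorSpace_iff_contDiff.2 contDiff_const
  have h4 := h2.comp h3.contMDiffOn (s := (chartAt (EuclideanSpace ℝ (Fin n)) p).target)
    (fun u hu => hu)
  refine h4.congr fun u hu => ?_
  simp only [Function.comp, tangentMapWithin]
  rw [mfderivWithin_of_isOpen ho hu]
  rfl

theorem contDiffOn_coordMetric (g : RMetric n M) (p : M) (v w : EuclideanSpace ℝ (Fin n)) :
    ContDiffOn ℝ ∞ (fun u => g.coordMetric p u v w)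
      (chartAt (EuclideanSpace ℝ (Fin n)) p).target := by
  rw [← contMDiffOn_iff_contDiffOn]
  intro u hu
  have h1 := contMDiffOn_coordMap p v u hu
  have h2 := contMDiffOn_coordMap p w u hu
  let _ : Bundle.RiemannianBundle (fun x : M => TangentSpace (𝓡 n) x) := ⟨g.toRiemannianMetric⟩
  open Bundle in
  exact ContMDiffWithinAt.inner_bundle (IB := 𝓡 n) (n := ∞) (E := fun x : M => TangentSpace (𝓡 n) x) h1 h2

end ChartGeometry
end RMetric

namespace RMetric

section ChartGeometry

set_option linter.unusedSectionVars false

variable {n : ℕ} {M : Type*} [TopologicalSpace M] [ChartedSpace (EuclideanSpace ℝ (Fin n)) M]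
  [IsManifold (𝓡 n) ∞ M]

theorem coordVec_eq (p : M) (u : EuclideanSpace ℝ (Fin n)) (i : Fin n) :
    coordVec p u i = coordMap p u (EuclideanSpace.single i (1 : ℝ)) := rfl

theorem coordMap_eq_sum (p : M) (u v : EuclideanSpace ℝ (Fin n)) :
    coordMap p u v = ∑ i, v i • coordVec p u i := by
  conv_lhs => rw [← (EuclideanSpace.basisFun (Fin n) ℝ).sum_repr v]
  simp [coordVec_eq]

theorem coordMetric_comm (g : RMetric n M) (p : M) (u v w : EuclideanSpace ℝ (Fin n)) :
    g.coordMetric p u v w = g.coordMetric p u w v := g.symm _ _ _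

/-- The Gram matrix `(g_ij)` of the coordinate fields of the chart at `p`. -/
noncomputable def gram (g : RMetric n M) (p : M) (u : EuclideanSpace ℝ (Fin n)) :
    Matrix (Fin n) (Fin n) ℝ :=
  Matrix.of fun i j => g.coordMetric p u (EuclideanSpace.single i (1 : ℝ))
    (EuclideanSpace.single j (1 : ℝ))

theorem sqrtDet_eq (g : RMetric n M) (p : M) (u : EuclideanSpace ℝ (Fin n)) :
    g.sqrtDet p u = Real.sqrt (g.gram p u).det := rfl

theorem coordMetric_eq_sum (g : RMetric n M) (p : M) (u v w : EuclideanSpace ℝ (Fin n)) :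
    g.coordMetric p u v w = ∑ i, ∑ j, v i * w j * g.gram p u i j := by
  unfold coordMetric gram
  rw [coordMap_eq_sum p u v, coordMap_eq_sum p u w]
  simp only [map_sum, map_smul, _root_.sum_apply, _root_.smul_apply, smul_eq_mul,
    Matrix.of_apply, coordMetric, coordVec_eq, Finset.mul_sum]
  rw [Finset.sum_comm]
  refine Finset.sum_congr rfl fun i _ => Finset.sum_congr rfl fun j _ => by ring

theorem coordMap_injective (p : M) {u : EuclideanSpace ℝ (Fin n)}
    (hu : u ∈ (chartAt (EuclideanSpace ℝ (Fin n)) p).target) :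
    Function.Injective (coordMap p u) :=
  Function.LeftInverse.injective (chartMap_coordMap p hu)

theorem coordMetric_pos (g : RMetric n M) (p : M) {u : EuclideanSpace ℝ (Fin n)}
    (hu : u ∈ (chartAt (EuclideanSpace ℝ (Fin n)) p).target) {v : EuclideanSpace ℝ (Fin n)}
    (hv : v ≠ 0) : 0 < g.coordMetric p u v v :=
  g.pos _ _ fun h => hv (coordMap_injective p hu (by rw [h, map_zero]))

theorem gram_posDef (g : RMetric n M) (p : M) {u : EuclideanSpace ℝ (Fin n)}
    (hu : u ∈ (chartAt (EuclideanSpace ℝ (Fin n)) p).target) : (g.gram p u).PosDef := by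
  refine Matrix.PosDef.of_dotProduct_mulVec_pos ?_ ?_
  · ext i j
    simp [gram, g.coordMetric_comm p u (EuclideanSpace.single i (1 : ℝ))]
  · intro v hv
    have h := g.coordMetric_pos p hu (v := WithLp.toLp 2 v) (by simpa using hv)
    rw [coordMetric_eq_sum] at h
    have e : star v ⬝ᵥ (g.gram p u).mulVec v = ∑ i, ∑ j, v i * v j * g.gram p u i j := by
      simp only [dotProduct, Matrix.mulVec, Finset.mul_sum, star_trivial]
      exact Finset.sum_congr rfl fun i _ => Finset.sum_congr rfl fun j _ => by ring
    rw [e]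
    exact h

theorem gram_det_pos (g : RMetric n M) (p : M) {u : EuclideanSpace ℝ (Fin n)}
    (hu : u ∈ (chartAt (EuclideanSpace ℝ (Fin n)) p).target) : 0 < (g.gram p u).det :=
  (g.gram_posDef p hu).det_pos

theorem sqrtDet_pos (g : RMetric n M) (p : M) {u : EuclideanSpace ℝ (Fin n)}
    (hu : u ∈ (chartAt (EuclideanSpace ℝ (Fin n)) p).target) : 0 < g.sqrtDet p u :=
  Real.sqrt_pos.2 (g.gram_det_pos p hu)

theorem contDiffOn_gram_apply (g : RMetric n M) (p : M) (i j : Fin n) :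
    ContDiffOn ℝ ∞ (fun u => g.gram p u i j) (chartAt (EuclideanSpace ℝ (Fin n)) p).target :=
  g.contDiffOn_coordMetric p _ _

theorem contDiffOn_det {E : Type*} [NormedAddCommGroup E] [NormedSpace ℝ E] {m : ℕ} {s : Set E}
    {A : E → Matrix (Fin m) (Fin m) ℝ} (hA : ∀ i j, ContDiffOn ℝ ∞ (fun u => A u i j) s) :
    ContDiffOn ℝ ∞ (fun u => (A u).det) s := by
  simp only [Matrix.det_apply]
  exact ContDiffOn.sum fun σ _ => (contDiffOn_prod fun i _ => hA _ _).const_smul _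

theorem contDiffOn_sqrtDet (g : RMetric n M) (p : M) :
    ContDiffOn ℝ ∞ (g.sqrtDet p) (chartAt (EuclideanSpace ℝ (Fin n)) p).target :=
  (contDiffOn_det (g.contDiffOn_gram_apply p)).sqrt fun _ hu => (g.gram_det_pos p hu).ne'

theorem contDiffOn_gram_inv_apply (g : RMetric n M) (p : M) (i j : Fin n) :
    ContDiffOn ℝ ∞ (fun u => (g.gram p u)⁻¹ i j)
      (chartAt (EuclideanSpace ℝ (Fin n)) p).target := by
  simp only [Matrix.inv_def, Matrix.smul_apply, Ring.inverse_eq_inv', smul_eq_mul,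
    Matrix.adjugate_apply]
  refine ((contDiffOn_det (g.contDiffOn_gram_apply p)).inv
    fun _ hu => (g.gram_det_pos p hu).ne').mul (contDiffOn_det fun k l => ?_)
  by_cases hk : k = j
  · subst hk
    simpa using contDiffOn_const
  · simpa [Matrix.updateRow_ne hk] using g.contDiffOn_gram_apply p k l

/-! ### Functions and their gradients in a chart -/

theorem contDiffOn_comp_chart_symm {f : M → ℝ} (hf : ContMDiff (𝓡 n) 𝓘(ℝ, ℝ) ∞ f) (p : M) :
    ContDiffOn ℝ ∞ (fun u => f ((chartAt (EuclideanSpace ℝ (Fin n)) p).symm u))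
      (chartAt (EuclideanSpace ℝ (Fin n)) p).target := by
  rw [← contMDiffOn_iff_contDiffOn]
  exact hf.comp_contMDiffOn contMDiffOn_chart_symm

theorem fderiv_comp_chart_symm {f : M → ℝ} (hf : ContMDiff (𝓡 n) 𝓘(ℝ, ℝ) ∞ f) (p : M)
    {u : EuclideanSpace ℝ (Fin n)} (hu : u ∈ (chartAt (EuclideanSpace ℝ (Fin n)) p).target)
    (v : EuclideanSpace ℝ (Fin n)) :
    fderiv ℝ (fun u => f ((chartAt (EuclideanSpace ℝ (Fin n)) p).symm u)) u v =
      mfderiv (𝓡 n) 𝓘(ℝ, ℝ) f ((chartAt (EuclideanSpace ℝ (Fin n)) p).symm u)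
        (coordMap p u v) := by
  have : IsManifold (𝓡 n) 1 M := isManifold_one
  have h1 : MDifferentiableAt (𝓡 n) 𝓘(ℝ, ℝ) f
    ((chartAt (EuclideanSpace ℝ (Fin n)) p).symm u) := hf.mdifferentiableAt (by simp)
  have h2 := (mdifferentiable_chart (I := 𝓡 n) p).mdifferentiableAt_symm hu
  have h := mfderiv_comp u h1 h2
  rw [mfderiv_eq_fderiv] at h
  exact congrArg (fun L => L v) h

theorem fderiv_comp_chart_symm_eq_inner (g : RMetric n M) {f : M → ℝ}
    (hf : ContMDiff (𝓡 n) 𝓘(ℝ, ℝ) ∞ f) (p : M)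
    {u : EuclideanSpace ℝ (Fin n)} (hu : u ∈ (chartAt (EuclideanSpace ℝ (Fin n)) p).target)
    (v : EuclideanSpace ℝ (Fin n)) :
    fderiv ℝ (fun u => f ((chartAt (EuclideanSpace ℝ (Fin n)) p).symm u)) u v =
      g.inner _ (g.grad f ((chartAt (EuclideanSpace ℝ (Fin n)) p).symm u)) (coordMap p u v) := by
  rw [fderiv_comp_chart_symm hf p hu, inner_grad]

theorem components_eq (p : M) (X : ∀ x : M, TangentSpace (𝓡 n) x) (x : M) :
    components p X x = chartMap p x (X x) := rfl

theorem coordMap_components (p : M) (X : ∀ x : M, TangentSpace (𝓡 n) x)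
    {u : EuclideanSpace ℝ (Fin n)} (hu : u ∈ (chartAt (EuclideanSpace ℝ (Fin n)) p).target) :
    coordMap p u (components p X ((chartAt (EuclideanSpace ℝ (Fin n)) p).symm u)) =
      X ((chartAt (EuclideanSpace ℝ (Fin n)) p).symm u) :=
  coordMap_chartMap p hu _

theorem inner_eq_sum_components (g : RMetric n M) (p : M) (X Y : ∀ x : M, TangentSpace (𝓡 n) x)
    {u : EuclideanSpace ℝ (Fin n)} (hu : u ∈ (chartAt (EuclideanSpace ℝ (Fin n)) p).target) :
    g.inner _ (X ((chartAt (EuclideanSpace ℝ (Fin n)) p).symm u)) (Y _) =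
      ∑ i, ∑ j, components p X ((chartAt (EuclideanSpace ℝ (Fin n)) p).symm u) i *
        components p Y ((chartAt (EuclideanSpace ℝ (Fin n)) p).symm u) j * g.gram p u i j := by
  rw [← coordMetric_eq_sum, coordMetric, coordMap_components p X hu, coordMap_components p Y hu]

theorem components_grad (g : RMetric n M) {f : M → ℝ} (hf : ContMDiff (𝓡 n) 𝓘(ℝ, ℝ) ∞ f) (p : M)
    {u : EuclideanSpace ℝ (Fin n)} (hu : u ∈ (chartAt (EuclideanSpace ℝ (Fin n)) p).target)
    (i : Fin n) :
    components p (g.grad f) ((chartAt (EuclideanSpace ℝ (Fin n)) p).symm u) i =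
      ∑ j, (g.gram p u)⁻¹ i j *
        fderiv ℝ (fun u => f ((chartAt (EuclideanSpace ℝ (Fin n)) p).symm u)) u
          (EuclideanSpace.single j (1 : ℝ)) := by
  set c := components p (g.grad f) ((chartAt (EuclideanSpace ℝ (Fin n)) p).symm u) with hc
  have h : ∀ j, fderiv ℝ (fun u => f ((chartAt (EuclideanSpace ℝ (Fin n)) p).symm u)) u
          (EuclideanSpace.single j (1 : ℝ)) = ((g.gram p u).mulVec c) j := by
    intro j
    rw [g.fderiv_comp_chart_symm_eq_inner hf p hu, ← coordMap_components p (g.grad f) hu, ← hc]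
    change g.coordMetric p u c _ = _
    rw [coordMetric_comm, coordMetric_eq_sum]
    simp [Matrix.mulVec, dotProduct, mul_comm]
  simp only [h]
  change _ = ((g.gram p u)⁻¹.mulVec ((g.gram p u).mulVec c)) i
  rw [Matrix.mulVec_mulVec, Matrix.nonsing_inv_mul _ (g.gram_det_pos p hu).ne'.isUnit,
    Matrix.one_mulVec]

theorem contDiffOn_fderiv_comp_chart_symm {f : M → ℝ} (hf : ContMDiff (𝓡 n) 𝓘(ℝ, ℝ) ∞ f) (p : M)
    (v : EuclideanSpace ℝ (Fin n)) :
    ContDiffOn ℝ ∞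
      (fun u => fderiv ℝ (fun u => f ((chartAt (EuclideanSpace ℝ (Fin n)) p).symm u)) u v)
      (chartAt (EuclideanSpace ℝ (Fin n)) p).target :=
  ((contDiffOn_comp_chart_symm hf p).fderiv_of_isOpen (m := ∞)
    (chartAt (EuclideanSpace ℝ (Fin n)) p).open_target (by simp)).clm_apply contDiffOn_const

theorem contDiffOn_components_grad (g : RMetric n M) {f : M → ℝ}
    (hf : ContMDiff (𝓡 n) 𝓘(ℝ, ℝ) ∞ f) (p : M) (i : Fin n) :
    ContDiffOn ℝ ∞
      (fun u => components p (g.grad f) ((chartAt (EuclideanSpace ℝ (Fin n)) p).symm u) i)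
      (chartAt (EuclideanSpace ℝ (Fin n)) p).target := by
  refine ContDiffOn.congr (ContDiffOn.sum fun j _ => (g.contDiffOn_gram_inv_apply p i j).mul
    (contDiffOn_fderiv_comp_chart_symm hf p (EuclideanSpace.single j (1 : ℝ))))
    fun u hu => g.components_grad hf p hu i

theorem contDiffOn_inner_grad (g : RMetric n M) {f h : M → ℝ}
    (hf : ContMDiff (𝓡 n) 𝓘(ℝ, ℝ) ∞ f) (hh : ContMDiff (𝓡 n) 𝓘(ℝ, ℝ) ∞ h) (p : M) :
    ContDiffOn ℝ ∞ (fun u => g.inner ((chartAt (EuclideanSpace ℝ (Fin n)) p).symm u)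
        (g.grad f _) (g.grad h _))
      (chartAt (EuclideanSpace ℝ (Fin n)) p).target := by
  refine ContDiffOn.congr (ContDiffOn.sum fun i _ => ContDiffOn.sum fun j _ =>
    ((g.contDiffOn_components_grad hf p i).mul (g.contDiffOn_components_grad hh p j)).mul
      (g.contDiffOn_gram_apply p i j)) fun u hu => g.inner_eq_sum_components p _ _ hu

/-- A function on `M` is continuous if its expressions in the charts are. -/
theorem continuous_of_continuousOn_charts {β : Type*} [TopologicalSpace β] {f : M → β}
    (hf : ∀ p : M, ContinuousOn (fun u => f ((chartAt (EuclideanSpace ℝ (Fin n)) p).symm u))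
      (chartAt (EuclideanSpace ℝ (Fin n)) p).target) : Continuous f := by
  rw [continuous_iff_continuousAt]
  intro p
  set e := chartAt (EuclideanSpace ℝ (Fin n)) p
  have h1 : ContinuousAt (fun x => f (e.symm (e x))) p :=
    ContinuousAt.comp (g := fun u => f (e.symm u))
      ((hf p).continuousAt (e.open_target.mem_nhds (mem_chart_target _ p)))
      (e.continuousAt (mem_chart_source _ p))
  refine h1.congr ?_
  filter_upwards [e.open_source.mem_nhds (mem_chart_source _ p)] with x hx
  rw [e.left_inv hx]

theorem continuous_inner_grad (g : RMetric n M) {f h : M → ℝ}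
    (hf : ContMDiff (𝓡 n) 𝓘(ℝ, ℝ) ∞ f) (hh : ContMDiff (𝓡 n) 𝓘(ℝ, ℝ) ∞ h) :
    Continuous fun x => g.inner x (g.grad f x) (g.grad h x) :=
  continuous_of_continuousOn_charts fun p => (g.contDiffOn_inner_grad hf hh p).continuousOn

/-! ### Algebraic rules for the gradient -/

theorem ext_inner (g : RMetric n M) {x : M} {v w : TangentSpace (𝓡 n) x}
    (h : ∀ z, g.inner x v z = g.inner x w z) : v = w := by
  have h0 : g.inner x (v - w) (v - w) = 0 := by
    have e : g.inner x (v - w) (v - w) = g.inner x v (v - w) - g.inner x w (v - w) := by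
      rw [map_sub (g.inner x) v w]; rfl
    rw [e, h, sub_self]
  by_contra hne
  exact (g.pos x _ (sub_ne_zero.2 hne)).ne' h0

theorem grad_add (g : RMetric n M) {f h : M → ℝ} {x : M}
    (hf : MDifferentiableAt (𝓡 n) 𝓘(ℝ, ℝ) f x) (hh : MDifferentiableAt (𝓡 n) 𝓘(ℝ, ℝ) h x) :
    g.grad (f + h) x = g.grad f x + g.grad h x := by
  refine g.ext_inner fun z => ?_
  rw [map_add, _root_.add_apply, inner_grad, inner_grad, inner_grad, mfderiv_add hf hh]
  rfl

theorem grad_const_smul (g : RMetric n M) {f : M → ℝ} {x : M} (c : ℝ)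
    (hf : MDifferentiableAt (𝓡 n) 𝓘(ℝ, ℝ) f x) :
    g.grad (c • f) x = c • g.grad f x := by
  refine g.ext_inner fun z => ?_
  rw [map_smul, _root_.smul_apply, inner_grad, inner_grad, const_smul_mfderiv hf]
  rfl

theorem grad_mul (g : RMetric n M) {f h : M → ℝ} {x : M}
    (hf : MDifferentiableAt (𝓡 n) 𝓘(ℝ, ℝ) f x) (hh : MDifferentiableAt (𝓡 n) 𝓘(ℝ, ℝ) h x) :
    g.grad (f * h) x = f x • g.grad h x + h x • g.grad f x := by
  refine g.ext_inner fun z => ?_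
  rw [map_add, _root_.add_apply, map_smul, map_smul, _root_.smul_apply, _root_.smul_apply,
    inner_grad, inner_grad, inner_grad,
    (hf.hasMFDerivAt.mul hh.hasMFDerivAt).mfderiv]
  rfl

/-- The gradient at `x` depends only on the germ of the function. -/
theorem grad_congr (g : RMetric n M) {f h : M → ℝ} {x : M} (hfh : f =ᶠ[𝓝 x] h) :
    g.grad f x = g.grad h x := by
  refine g.ext_inner fun z => ?_
  rw [inner_grad, inner_grad, hfh.mfderiv_eq]
  rfl

end ChartGeometry
end RMetric

namespace RMetric

section Volume

set_option linter.unusedSectionVars false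

variable {n : ℕ} {M : Type*} [TopologicalSpace M] [ChartedSpace (EuclideanSpace ℝ (Fin n)) M]
  [IsManifold (𝓡 n) ∞ M]

/-! ### The Riemannian volume in charts -/

theorem inner_eq_coordMetric (g : RMetric n M) (q : M) {x : M}
    (hx : x ∈ (chartAt (EuclideanSpace ℝ (Fin n)) q).source) (v w : TangentSpace (𝓡 n) x) :
    g.inner x v w = g.coordMetric q (chartAt (EuclideanSpace ℝ (Fin n)) q x)
      (chartMap q x v) (chartMap q x w) := by
  obtain ⟨u, hu, rfl⟩ : ∃ u ∈ (chartAt (EuclideanSpace ℝ (Fin n)) q).target,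
      (chartAt (EuclideanSpace ℝ (Fin n)) q).symm u = x :=
    ⟨_, (chartAt (EuclideanSpace ℝ (Fin n)) q).map_source hx,
      (chartAt (EuclideanSpace ℝ (Fin n)) q).left_inv hx⟩
  rw [(chartAt (EuclideanSpace ℝ (Fin n)) q).right_inv hu, coordMetric, coordMap_chartMap q hu,
    coordMap_chartMap q hu]

/-- The derivative of the change of coordinates from the chart at `p` to the chart at `q`. -/
noncomputable def transitionDeriv (p q : M) (u : EuclideanSpace ℝ (Fin n)) :
    EuclideanSpace ℝ (Fin n) →L[ℝ] EuclideanSpace ℝ (Fin n) :=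
  (chartMap q ((chartAt (EuclideanSpace ℝ (Fin n)) p).symm u)).comp (coordMap p u)

theorem hasFDerivAt_transition (p q : M) {u : EuclideanSpace ℝ (Fin n)}
    (hu : u ∈ (chartAt (EuclideanSpace ℝ (Fin n)) p).target)
    (hq : (chartAt (EuclideanSpace ℝ (Fin n)) p).symm u ∈
      (chartAt (EuclideanSpace ℝ (Fin n)) q).source) :
    HasFDerivAt (fun u => chartAt (EuclideanSpace ℝ (Fin n)) q
      ((chartAt (EuclideanSpace ℝ (Fin n)) p).symm u)) (transitionDeriv p q u) u := by
  have : IsManifold (𝓡 n) 1 M := isManifold_one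
  have h1 := (mdifferentiable_chart (I := 𝓡 n) q).mdifferentiableAt hq
  have h2 := (mdifferentiable_chart (I := 𝓡 n) p).mdifferentiableAt_symm hu
  exact (h1.hasMFDerivAt.comp u h2.hasMFDerivAt).hasFDerivAt

/-- The density of the Riemannian volume transforms with the absolute value of the Jacobian, because
the Gram matrices in two charts are congruent by the Jacobian matrix. -/
theorem sqrtDet_transition (g : RMetric n M) (p q : M) {u : EuclideanSpace ℝ (Fin n)}
    (hq : (chartAt (EuclideanSpace ℝ (Fin n)) p).symm u ∈
      (chartAt (EuclideanSpace ℝ (Fin n)) q).source) :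
    g.sqrtDet p u = |(transitionDeriv p q u).det| * g.sqrtDet q
      (chartAt (EuclideanSpace ℝ (Fin n)) q ((chartAt (EuclideanSpace ℝ (Fin n)) p).symm u)) := by
  set D := transitionDeriv p q u with hD
  set w := chartAt (EuclideanSpace ℝ (Fin n)) q ((chartAt (EuclideanSpace ℝ (Fin n)) p).symm u)
  set A : Matrix (Fin n) (Fin n) ℝ := LinearMap.toMatrix
    (EuclideanSpace.basisFun (Fin n) ℝ).toBasis (EuclideanSpace.basisFun (Fin n) ℝ).toBasis
      (D : EuclideanSpace ℝ (Fin n) →ₗ[ℝ] EuclideanSpace ℝ (Fin n)) with hA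
  have hAD : A.det = D.det := LinearMap.det_toMatrix _ _
  have hAij : ∀ i j, A i j = D (EuclideanSpace.single j (1 : ℝ)) i := fun i j => by
    simp [hA, LinearMap.toMatrix_apply]
  have hG : g.gram p u = A.transpose * g.gram q w * A := by
    ext i j
    have h1 : g.gram p u i j = g.coordMetric q w (D (EuclideanSpace.single i (1 : ℝ)))
        (D (EuclideanSpace.single j (1 : ℝ))) := g.inner_eq_coordMetric q hq _ _
    rw [h1, coordMetric_eq_sum]
    simp only [Matrix.mul_apply, Matrix.transpose_apply, hAij, Finset.sum_mul]
    rw [Finset.sum_comm]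
    exact Finset.sum_congr rfl fun i _ => Finset.sum_congr rfl fun j _ => by ring
  rw [sqrtDet_eq, sqrtDet_eq, hG, Matrix.det_mul, Matrix.det_mul, Matrix.det_transpose, hAD,
    show D.det * (g.gram q w).det * D.det = D.det ^ 2 * (g.gram q w).det by ring,
    Real.sqrt_mul (sq_nonneg _), Real.sqrt_sq_eq_abs]

variable [MeasurableSpace M] [BorelSpace M]

theorem measurableSet_target_inter_preimage (e : OpenPartialHomeomorph M (EuclideanSpace ℝ (Fin n)))
    {S : Set M} (hS : MeasurableSet S) : MeasurableSet (e.target ∩ e.symm ⁻¹' S) := by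
  have h : Measurable (e.target.domRestrict e.symm) := e.continuousOn_symm.domRestrict.measurable
  have h2 := (e.open_target.measurableSet).subtype_image (h hS)
  convert h2 using 1
  ext u
  simp [Set.domRestrict, and_comm]

theorem aemeasurable_chart_symm (e : OpenPartialHomeomorph M (EuclideanSpace ℝ (Fin n))) :
    AEMeasurable e.symm (volume.restrict e.target) :=
  e.continuousOn_symm.aemeasurable e.open_target.measurableSet

theorem chartVolume_apply (g : RMetric n M) (p : M) {S : Set M} (hS : MeasurableSet S) :
    g.chartVolume p S = ∫⁻ u in (chartAt (EuclideanSpace ℝ (Fin n)) p).target ∩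
      (chartAt (EuclideanSpace ℝ (Fin n)) p).symm ⁻¹' S, ENNReal.ofReal (g.sqrtDet p u) := by
  unfold chartVolume
  rw [Measure.map_apply_of_aemeasurable _ hS, withDensity_apply',
    Measure.restrict_restrict' (chartAt (EuclideanSpace ℝ (Fin n)) p).open_target.measurableSet,
    Set.inter_comm]
  exact (aemeasurable_chart_symm _).mono_ac (withDensity_absolutelyContinuous _ _)

theorem chartVolume_compl_source (g : RMetric n M) (p : M) :
    g.chartVolume p (chartAt (EuclideanSpace ℝ (Fin n)) p).sourceᶜ = 0 := by
  rw [chartVolume_apply _ _ (chartAt (EuclideanSpace ℝ (Fin n)) p).open_source.measurableSet.compl]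
  have : (chartAt (EuclideanSpace ℝ (Fin n)) p).target ∩
      (chartAt (EuclideanSpace ℝ (Fin n)) p).symm ⁻¹'
        (chartAt (EuclideanSpace ℝ (Fin n)) p).sourceᶜ = ∅ := by
    ext u
    simp only [Set.mem_inter_iff, Set.mem_preimage, Set.mem_compl_iff, Set.mem_empty_iff_false,
      iff_false, not_and, not_not]
    exact fun hu => (chartAt (EuclideanSpace ℝ (Fin n)) p).map_target hu
  rw [this]; simp

/-- On the overlap of two charts the two coordinate expressions of the volume agree: this is the
change of variables formula. -/
theorem chartVolume_eq_chartVolume (g : RMetric n M) (p q : M) {S : Set M} (hS : MeasurableSet S)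
    (hp : S ⊆ (chartAt (EuclideanSpace ℝ (Fin n)) p).source)
    (hq : S ⊆ (chartAt (EuclideanSpace ℝ (Fin n)) q).source) :
    g.chartVolume p S = g.chartVolume q S := by
  rw [chartVolume_apply _ _ hS, chartVolume_apply _ _ hS]
  set a := chartAt (EuclideanSpace ℝ (Fin n)) p
  set b := chartAt (EuclideanSpace ℝ (Fin n)) q
  have himg : b.target ∩ b.symm ⁻¹' S = (fun u => b (a.symm u)) '' (a.target ∩ a.symm ⁻¹' S) := by
    ext w
    constructor
    · rintro ⟨hw, hwS⟩
      refine ⟨a (b.symm w), ⟨a.map_source (hp hwS), ?_⟩, ?_⟩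
      · rw [Set.mem_preimage, a.left_inv (hp hwS)]; exact hwS
      · simp only [a.left_inv (hp hwS), b.right_inv hw]
    · rintro ⟨u, ⟨hu, huS⟩, rfl⟩
      refine ⟨b.map_source (hq huS), ?_⟩
      rw [Set.mem_preimage, b.left_inv (hq huS)]; exact huS
  rw [himg, lintegral_image_eq_lintegral_abs_det_fderiv_mul volume
    (measurableSet_target_inter_preimage a hS)
    (f' := fun u => transitionDeriv p q u)
    (fun u hu => (hasFDerivAt_transition p q hu.1 (hq hu.2)).hasFDerivWithinAt)]
  · refine setLIntegral_congr_fun (measurableSet_target_inter_preimage a hS) fun u hu => ?_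
    rw [← ENNReal.ofReal_mul (abs_nonneg _), g.sqrtDet_transition p q (hq hu.2)]
  · intro u hu v hv huv
    have h1 : a.symm u = a.symm v := b.injOn (hq hu.2) (hq hv.2) huv
    exact a.symm.injOn hu.1 hv.1 h1

theorem chartVolume_le_vol (g : RMetric n M) (p : M) : g.chartVolume p ≤ g.vol :=
  le_iSup (fun p => g.chartVolume p) p

/-- On the domain of a chart, the Riemannian volume is `√det (g_ij) du`. -/
theorem vol_restrict_source (g : RMetric n M) (p : M) :
    g.vol.restrict (chartAt (EuclideanSpace ℝ (Fin n)) p).source = g.chartVolume p := by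
  set U := (chartAt (EuclideanSpace ℝ (Fin n)) p).source
  have hU : MeasurableSet U := (chartAt (EuclideanSpace ℝ (Fin n)) p).open_source.measurableSet
  have hle : g.vol ≤ g.chartVolume p + g.vol.restrict Uᶜ := by
    refine iSup_le fun q => Measure.le_iff.2 fun S hS => ?_
    have hV : MeasurableSet (chartAt (EuclideanSpace ℝ (Fin n)) q).source :=
      (chartAt (EuclideanSpace ℝ (Fin n)) q).open_source.measurableSet
    rw [Measure.add_apply, Measure.restrict_apply hS, ← measure_inter_add_sdiff S hU]
    refine add_le_add ?_ (g.chartVolume_le_vol q _)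
    calc g.chartVolume q (S ∩ U)
        ≤ g.chartVolume q (S ∩ U ∩ (chartAt (EuclideanSpace ℝ (Fin n)) q).source) +
          g.chartVolume q (chartAt (EuclideanSpace ℝ (Fin n)) q).sourceᶜ := by
          refine (measure_mono fun x hx => ?_).trans (measure_union_le _ _)
          by_cases h : x ∈ (chartAt (EuclideanSpace ℝ (Fin n)) q).source
          · exact Or.inl ⟨hx, h⟩
          · exact Or.inr h
      _ = g.chartVolume p (S ∩ U ∩ (chartAt (EuclideanSpace ℝ (Fin n)) q).source) := by
          rw [chartVolume_compl_source, add_zero]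
          exact g.chartVolume_eq_chartVolume q p ((hS.inter hU).inter hV)
            (fun x hx => hx.2) (fun x hx => hx.1.2)
      _ ≤ g.chartVolume p S := measure_mono fun x hx => hx.1.1
  ext S hS
  rw [Measure.restrict_apply hS]
  refine le_antisymm ?_ ?_
  · refine (hle (S ∩ U)).trans ?_
    rw [Measure.add_apply, Measure.restrict_apply (hS.inter hU)]
    have : S ∩ U ∩ Uᶜ = ∅ := by
      rw [Set.inter_assoc, Set.inter_compl_self, Set.inter_empty]
    rw [this, measure_empty, add_zero]
    exact measure_mono Set.inter_subset_left
  · calc g.chartVolume p S ≤ g.chartVolume p (S ∩ U) + g.chartVolume p Uᶜ := by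
          refine (measure_mono fun x hx => ?_).trans (measure_union_le _ _)
          by_cases h : x ∈ U
          · exact Or.inl ⟨hx, h⟩
          · exact Or.inr h
      _ ≤ _ := by
          rw [chartVolume_compl_source, add_zero]
          exact g.chartVolume_le_vol p _

theorem vol_apply (g : RMetric n M) (p : M) {S : Set M} (hS : MeasurableSet S)
    (hp : S ⊆ (chartAt (EuclideanSpace ℝ (Fin n)) p).source) :
    g.vol S = ∫⁻ u in (chartAt (EuclideanSpace ℝ (Fin n)) p).target ∩
      (chartAt (EuclideanSpace ℝ (Fin n)) p).symm ⁻¹' S, ENNReal.ofReal (g.sqrtDet p u) := by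
  rw [← chartVolume_apply _ _ hS, ← vol_restrict_source, Measure.restrict_apply hS,
    Set.inter_eq_left.2 hp]

theorem isOpenPosMeasure_vol (g : RMetric n M) : g.vol.IsOpenPosMeasure := by
  refine ⟨fun W hW ⟨x, hx⟩ h0 => ?_⟩
  set e := chartAt (EuclideanSpace ℝ (Fin n)) x
  have hSo : IsOpen (W ∩ e.source) := hW.inter e.open_source
  have h1 : g.vol (W ∩ e.source) = 0 := measure_mono_null Set.inter_subset_left h0
  rw [g.vol_apply x hSo.measurableSet Set.inter_subset_right] at h1
  have hT : IsOpen (e.target ∩ e.symm ⁻¹' (W ∩ e.source)) :=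
    e.continuousOn_symm.isOpen_inter_preimage e.open_target hSo
  have hmem : e x ∈ e.target ∩ e.symm ⁻¹' (W ∩ e.source) := by
    refine ⟨mem_chart_target _ x, ?_⟩
    rw [Set.mem_preimage, e.left_inv (mem_chart_source _ x)]
    exact ⟨hx, mem_chart_source _ x⟩
  have hc : ContinuousOn (fun u => ENNReal.ofReal (g.sqrtDet x u))
      (e.target ∩ e.symm ⁻¹' (W ∩ e.source)) :=
    ENNReal.continuous_ofReal.comp_continuousOn
      ((g.contDiffOn_sqrtDet x).continuousOn.mono Set.inter_subset_left)
  rw [lintegral_eq_zero_iff' (hc.aemeasurable hT.measurableSet)] at h1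
  have h2 : ∀ᵐ u : EuclideanSpace ℝ (Fin n), u ∉ e.target ∩ e.symm ⁻¹' (W ∩ e.source) := by
    filter_upwards [(ae_restrict_iff' hT.measurableSet).1 h1] with u hu hmem
    have := hu hmem
    simp only [Pi.zero_apply, ENNReal.ofReal_eq_zero] at this
    exact absurd (g.sqrtDet_pos x hmem.1) (not_lt.2 this)
  have h3 : volume (e.target ∩ e.symm ⁻¹' (W ∩ e.source)) = 0 := by
    rw [measure_eq_zero_iff_ae_notMem]; exact h2
  exact (hT.measure_pos volume ⟨_, hmem⟩).ne' h3

theorem isLocallyFiniteMeasure_vol (g : RMetric n M) : IsLocallyFiniteMeasure g.vol := by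
  refine ⟨fun x => ?_⟩
  set e := chartAt (EuclideanSpace ℝ (Fin n)) x
  obtain ⟨K, hK, hxK, hKe⟩ :=
    exists_compact_subset e.open_target (mem_chart_target (EuclideanSpace ℝ (Fin n)) x)
  refine ⟨e.source ∩ e ⁻¹' (interior K), ?_, ?_⟩
  · exact (e.isOpen_inter_preimage isOpen_interior).mem_nhds ⟨mem_chart_source _ x, hxK⟩
  · have hm := (e.isOpen_inter_preimage (isOpen_interior (s := K))).measurableSet
    rw [g.vol_apply x hm Set.inter_subset_left]
    have hsub : e.target ∩ e.symm ⁻¹' (e.source ∩ e ⁻¹' (interior K)) ⊆ K := by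
      rintro u ⟨hu, -, hu'⟩
      rw [Set.mem_preimage, e.right_inv hu] at hu'
      exact interior_subset hu'
    refine (lintegral_mono_set hsub).trans_lt ?_
    have hc : ContinuousOn (fun u => g.sqrtDet x u) K :=
      (g.contDiffOn_sqrtDet x).continuousOn.mono hKe
    obtain ⟨C, hC⟩ := hK.exists_bound_of_continuousOn hc
    calc ∫⁻ u in K, ENNReal.ofReal (g.sqrtDet x u) ≤ ∫⁻ u in K, ENNReal.ofReal C := by
          refine setLIntegral_mono' hK.measurableSet fun u hu => ?_
          exact ENNReal.ofReal_le_ofReal ((le_abs_self _).trans (hC u hu))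
      _ < ⊤ := by
          rw [setLIntegral_const]
          exact ENNReal.mul_lt_top ENNReal.ofReal_lt_top hK.measure_lt_top

theorem lintegral_source (g : RMetric n M) (p : M) {h : M → ℝ≥0∞}
    (hh : AEMeasurable h (g.vol.restrict (chartAt (EuclideanSpace ℝ (Fin n)) p).source)) :
    ∫⁻ x in (chartAt (EuclideanSpace ℝ (Fin n)) p).source, h x ∂g.vol =
      ∫⁻ u in (chartAt (EuclideanSpace ℝ (Fin n)) p).target,
        ENNReal.ofReal (g.sqrtDet p u) *
          h ((chartAt (EuclideanSpace ℝ (Fin n)) p).symm u) := by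
  rw [vol_restrict_source] at hh ⊢
  unfold chartVolume at hh ⊢
  have hs := (aemeasurable_chart_symm (chartAt (EuclideanSpace ℝ (Fin n)) p)).mono_ac
    (withDensity_absolutelyContinuous _ fun u => ENNReal.ofReal (g.sqrtDet p u))
  have hd : AEMeasurable (fun u => ENNReal.ofReal (g.sqrtDet p u))
      (volume.restrict (chartAt (EuclideanSpace ℝ (Fin n)) p).target) :=
    ((g.contDiffOn_sqrtDet p).continuousOn.aemeasurable
      (chartAt (EuclideanSpace ℝ (Fin n)) p).open_target.measurableSet).ennreal_ofReal
  rw [lintegral_map' hh hs]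
  exact lintegral_withDensity_eq_lintegral_mul₀' hd (hh.comp_aemeasurable hs)

theorem integral_source (g : RMetric n M) (p : M) {h : M → ℝ}
    (hh : AEStronglyMeasurable h
      (g.vol.restrict (chartAt (EuclideanSpace ℝ (Fin n)) p).source)) :
    ∫ x in (chartAt (EuclideanSpace ℝ (Fin n)) p).source, h x ∂g.vol =
      ∫ u in (chartAt (EuclideanSpace ℝ (Fin n)) p).target,
        g.sqrtDet p u * h ((chartAt (EuclideanSpace ℝ (Fin n)) p).symm u) := by
  rw [vol_restrict_source] at hh ⊢
  unfold chartVolume at hh ⊢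
  have hs := (aemeasurable_chart_symm (chartAt (EuclideanSpace ℝ (Fin n)) p)).mono_ac
    (withDensity_absolutelyContinuous _ fun u => ENNReal.ofReal (g.sqrtDet p u))
  have hd : AEMeasurable (fun u => ENNReal.ofReal (g.sqrtDet p u))
      (volume.restrict (chartAt (EuclideanSpace ℝ (Fin n)) p).target) :=
    ((g.contDiffOn_sqrtDet p).continuousOn.aemeasurable
      (chartAt (EuclideanSpace ℝ (Fin n)) p).open_target.measurableSet).ennreal_ofReal
  rw [integral_map hs hh, integral_withDensity_eq_integral_toReal_smul₀ hd (by simp)]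
  refine integral_congr_ae (Eventually.of_forall fun u => ?_)
  simp only [smul_eq_mul]
  rw [ENNReal.toReal_ofReal (show 0 ≤ g.sqrtDet p u from Real.sqrt_nonneg _)]

end Volume
end RMetric

/-! ### Functions with compact support in an open set -/

section Euclid

variable {E : Type*} [NormedAddCommGroup E] [NormedSpace ℝ E]

theorem contDiff_indicator_of_isCompact {V K : Set E} (hV : IsOpen V) (hK : IsCompact K)
    (hKV : K ⊆ V) {w : E → ℝ} (hw : ContDiffOn ℝ ∞ w V) (h0 : ∀ u ∈ V, u ∉ K → w u = 0) :
    ContDiff ℝ ∞ (V.indicator w) := by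
  rw [contDiff_iff_contDiffAt]
  intro u
  by_cases hu : u ∈ V
  · refine ((hw u hu).contDiffAt (hV.mem_nhds hu)).congr_of_eventuallyEq ?_
    filter_upwards [hV.mem_nhds hu] with v hv using Set.indicator_of_mem hv w
  · refine (contDiffAt_const (c := (0 : ℝ))).congr_of_eventuallyEq ?_
    filter_upwards [hK.isClosed.isOpen_compl.mem_nhds fun h => hu (hKV h)] with v hv
    by_cases hvV : v ∈ V
    · rw [Set.indicator_of_mem hvV, h0 v hvV hv]
    · rw [Set.indicator_of_notMem hvV]

omit [NormedSpace ℝ E] in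
theorem hasCompactSupport_indicator {V K : Set E} (hK : IsCompact K)
    {w : E → ℝ} (h0 : ∀ u ∈ V, u ∉ K → w u = 0) : HasCompactSupport (V.indicator w) := by
  refine HasCompactSupport.intro hK fun u hu => ?_
  by_cases huV : u ∈ V
  · rw [Set.indicator_of_mem huV, h0 u huV hu]
  · rw [Set.indicator_of_notMem huV]

theorem fderiv_indicator_of_mem {V : Set E} (hV : IsOpen V) {w : E → ℝ} {u : E} (hu : u ∈ V) :
    fderiv ℝ (V.indicator w) u = fderiv ℝ w u :=
  Filter.EventuallyEq.fderiv_eq (by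
    filter_upwards [hV.mem_nhds hu] with v hv using Set.indicator_of_mem hv w)

theorem fderiv_eq_zero_of_hasCompactSupport_indicator {V K : Set E} (hK : IsCompact K)
    (hKV : K ⊆ V) {w : E → ℝ} (h0 : ∀ u ∈ V, u ∉ K → w u = 0) {u : E} (hu : u ∉ V) :
    fderiv ℝ (V.indicator w) u = 0 := by
  have h : V.indicator w =ᶠ[𝓝 u] fun _ => (0 : ℝ) := by
    filter_upwards [hK.isClosed.isOpen_compl.mem_nhds fun h => hu (hKV h)] with v hv
    by_cases hvV : v ∈ V
    · rw [Set.indicator_of_mem hvV, h0 v hvV hv]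
    · rw [Set.indicator_of_notMem hvV]
  rw [h.fderiv_eq]; simp

variable [MeasurableSpace E] [BorelSpace E] [FiniteDimensional ℝ E]

/-- Integration by parts against the constant function `1`. -/
theorem integral_fderiv_eq_zero (μ : Measure E) [μ.IsAddHaarMeasure] {w : E → ℝ}
    (hw : ContDiff ℝ ∞ w) (hc : HasCompactSupport w) (v : E) :
    ∫ u, fderiv ℝ w u v ∂μ = 0 := by
  have hd : Continuous fun u => fderiv ℝ w u v :=
    (hw.continuous_fderiv (by simp)).clm_apply continuous_const
  have hdc : HasCompactSupport fun u => fderiv ℝ w u v := hc.fderiv_apply ℝ v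
  have h := integral_mul_fderiv_eq_neg_fderiv_mul_of_integrable (μ := μ) (f := fun _ : E => (1 : ℝ))
    (g := w) (v := v) (by simp) (by simpa using hd.integrable_of_hasCompactSupport hdc)
    (by simpa using hw.continuous.integrable_of_hasCompactSupport hc)
    (fun x _ => differentiableAt_const _)
    (fun x _ => (hw.differentiable (by simp)).differentiableAt)
  simpa using h

/-- If `w` is smooth on the open set `V` and vanishes outside a compact subset of `V`, the integral
over `V` of a directional derivative of `w` is zero. -/
theorem setIntegral_fderiv_eq_zero (μ : Measure E) [μ.IsAddHaarMeasure] {V K : Set E}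
    (hV : IsOpen V) (hK : IsCompact K) (hKV : K ⊆ V) {w : E → ℝ} (hw : ContDiffOn ℝ ∞ w V)
    (h0 : ∀ u ∈ V, u ∉ K → w u = 0) (v : E) :
    ∫ u in V, fderiv ℝ w u v ∂μ = 0 := by
  have h := integral_fderiv_eq_zero μ (contDiff_indicator_of_isCompact hV hK hKV hw h0)
    (hasCompactSupport_indicator hK h0) v
  rw [← setIntegral_eq_integral_of_forall_compl_eq_zero (s := V) fun u hu => by
    rw [fderiv_eq_zero_of_hasCompactSupport_indicator hK hKV h0 hu]; rfl] at h
  rw [← h]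
  exact setIntegral_congr_fun hV.measurableSet fun u hu =>
    congrArg (fun L => L v) (fderiv_indicator_of_mem hV hu).symm

end Euclid

theorem continuous_mul_of_tsupport_subset {X : Type*} [TopologicalSpace X] {U : Set X}
    (hU : IsOpen U) {f h : X → ℝ} (hf : Continuous f) (hfU : tsupport f ⊆ U)
    (hh : ContinuousOn h U) : Continuous fun x => f x * h x :=
  continuous_of_tsupport fun _ hx => hf.continuousAt.mul
    (hh.continuousAt (hU.mem_nhds (hfU (tsupport_mul_subset_left hx))))

namespace RMetric

section Divergence

set_option linter.unusedSectionVars false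

variable {n : ℕ} {M : Type*} [TopologicalSpace M] [ChartedSpace (EuclideanSpace ℝ (Fin n)) M]
  [IsManifold (𝓡 n) ∞ M]

/-! ### The divergence theorem -/

/-- The compact set of coordinates, in the chart at `p`, of the points of the support of `f`. -/
theorem isCompact_chart_image [CompactSpace M] (p : M) {f : M → ℝ}
    (hf : tsupport f ⊆ (chartAt (EuclideanSpace ℝ (Fin n)) p).source) :
    IsCompact (chartAt (EuclideanSpace ℝ (Fin n)) p '' tsupport f) :=
  (isClosed_tsupport f).isCompact.image_of_continuousOn
    ((chartAt (EuclideanSpace ℝ (Fin n)) p).continuousOn.mono hf)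

theorem chart_image_subset (p : M) {f : M → ℝ}
    (hf : tsupport f ⊆ (chartAt (EuclideanSpace ℝ (Fin n)) p).source) :
    chartAt (EuclideanSpace ℝ (Fin n)) p '' tsupport f ⊆
      (chartAt (EuclideanSpace ℝ (Fin n)) p).target := by
  rintro _ ⟨x, hx, rfl⟩
  exact (chartAt (EuclideanSpace ℝ (Fin n)) p).map_source (hf hx)

theorem eq_zero_of_notMem_chart_image (p : M) {f : M → ℝ} {u : EuclideanSpace ℝ (Fin n)}
    (hu : u ∈ (chartAt (EuclideanSpace ℝ (Fin n)) p).target)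
    (hK : u ∉ chartAt (EuclideanSpace ℝ (Fin n)) p '' tsupport f) :
    f ((chartAt (EuclideanSpace ℝ (Fin n)) p).symm u) = 0 := by
  by_contra h
  exact hK ⟨_, subset_tsupport f h, (chartAt (EuclideanSpace ℝ (Fin n)) p).right_inv hu⟩

theorem grad_const (g : RMetric n M) (c : ℝ) (x : M) : g.grad (fun _ => c) x = 0 := by
  refine g.ext_inner fun z => ?_
  rw [inner_grad, mfderiv_const, map_zero]
  rfl

/-- The divergence of a vector field computed in the chart at `p`. -/
noncomputable def chartDivergence (g : RMetric n M) (p : M) (X : ∀ x : M, TangentSpace (𝓡 n) x)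
    (x : M) : ℝ :=
  (g.sqrtDet p (chartAt (EuclideanSpace ℝ (Fin n)) p x))⁻¹ *
    ∑ i : Fin n, fderiv ℝ
      (fun u => g.sqrtDet p u *
        components p X ((chartAt (EuclideanSpace ℝ (Fin n)) p).symm u) i)
      (chartAt (EuclideanSpace ℝ (Fin n)) p x) (EuclideanSpace.single i (1 : ℝ))

theorem contDiffOn_sqrtDet_mul_components (g : RMetric n M) {f : M → ℝ}
    (hf : ContMDiff (𝓡 n) 𝓘(ℝ, ℝ) ∞ f) (p : M) (i : Fin n) :
    ContDiffOn ℝ ∞ (fun u => g.sqrtDet p u *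
        components p (g.grad f) ((chartAt (EuclideanSpace ℝ (Fin n)) p).symm u) i)
      (chartAt (EuclideanSpace ℝ (Fin n)) p).target :=
  (g.contDiffOn_sqrtDet p).mul (g.contDiffOn_components_grad hf p i)

theorem continuousOn_chartDivergence_grad (g : RMetric n M) {f : M → ℝ}
    (hf : ContMDiff (𝓡 n) 𝓘(ℝ, ℝ) ∞ f) (p : M) :
    ContinuousOn (g.chartDivergence p (g.grad f))
      (chartAt (EuclideanSpace ℝ (Fin n)) p).source := by
  set e := chartAt (EuclideanSpace ℝ (Fin n)) p with he
  have h : ContinuousOn (fun u => (g.sqrtDet p u)⁻¹ *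
      ∑ i : Fin n, fderiv ℝ (fun u => g.sqrtDet p u * components p (g.grad f) (e.symm u) i) u
        (EuclideanSpace.single i (1 : ℝ))) e.target := by
    refine ((g.contDiffOn_sqrtDet p).continuousOn.inv₀ fun u hu => (g.sqrtDet_pos p hu).ne').mul
      (continuousOn_finsetSum _ fun i _ => ?_)
    exact (((g.contDiffOn_sqrtDet_mul_components hf p i).fderiv_of_isOpen (m := ∞)
      e.open_target (by simp)).clm_apply contDiffOn_const).continuousOn
  exact h.comp e.continuousOn fun x hx => e.map_source hx

variable [MeasurableSpace M] [BorelSpace M]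

theorem secondCountableTopology (n : ℕ) (M : Type*) [TopologicalSpace M]
    [ChartedSpace (EuclideanSpace ℝ (Fin n)) M] [CompactSpace M] : SecondCountableTopology M :=
  ChartedSpace.secondCountable_of_sigmaCompact (EuclideanSpace ℝ (Fin n)) M

/-- Integration by parts in one chart. -/
theorem integral_mul_chartDivergence_grad [CompactSpace M] (g : RMetric n M) (p : M) {η ψ : M → ℝ}
    (hη : ContMDiff (𝓡 n) 𝓘(ℝ, ℝ) ∞ η) (hψ : ContMDiff (𝓡 n) 𝓘(ℝ, ℝ) ∞ ψ)
    (hηp : tsupport η ⊆ (chartAt (EuclideanSpace ℝ (Fin n)) p).source) :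
    ∫ x, η x * g.chartDivergence p (g.grad ψ) x ∂g.vol =
      -∫ x, g.inner x (g.grad η x) (g.grad ψ x) ∂g.vol := by
  set e := chartAt (EuclideanSpace ℝ (Fin n)) p with he
  have hV := e.open_target
  have hK := isCompact_chart_image p hηp
  have hKV := chart_image_subset p hηp
  set Y : Fin n → EuclideanSpace ℝ (Fin n) → ℝ := fun i u =>
    g.sqrtDet p u * components p (g.grad ψ) (e.symm u) i with hY
  have hYs : ∀ i, ContDiffOn ℝ ∞ (Y i) e.target := g.contDiffOn_sqrtDet_mul_components hψ p
  set f : EuclideanSpace ℝ (Fin n) → ℝ := fun u => η (e.symm u) with hf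
  have hfs : ContDiffOn ℝ ∞ f e.target := contDiffOn_comp_chart_symm hη p
  have hf0 : ∀ u ∈ e.target, u ∉ e '' tsupport η → f u = 0 := fun u hu hKu =>
    eq_zero_of_notMem_chart_image p hu hKu
  have hout : ∀ x ∉ e.source, η x = 0 := fun x hx =>
    image_eq_zero_of_notMem_tsupport fun h => hx (hηp h)
  have hgout : ∀ x ∉ e.source, g.grad η x = 0 := fun x hx => by
    have h0 : η =ᶠ[𝓝 x] fun _ => (0 : ℝ) :=
      notMem_tsupport_iff_eventuallyEq.1 fun h => hx (hηp h)
    rw [g.grad_congr h0, grad_const]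
  have h1 : ∫ x, η x * g.chartDivergence p (g.grad ψ) x ∂g.vol =
      ∫ u in e.target, ∑ i, f u * fderiv ℝ (Y i) u (EuclideanSpace.single i (1 : ℝ)) := by
    rw [← setIntegral_eq_integral_of_forall_compl_eq_zero (s := e.source)
      (fun x hx => by rw [hout x hx, zero_mul]), he, integral_source]
    · refine setIntegral_congr_fun hV.measurableSet fun u hu => ?_
      simp only [chartDivergence]
      rw [(chartAt (EuclideanSpace ℝ (Fin n)) p).right_inv hu, mul_left_comm (η _), ← mul_assoc,
        mul_inv_cancel₀ (g.sqrtDet_pos p hu).ne', one_mul, Finset.mul_sum]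
    · exact (hη.continuous.continuousOn.mul
        (g.continuousOn_chartDivergence_grad hψ p)).aestronglyMeasurable
          e.open_source.measurableSet
  have h2 : ∫ x, g.inner x (g.grad η x) (g.grad ψ x) ∂g.vol =
      ∫ u in e.target, ∑ i, fderiv ℝ f u (EuclideanSpace.single i (1 : ℝ)) * Y i u := by
    rw [← setIntegral_eq_integral_of_forall_compl_eq_zero (s := e.source)
      (fun x hx => by rw [hgout x hx]; simp), he, integral_source]
    · refine setIntegral_congr_fun hV.measurableSet fun u hu => ?_
      rw [← coordMap_components p (g.grad ψ) hu, ← g.fderiv_comp_chart_symm_eq_inner hη p hu]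
      conv_lhs => rw [← (EuclideanSpace.basisFun (Fin n) ℝ).sum_repr
        (components p (g.grad ψ) ((chartAt (EuclideanSpace ℝ (Fin n)) p).symm u))]
      simp only [map_sum, map_smul, smul_eq_mul, EuclideanSpace.basisFun_apply,
        EuclideanSpace.basisFun_repr, Finset.mul_sum, hY, hf]
      exact Finset.sum_congr rfl fun i _ => by ring
    · exact (g.continuous_inner_grad hη hψ).continuousOn.aestronglyMeasurable
        e.open_source.measurableSet
  have hprod : ∀ i, ∀ u ∈ e.target, fderiv ℝ (fun u => f u * Y i u) u
      (EuclideanSpace.single i (1 : ℝ)) =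
        f u * fderiv ℝ (Y i) u (EuclideanSpace.single i (1 : ℝ)) +
        fderiv ℝ f u (EuclideanSpace.single i (1 : ℝ)) * Y i u := by
    intro i u hu
    have d1 : DifferentiableAt ℝ f u :=
      ((hfs u hu).contDiffAt (hV.mem_nhds hu)).differentiableAt (by simp)
    have d2 : DifferentiableAt ℝ (Y i) u :=
      ((hYs i u hu).contDiffAt (hV.mem_nhds hu)).differentiableAt (by simp)
    rw [fderiv_fun_mul d1 d2]
    simp only [_root_.add_apply, _root_.smul_apply, smul_eq_mul]
    ring
  -- both integrands vanish outside the compact set `e '' tsupport η`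
  have hint : ∀ w : EuclideanSpace ℝ (Fin n) → ℝ, ContinuousOn w e.target →
      (∀ u ∈ e.target, u ∉ e '' tsupport η → w u = 0) → IntegrableOn w e.target := by
    intro w hw h0
    refine ((hw.mono hKV).integrableOn_compact hK).of_forall_sdiff_eq_zero
      hV.measurableSet fun u hu => h0 u hu.1 hu.2
  have hfd0 : ∀ u ∈ e.target, u ∉ e '' tsupport η → fderiv ℝ f u = 0 := by
    intro u hu hKu
    have h0 : f =ᶠ[𝓝 u] fun _ => (0 : ℝ) := by
      filter_upwards [hV.mem_nhds hu, hK.isClosed.isOpen_compl.mem_nhds hKu] with v hv hv'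
      exact hf0 v hv hv'
    rw [h0.fderiv_eq]; simp
  have hi1 : ∀ i, IntegrableOn
      (fun u => f u * fderiv ℝ (Y i) u (EuclideanSpace.single i (1 : ℝ))) e.target := fun i =>
    hint _ (hfs.continuousOn.mul (((hYs i).fderiv_of_isOpen (m := ∞) hV
      (by simp)).clm_apply contDiffOn_const).continuousOn)
      fun u hu hKu => by rw [hf0 u hu hKu, zero_mul]
  have hi2 : ∀ i, IntegrableOn
      (fun u => fderiv ℝ f u (EuclideanSpace.single i (1 : ℝ)) * Y i u) e.target := fun i =>
    hint _ (((hfs.fderiv_of_isOpen (m := ∞) hV (by simp)).clm_apply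
      contDiffOn_const).continuousOn.mul (hYs i).continuousOn)
      fun u hu hKu => by rw [hfd0 u hu hKu]; simp
  rw [h1, h2, integral_finsetSum _ fun i _ => hi1 i, integral_finsetSum _ fun i _ => hi2 i,
    eq_neg_iff_add_eq_zero, ← Finset.sum_add_distrib]
  refine Finset.sum_eq_zero fun i _ => ?_
  rw [← integral_add (hi1 i) (hi2 i), ← setIntegral_fderiv_eq_zero volume hV hK hKV
    (hfs.mul (hYs i)) (fun u hu hKu => by rw [hf0 u hu hKu, zero_mul])
    (EuclideanSpace.single i (1 : ℝ))]
  exact setIntegral_congr_fun hV.measurableSet fun u hu => (hprod i u hu).symm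

theorem isFiniteMeasure_vol [CompactSpace M] (g : RMetric n M) : IsFiniteMeasure g.vol :=
  have := g.isLocallyFiniteMeasure_vol
  CompactSpace.isFiniteMeasure

variable [T2Space M] [CompactSpace M]

theorem _root_.Continuous.integrable_vol {g : RMetric n M} {f : M → ℝ} (hf : Continuous f) :
    Integrable f g.vol :=
  have := g.isLocallyFiniteMeasure_vol
  hf.integrable_of_hasCompactSupport (HasCompactSupport.of_compactSpace f)

/-- The divergence of a gradient does not depend on the chart: by `integral_mul_chartDivergence_grad`
both expressions have the same integral against every test function supported in the overlap. -/
theorem chartDivergence_grad_eq (g : RMetric n M) {ψ : M → ℝ}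
    (hψ : ContMDiff (𝓡 n) 𝓘(ℝ, ℝ) ∞ ψ) (p q : M) {x : M}
    (hp : x ∈ (chartAt (EuclideanSpace ℝ (Fin n)) p).source)
    (hq : x ∈ (chartAt (EuclideanSpace ℝ (Fin n)) q).source) :
    g.chartDivergence p (g.grad ψ) x = g.chartDivergence q (g.grad ψ) x := by
  have := g.isLocallyFiniteMeasure_vol
  have := g.isOpenPosMeasure_vol
  have : SecondCountableTopology M := secondCountableTopology n M
  set a := chartAt (EuclideanSpace ℝ (Fin n)) p
  set b := chartAt (EuclideanSpace ℝ (Fin n)) q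
  have hO : IsOpen (a.source ∩ b.source) := a.open_source.inter b.open_source
  have hca : ContinuousOn (g.chartDivergence p (g.grad ψ)) (a.source ∩ b.source) :=
    (g.continuousOn_chartDivergence_grad hψ p).mono Set.inter_subset_left
  have hcb : ContinuousOn (g.chartDivergence q (g.grad ψ)) (a.source ∩ b.source) :=
    (g.continuousOn_chartDivergence_grad hψ q).mono Set.inter_subset_right
  have hae := hO.ae_eq_zero_of_integral_contMDiff_smul_eq_zero (𝓡 n) (μ := g.vol)
    (f := fun x => g.chartDivergence p (g.grad ψ) x - g.chartDivergence q (g.grad ψ) x)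
    ((hca.sub hcb).locallyIntegrableOn hO.measurableSet) (by
      intro η hη _ hsupp
      have e1 := continuous_mul_of_tsupport_subset hO hη.continuous hsupp hca
      have e2 := continuous_mul_of_tsupport_subset hO hη.continuous hsupp hcb
      simp only [smul_eq_mul, mul_sub]
      rw [integral_sub e1.integrable_vol e2.integrable_vol,
        g.integral_mul_chartDivergence_grad p hη hψ (hsupp.trans Set.inter_subset_left),
        g.integral_mul_chartDivergence_grad q hη hψ (hsupp.trans Set.inter_subset_right),
        sub_self])
  refine Measure.eqOn_open_of_ae_eq (μ := g.vol) ?_ hO hca hcb ⟨hp, hq⟩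
  refine (ae_restrict_iff' hO.measurableSet).2 ?_
  filter_upwards [hae] with y hy hyO
  exact sub_eq_zero.1 (hy hyO)

theorem laplacian_eq_chartDivergence (g : RMetric n M) {ψ : M → ℝ}
    (hψ : ContMDiff (𝓡 n) 𝓘(ℝ, ℝ) ∞ ψ) (p : M) {x : M}
    (hp : x ∈ (chartAt (EuclideanSpace ℝ (Fin n)) p).source) :
    g.laplacian ψ x = g.chartDivergence p (g.grad ψ) x :=
  g.chartDivergence_grad_eq hψ x p (mem_chart_source _ x) hp

theorem continuous_laplacian (g : RMetric n M) {ψ : M → ℝ}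
    (hψ : ContMDiff (𝓡 n) 𝓘(ℝ, ℝ) ∞ ψ) : Continuous (g.laplacian ψ) := by
  rw [continuous_iff_continuousAt]
  intro p
  have ho := (chartAt (EuclideanSpace ℝ (Fin n)) p).open_source.mem_nhds (mem_chart_source _ p)
  refine ((g.continuousOn_chartDivergence_grad hψ p).continuousAt ho).congr ?_
  filter_upwards [ho] with x hx using (g.laplacian_eq_chartDivergence hψ p hx).symm

variable (n M) in
/-- A finite smooth partition of unity subordinate to the atlas. -/
theorem exists_partitionOfUnity : ∃ (t : Finset M) (ρ : M → M → ℝ),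
    (∀ p, ContMDiff (𝓡 n) 𝓘(ℝ, ℝ) ∞ (ρ p)) ∧
    (∀ p, tsupport (ρ p) ⊆ (chartAt (EuclideanSpace ℝ (Fin n)) p).source) ∧
    ∀ x, ∑ p ∈ t, ρ p x = 1 := by
  obtain ⟨f, hf⟩ := SmoothPartitionOfUnity.exists_isSubordinate (𝓡 n) (isClosed_univ (X := M))
    (fun p : M => (chartAt (EuclideanSpace ℝ (Fin n)) p).source)
    (fun p => (chartAt (EuclideanSpace ℝ (Fin n)) p).open_source)
    (fun x _ => Set.mem_iUnion.2 ⟨x, mem_chart_source _ x⟩)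
  have hfin := f.locallyFinite.finite_nonempty_of_compact
  refine ⟨hfin.toFinset, fun p => f p, fun p => (f p).contMDiff, fun p => hf p, fun x => ?_⟩
  rw [← f.sum_eq_one (Set.mem_univ x)]
  refine (finsum_eq_sum_of_support_subset _ fun p hp => ?_).symm
  simp only [Set.Finite.coe_toFinset, Set.mem_ofPred_eq]
  exact ⟨x, hp⟩

theorem mdifferentiableAt_of_smooth {f : M → ℝ} (hf : ContMDiff (𝓡 n) 𝓘(ℝ, ℝ) ∞ f) (x : M) :
    MDifferentiableAt (𝓡 n) 𝓘(ℝ, ℝ) f x := hf.mdifferentiableAt (by simp)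

/-- Green's formula on a compact manifold without boundary. -/
theorem integral_mul_laplacian (g : RMetric n M) {f ψ : M → ℝ}
    (hf : ContMDiff (𝓡 n) 𝓘(ℝ, ℝ) ∞ f) (hψ : ContMDiff (𝓡 n) 𝓘(ℝ, ℝ) ∞ ψ) :
    ∫ x, f x * g.laplacian ψ x ∂g.vol = -∫ x, g.inner x (g.grad f x) (g.grad ψ x) ∂g.vol := by
  obtain ⟨t, ρ, hρ, hsupp, hsum⟩ := exists_partitionOfUnity n M
  have hρf : ∀ p, ContMDiff (𝓡 n) 𝓘(ℝ, ℝ) ∞ (ρ p * f) := fun p => (hρ p).mul hf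
  have hs : ∀ p, tsupport (ρ p * f) ⊆ (chartAt (EuclideanSpace ℝ (Fin n)) p).source := fun p =>
    tsupport_mul_subset_left.trans (hsupp p)
  have hloc : ∀ p, ∫ x, (ρ p * f) x * g.laplacian ψ x ∂g.vol =
      -∫ x, g.inner x (g.grad (ρ p * f) x) (g.grad ψ x) ∂g.vol := by
    intro p
    rw [← g.integral_mul_chartDivergence_grad p (hρf p) hψ (hs p)]
    refine integral_congr_ae (Eventually.of_forall fun x => ?_)
    by_cases hx : x ∈ (chartAt (EuclideanSpace ℝ (Fin n)) p).source
    · simp only [g.laplacian_eq_chartDivergence hψ p hx]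
    · have h0 : (ρ p * f) x = 0 := image_eq_zero_of_notMem_tsupport fun h => hx (hs p h)
      simp only [h0, zero_mul]
  have hgsum : ∀ x, ∑ p ∈ t, g.inner x (g.grad (ρ p * f) x) (g.grad ψ x) =
      g.inner x (g.grad f x) (g.grad ψ x) := by
    intro x
    have h1 : f = ∑ p ∈ t, ρ p * f := by
      ext y
      rw [Finset.sum_apply]
      simp only [Pi.mul_apply]
      rw [← Finset.sum_mul, hsum, one_mul]
    have h2 : ∀ s : Finset M, ContMDiff (𝓡 n) 𝓘(ℝ, ℝ) ∞ (∑ p ∈ s, ρ p * f) ∧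
        g.grad (∑ p ∈ s, ρ p * f) x = ∑ p ∈ s, g.grad (ρ p * f) x := by
      classical
      intro s
      induction s using Finset.induction_on with
      | empty =>
        simp only [Finset.sum_empty]
        exact ⟨contMDiff_const, g.grad_const 0 x⟩
      | insert a s ha ih =>
        rw [Finset.sum_insert ha, Finset.sum_insert ha]
        refine ⟨(hρf a).add ih.1, ?_⟩
        rw [g.grad_add (mdifferentiableAt_of_smooth (hρf a) x)
          (mdifferentiableAt_of_smooth ih.1 x), ih.2]
    conv_rhs => rw [h1, (h2 t).2]
    rw [map_sum, _root_.sum_apply]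
  have hL : ∀ x, f x * g.laplacian ψ x = ∑ p ∈ t, (ρ p * f) x * g.laplacian ψ x := by
    intro x
    simp only [Pi.mul_apply]
    rw [← Finset.sum_mul, ← Finset.sum_mul, hsum, one_mul]
  simp_rw [hL, ← hgsum]
  rw [integral_finsetSum, integral_finsetSum, ← Finset.sum_neg_distrib]
  · exact Finset.sum_congr rfl fun p _ => hloc p
  · exact fun p _ => (g.continuous_inner_grad (hρf p) hψ).integrable_vol
  · exact fun p _ => ((hρf p).continuous.mul (g.continuous_laplacian hψ)).integrable_vol

end Divergence
end RMetric

/-! ### A compactness inequality in Euclidean space -/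

/-- The Cauchy–Schwarz inequality for real functions. -/
theorem sq_integral_mul_le {α : Type*} [MeasurableSpace α] {μ : Measure α} {f h : α → ℝ}
    (hf : Integrable (fun x => f x ^ 2) μ) (hh : Integrable (fun x => h x ^ 2) μ)
    (hfh : Integrable (fun x => f x * h x) μ) :
    (∫ x, f x * h x ∂μ) ^ 2 ≤ (∫ x, f x ^ 2 ∂μ) * ∫ x, h x ^ 2 ∂μ := by
  have key : ∀ t : ℝ, 0 ≤ (∫ x, f x ^ 2 ∂μ) * (t * t) + (2 * ∫ x, f x * h x ∂μ) * t +
      ∫ x, h x ^ 2 ∂μ := by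
    intro t
    have e : (∫ x, f x ^ 2 ∂μ) * (t * t) + (2 * ∫ x, f x * h x ∂μ) * t + ∫ x, h x ^ 2 ∂μ =
        ∫ x, (t * f x + h x) ^ 2 ∂μ := by
      have : ∀ x, (t * f x + h x) ^ 2 = t * t * f x ^ 2 + 2 * t * (f x * h x) + h x ^ 2 :=
        fun x => by ring
      simp_rw [this]
      rw [integral_add (f := fun x => t * t * f x ^ 2 + 2 * t * (f x * h x))
          ((hf.const_mul _).add (hfh.const_mul _)) hh,
        integral_add (hf.const_mul _) (hfh.const_mul _), integral_const_mul, integral_const_mul]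
      ring
    rw [e]
    exact integral_nonneg fun x => sq_nonneg _
  have := discrim_le_zero key
  unfold discrim at this
  nlinarith

section Rellich

variable {n : ℕ}

local notation "𝔼" => EuclideanSpace ℝ (Fin n)

open scoped FourierTransform RealInnerProductSpace LineDeriv

theorem abs_cos_sub_cos_le (a b : ℝ) : |Real.cos a - Real.cos b| ≤ |a - b| := by
  have h := Convex.norm_image_sub_le_of_norm_deriv_le (f := Real.cos) (C := 1) (s := Set.univ)
    (x := b) (y := a) (fun x _ => Real.differentiable_cos x)
    (fun x _ => by simpa using Real.abs_sin_le_one x) convex_univ trivial trivial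
  simpa using h

theorem abs_sin_sub_sin_le (a b : ℝ) : |Real.sin a - Real.sin b| ≤ |a - b| := by
  have h := Convex.norm_image_sub_le_of_norm_deriv_le (f := Real.sin) (C := 1) (s := Set.univ)
    (x := b) (y := a) (fun x _ => Real.differentiable_sin x)
    (fun x _ => by simpa using Real.abs_cos_le_one x) convex_univ trivial trivial
  simpa using h

theorem integrable_norm_sq_schwartz (G : SchwartzMap 𝔼 ℂ) : Integrable fun ξ => ‖G ξ‖ ^ 2 := by
  have := (G.memLp 2 volume).integrable_norm_pow (p := 2) (by norm_num)
  simpa using this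

/-- The Fourier transform turns `∂ᵢ` into multiplication by `2πi ξᵢ`; the factor `2π ≥ 1` is dropped. -/
theorem norm_sq_mul_norm_sq_fourier_le (H : SchwartzMap 𝔼 ℂ) (ξ : 𝔼) :
    ‖ξ‖ ^ 2 * ‖(𝓕 H) ξ‖ ^ 2 ≤
      ∑ i : Fin n, ‖(𝓕 (∂_{EuclideanSpace.single i (1 : ℝ)} H)) ξ‖ ^ 2 := by
  rw [EuclideanSpace.norm_sq_eq, Finset.sum_mul]
  refine Finset.sum_le_sum fun i _ => ?_
  have ht : (inner ℝ · (EuclideanSpace.single i (1 : ℝ)) : 𝔼 → ℝ).HasTemperateGrowth :=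
    ((innerSL ℝ).flip (EuclideanSpace.single i (1 : ℝ))).hasTemperateGrowth
  rw [SchwartzMap.fourier_lineDerivOp_eq, _root_.smul_apply,
    SchwartzMap.smulLeftCLM_apply_apply ht, norm_smul, norm_smul, mul_pow, mul_pow]
  have e1 : ‖(⟪ξ, EuclideanSpace.single i (1 : ℝ)⟫ : ℝ)‖ = ‖ξ i‖ := by
    rw [EuclideanSpace.inner_single_right]; simp
  rw [e1]
  have e2 : 1 ≤ ‖(2 * Real.pi * Complex.I : ℂ)‖ ^ 2 := by
    have : ‖(2 * Real.pi * Complex.I : ℂ)‖ = 2 * Real.pi := by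
      simp [abs_of_pos Real.pi_pos]
    rw [this]
    nlinarith [Real.pi_gt_three]
  exact le_mul_of_one_le_left (by positivity) e2

/-- Chebyshev's inequality for the second moment, outside a ball of radius `R`. -/
theorem integral_compl_closedBall_le {F : 𝔼 → ℝ} {S : 𝔼 → ℝ} (hF : Integrable F)
    (hF0 : ∀ ξ, 0 ≤ F ξ) (hS : Integrable S) (hFS : ∀ ξ, ‖ξ‖ ^ 2 * F ξ ≤ S ξ)
    {R : ℝ} (hR : 0 < R) :
    ∫ ξ in (Metric.closedBall (0 : 𝔼) R)ᶜ, F ξ ≤ 1 / R ^ 2 * ∫ ξ, S ξ := by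
  have hS0 : ∀ ξ, 0 ≤ S ξ := fun ξ => (mul_nonneg (sq_nonneg _) (hF0 ξ)).trans (hFS ξ)
  rw [← integral_const_mul]
  calc ∫ ξ in (Metric.closedBall (0 : 𝔼) R)ᶜ, F ξ
      ≤ ∫ ξ in (Metric.closedBall (0 : 𝔼) R)ᶜ, 1 / R ^ 2 * S ξ := by
        refine setIntegral_mono_on hF.integrableOn (hS.const_mul _).integrableOn
          measurableSet_closedBall.compl fun ξ hξ => ?_
        have hξR : R ≤ ‖ξ‖ := by
          simp only [Set.mem_compl_iff, Metric.mem_closedBall, dist_zero_right, not_le] at hξ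
          exact hξ.le
        rw [div_mul_eq_mul_div, one_mul, le_div_iff₀ (by positivity)]
        refine le_trans ?_ (hFS ξ)
        rw [mul_comm]
        have := hF0 ξ
        gcongr
    _ ≤ ∫ ξ, 1 / R ^ 2 * S ξ :=
        setIntegral_le_integral (hS.const_mul _)
          (Eventually.of_forall fun ξ => mul_nonneg (by positivity) (hS0 ξ))

theorem integral_norm_sq_fourier_compl_closedBall_le (H : SchwartzMap 𝔼 ℂ) {R : ℝ} (hR : 0 < R) :
    ∫ ξ in (Metric.closedBall (0 : 𝔼) R)ᶜ, ‖(𝓕 H) ξ‖ ^ 2 ≤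
      1 / R ^ 2 * ∑ i : Fin n, ∫ u, ‖(∂_{EuclideanSpace.single i (1 : ℝ)} H) u‖ ^ 2 := by
  have hi : ∀ i : Fin n, Integrable fun ξ =>
      ‖(𝓕 (∂_{EuclideanSpace.single i (1 : ℝ)} H)) ξ‖ ^ 2 := fun i =>
    integrable_norm_sq_schwartz (𝓕 (∂_{EuclideanSpace.single i (1 : ℝ)} H))
  have h := integral_compl_closedBall_le (integrable_norm_sq_schwartz (𝓕 H))
    (fun ξ => sq_nonneg _) (integrable_finsetSum Finset.univ fun i _ => hi i)
    (norm_sq_mul_norm_sq_fourier_le H) hR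
  rw [integral_finsetSum Finset.univ fun i _ => hi i] at h
  refine h.trans (le_of_eq ?_)
  congr 1
  exact Finset.sum_congr rfl fun i _ => SchwartzMap.integral_norm_sq_fourier _

/-- The Fourier transform of a real function, in terms of its cosine and sine transforms. Only real
linear functionals of the function appear on the right-hand side. -/
theorem norm_sq_fourier_ofReal {h : 𝔼 → ℝ} (hcont : Continuous h) (hc : HasCompactSupport h)
    (ξ : 𝔼) : ‖(𝓕 (fun u => (h u : ℂ))) ξ‖ ^ 2 =
      (∫ v, Real.cos (2 * Real.pi * ⟪v, ξ⟫) * h v) ^ 2 +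
        (∫ v, Real.sin (2 * Real.pi * ⟪v, ξ⟫) * h v) ^ 2 := by
  have ic : Integrable fun v : 𝔼 => Real.cos (2 * Real.pi * ⟪v, ξ⟫) * h v :=
    Continuous.integrable_of_hasCompactSupport (by fun_prop) hc.mul_left
  have is : Integrable fun v : 𝔼 => Real.sin (2 * Real.pi * ⟪v, ξ⟫) * h v :=
    Continuous.integrable_of_hasCompactSupport (by fun_prop) hc.mul_left
  have e : (𝓕 (fun u => (h u : ℂ))) ξ =
      ((∫ v, Real.cos (2 * Real.pi * ⟪v, ξ⟫) * h v : ℝ) : ℂ) -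
        ((∫ v, Real.sin (2 * Real.pi * ⟪v, ξ⟫) * h v : ℝ) : ℂ) * Complex.I := by
    rw [Real.fourier_eq', ← integral_complex_ofReal,
      ← integral_complex_ofReal, ← integral_mul_const, ← integral_sub ic.ofReal
        (is.ofReal.mul_const _)]
    refine integral_congr_ae (Eventually.of_forall fun v => ?_)
    simp only [smul_eq_mul]
    rw [Complex.exp_mul_I, show (-2 * Real.pi * ⟪v, ξ⟫) = -(2 * Real.pi * ⟪v, ξ⟫) by ring,
      Complex.ofReal_neg, Complex.cos_neg, Complex.sin_neg]
    push_cast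
    ring
  rw [e, Complex.sq_norm, Complex.normSq_apply]
  simp
  ring

/-- Plancherel's theorem bounds the part of the `L²` norm carried by frequencies beyond `R` by the
gradient. -/
theorem integral_sq_le_low_frequency {h : 𝔼 → ℝ} (hs : ContDiff ℝ ∞ h)
    (hc : HasCompactSupport h) {R : ℝ} (hR : 0 < R) :
    ∫ u, h u ^ 2 ≤ (∫ ξ in Metric.closedBall (0 : 𝔼) R,
      ((∫ v, Real.cos (2 * Real.pi * ⟪v, ξ⟫) * h v) ^ 2 +
        (∫ v, Real.sin (2 * Real.pi * ⟪v, ξ⟫) * h v) ^ 2)) +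
      n / R ^ 2 * ∫ u, ‖fderiv ℝ h u‖ ^ 2 := by
  have hcs : ContDiff ℝ ∞ (fun u => (h u : ℂ)) := Complex.ofRealCLM.contDiff.comp hs
  have hcc : HasCompactSupport (fun u => (h u : ℂ)) := hc.comp_left (g := fun r : ℝ => (r : ℂ)) rfl
  obtain ⟨H, hHv⟩ : ∃ H : SchwartzMap 𝔼 ℂ, ⇑H = fun u => (h u : ℂ) := ⟨hcc.toSchwartzMap hcs, rfl⟩
  have h1 : ∫ u, h u ^ 2 = ∫ ξ, ‖(𝓕 H) ξ‖ ^ 2 := by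
    rw [SchwartzMap.integral_norm_sq_fourier]
    simp [hHv]
  have hderiv : ∀ (i : Fin n) (u : 𝔼), (∂_{EuclideanSpace.single i (1 : ℝ)} H) u =
      ((fderiv ℝ h u (EuclideanSpace.single i (1 : ℝ)) : ℝ) : ℂ) := by
    intro i u
    have : HasFDerivAt (fun u => (h u : ℂ)) (Complex.ofRealCLM.comp (fderiv ℝ h u)) u :=
      Complex.ofRealCLM.hasFDerivAt.comp u
        (hs.differentiable (by simp)).differentiableAt.hasFDerivAt
    rw [SchwartzMap.lineDerivOp_apply_eq_fderiv, hHv, this.fderiv]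
    rfl
  have h2 : ∀ i : Fin n, ∫ u, ‖(∂_{EuclideanSpace.single i (1 : ℝ)} H) u‖ ^ 2 ≤
      ∫ u, ‖fderiv ℝ h u‖ ^ 2 := by
    intro i
    refine integral_mono
      (integrable_norm_sq_schwartz (∂_{EuclideanSpace.single i (1 : ℝ)} H)) ?_ fun u => ?_
    · refine Continuous.integrable_of_hasCompactSupport
        ((hs.continuous_fderiv (by simp)).norm.pow 2) ?_
      exact (hc.fderiv ℝ).comp_left (g := fun L : 𝔼 →L[ℝ] ℝ => ‖L‖ ^ 2) (by simp)
    · change ‖(∂_{EuclideanSpace.single i (1 : ℝ)} H) u‖ ^ 2 ≤ ‖fderiv ℝ h u‖ ^ 2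
      rw [hderiv i u, Complex.norm_real]
      refine pow_le_pow_left₀ (norm_nonneg _) ?_ 2
      have := (fderiv ℝ h u).le_opNorm (EuclideanSpace.single i (1 : ℝ))
      simpa using this
  have hB : MeasurableSet (Metric.closedBall (0 : 𝔼) R) := measurableSet_closedBall
  rw [h1, ← integral_add_compl hB (integrable_norm_sq_schwartz (𝓕 H))]
  refine add_le_add (le_of_eq ?_) ((integral_norm_sq_fourier_compl_closedBall_le H hR).trans ?_)
  · simp_rw [SchwartzMap.fourier_coe, hHv, norm_sq_fourier_ofReal hs.continuous hc]
  · refine (mul_le_mul_of_nonneg_left (Finset.sum_le_sum fun i _ => h2 i)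
      (by positivity)).trans (le_of_eq ?_)
    rw [Finset.sum_const, Finset.card_univ, Fintype.card_fin, nsmul_eq_mul]
    ring

/-- A quantitative form of Rellich's theorem: up to a small multiple of the first Sobolev norm, the
`L²` norm of a function supported in a fixed compact set is controlled by finitely many of its
Fourier coefficients. -/
theorem exists_integral_sq_le_fourier {K : Set 𝔼} (hK : IsCompact K) {η : ℝ} (hη : 0 < η) :
    ∃ (t : Finset 𝔼) (c : ℝ), 0 ≤ c ∧ ∀ h : 𝔼 → ℝ, ContDiff ℝ ∞ h → (∀ u ∉ K, h u = 0) →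
      ∫ u, h u ^ 2 ≤ η * ((∫ u, ‖fderiv ℝ h u‖ ^ 2) + ∫ u, h u ^ 2) +
        c * ∑ ξ ∈ t, ((∫ v, Real.cos (2 * Real.pi * ⟪v, ξ⟫) * h v) ^ 2 +
          (∫ v, Real.sin (2 * Real.pi * ⟪v, ξ⟫) * h v) ^ 2) := by
  -- the frequencies beyond `R` contribute at most `η ∫ ‖∇h‖²`
  obtain ⟨R, hR, hRη⟩ : ∃ R : ℝ, 0 < R ∧ n / R ^ 2 ≤ η := by
    refine ⟨Real.sqrt (n / η) + 1, by positivity, ?_⟩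
    rw [div_le_iff₀ (by positivity)]
    have h1 := Real.sq_sqrt (show (0 : ℝ) ≤ n / η by positivity)
    have h2 := Real.sqrt_nonneg (n / η : ℝ)
    have h3 : (n : ℝ) / η ≤ (Real.sqrt (n / η) + 1) ^ 2 := by nlinarith
    rw [div_le_iff₀ hη] at h3
    linarith
  obtain ⟨A, hA⟩ := hK.isBounded.exists_norm_le
  set b := volume.real (Metric.closedBall (0 : 𝔼) R) with hb
  set k := volume.real K with hk
  have hb0 : 0 ≤ b := measureReal_nonneg
  have hk0 : 0 ≤ k := measureReal_nonneg
  set D := b * (4 * (2 * Real.pi * A) ^ 2 * k) with hD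
  have hD0 : 0 ≤ D := by positivity
  -- replacing a frequency in the ball by the nearest point of a `δ`-net costs at most `η ∫ h²`
  obtain ⟨δ, hδ, hδη⟩ : ∃ δ : ℝ, 0 < δ ∧ D * δ ^ 2 ≤ η := by
    refine ⟨Real.sqrt (η / (D + 1)), by positivity, ?_⟩
    rw [Real.sq_sqrt (by positivity), mul_div_assoc', div_le_iff₀ (by positivity)]
    nlinarith
  obtain ⟨t, htB, htf, ht⟩ := Metric.totallyBounded_iff.1
    (isCompact_closedBall (0 : 𝔼) R).totallyBounded δ hδ |>.imp fun t h => (⟨trivial, h⟩ : True ∧ _)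
  lift t to Finset 𝔼 using htf
  refine ⟨t, b * 2, by positivity, fun h hs h0 => ?_⟩
  have hc : HasCompactSupport h := HasCompactSupport.intro hK h0
  have hcont := hs.continuous
  refine (integral_sq_le_low_frequency hs hc hR).trans ?_
  have hi : ∀ w : 𝔼 → ℝ, Continuous w → Integrable fun v => w v * h v := fun w hw =>
    (hw.mul hcont).integrable_of_hasCompactSupport hc.mul_left
  set L := ∫ v, |h v| with hL
  set Q := ∫ v, h v ^ 2 with hQ
  have hQ0 : 0 ≤ Q := integral_nonneg fun v => sq_nonneg _
  have hL2 : L ^ 2 ≤ k * Q := by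
    have e1 : L = ∫ v in K, 1 * |h v| := by
      rw [hL, ← setIntegral_eq_integral_of_forall_compl_eq_zero (s := K)
        (fun v hv => by rw [h0 v hv, abs_zero])]
      simp
    have e2 : Q = ∫ v in K, |h v| ^ 2 := by
      rw [hQ, ← setIntegral_eq_integral_of_forall_compl_eq_zero (s := K)
        (fun v hv => by rw [h0 v hv]; simp)]
      simp
    have e3 : k = ∫ v in K, (1 : ℝ) ^ 2 := by simp [hk, Measure.real]
    rw [e1, e2, e3]
    refine sq_integral_mul_le (μ := volume.restrict K) (f := fun _ => 1) (h := fun v => |h v|) ?_ ?_ ?_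
    · exact continuous_const.continuousOn.integrableOn_compact hK
    · exact (hcont.abs.pow 2).continuousOn.integrableOn_compact hK
    · exact (continuous_const.mul hcont.abs).continuousOn.integrableOn_compact hK
  -- the Fourier transform of `h` is Lipschitz, with constant controlled by `L`
  have hosc : ∀ φ : ℝ → ℝ, Continuous φ → (∀ a b, |φ a - φ b| ≤ |a - b|) → ∀ ξ ζ : 𝔼,
      dist ξ ζ < δ → (∫ v, φ (2 * Real.pi * ⟪v, ξ⟫) * h v) ^ 2 ≤
        2 * (∫ v, φ (2 * Real.pi * ⟪v, ζ⟫) * h v) ^ 2 +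
          2 * ((2 * Real.pi * A) ^ 2 * δ ^ 2 * (k * Q)) := by
    intro φ hφ hlip ξ ζ hξζ
    have hc1 : ∀ ξ : 𝔼, Continuous fun v : 𝔼 => φ (2 * Real.pi * ⟪v, ξ⟫) := fun ξ => by fun_prop
    have hdiff : |(∫ v, φ (2 * Real.pi * ⟪v, ξ⟫) * h v) - ∫ v, φ (2 * Real.pi * ⟪v, ζ⟫) * h v| ≤
        |2 * Real.pi * A * δ| * L := by
      rw [← Real.norm_eq_abs, ← integral_sub (hi _ (hc1 ξ)) (hi _ (hc1 ζ)), hL, ← integral_const_mul]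
      refine norm_integral_le_of_norm_le ((hcont.abs.integrable_of_hasCompactSupport
        (hc.comp_left (g := fun r : ℝ => |r|) abs_zero)).const_mul _)
        (Eventually.of_forall fun v => ?_)
      rw [← sub_mul, Real.norm_eq_abs, abs_mul]
      by_cases hv : v ∈ K
      · refine mul_le_mul_of_nonneg_right ?_ (abs_nonneg _)
        refine (hlip _ _).trans ?_
        rw [← mul_sub, ← inner_sub_right, abs_mul, mul_assoc (2 * Real.pi), abs_mul (2 * Real.pi),
          abs_mul A]
        gcongr
        calc |⟪v, ξ - ζ⟫| ≤ ‖v‖ * ‖ξ - ζ‖ := abs_real_inner_le_norm _ _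
          _ ≤ |A| * |δ| := by
            refine mul_le_mul ((hA v hv).trans (le_abs_self _)) ?_ (norm_nonneg _) (abs_nonneg _)
            rw [← dist_eq_norm]; exact hξζ.le.trans (le_abs_self _)
      · rw [h0 v hv]; simp
    set x := ∫ v, φ (2 * Real.pi * ⟪v, ξ⟫) * h v
    set y := ∫ v, φ (2 * Real.pi * ⟪v, ζ⟫) * h v
    have hsq : (x - y) ^ 2 ≤ (2 * Real.pi * A) ^ 2 * δ ^ 2 * (k * Q) := by
      calc (x - y) ^ 2 = |x - y| ^ 2 := (sq_abs _).symm
        _ ≤ (|2 * Real.pi * A * δ| * L) ^ 2 := by gcongr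
        _ = (2 * Real.pi * A) ^ 2 * δ ^ 2 * L ^ 2 := by rw [mul_pow, sq_abs]; ring
        _ ≤ _ := by gcongr
    nlinarith [sq_nonneg (x - 2 * y)]
  set T := ∑ ξ ∈ t, ((∫ v, Real.cos (2 * Real.pi * ⟪v, ξ⟫) * h v) ^ 2 +
          (∫ v, Real.sin (2 * Real.pi * ⟪v, ξ⟫) * h v) ^ 2) with hT
  have hpt : ∀ ξ ∈ Metric.closedBall (0 : 𝔼) R,
      (∫ v, Real.cos (2 * Real.pi * ⟪v, ξ⟫) * h v) ^ 2 +
        (∫ v, Real.sin (2 * Real.pi * ⟪v, ξ⟫) * h v) ^ 2 ≤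
      2 * T + 4 * ((2 * Real.pi * A) ^ 2 * δ ^ 2 * (k * Q)) := by
    intro ξ hξ
    obtain ⟨ζ, hζ, hξζ⟩ := Set.mem_iUnion₂.1 (ht hξ)
    have h1 := hosc _ Real.continuous_cos abs_cos_sub_cos_le ξ ζ hξζ
    have h2 := hosc _ Real.continuous_sin abs_sin_sub_sin_le ξ ζ hξζ
    have h3 : (∫ v, Real.cos (2 * Real.pi * ⟪v, ζ⟫) * h v) ^ 2 +
        (∫ v, Real.sin (2 * Real.pi * ⟪v, ζ⟫) * h v) ^ 2 ≤ T :=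
      Finset.single_le_sum (f := fun ζ => (∫ v, Real.cos (2 * Real.pi * ⟪v, ζ⟫) * h v) ^ 2 +
        (∫ v, Real.sin (2 * Real.pi * ⟪v, ζ⟫) * h v) ^ 2) (fun _ _ => by positivity) hζ
    linarith
  have hlow : (∫ ξ in Metric.closedBall (0 : 𝔼) R,
      ((∫ v, Real.cos (2 * Real.pi * ⟪v, ξ⟫) * h v) ^ 2 +
        (∫ v, Real.sin (2 * Real.pi * ⟪v, ξ⟫) * h v) ^ 2)) ≤
      (2 * T + 4 * ((2 * Real.pi * A) ^ 2 * δ ^ 2 * (k * Q))) * b := by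
    have := norm_setIntegral_le_of_norm_le_const (μ := volume)
      (f := fun ξ : 𝔼 => (∫ v, Real.cos (2 * Real.pi * ⟪v, ξ⟫) * h v) ^ 2 +
        (∫ v, Real.sin (2 * Real.pi * ⟪v, ξ⟫) * h v) ^ 2)
      (isCompact_closedBall (0 : 𝔼) R).measure_lt_top (fun ξ hξ => by
        rw [Real.norm_of_nonneg (by positivity)]; exact hpt ξ hξ)
    exact (le_abs_self _).trans this
  have hG0 : 0 ≤ ∫ u, ‖fderiv ℝ h u‖ ^ 2 := integral_nonneg fun u => by positivity
  have e1 : n / R ^ 2 * ∫ u, ‖fderiv ℝ h u‖ ^ 2 ≤ η * ∫ u, ‖fderiv ℝ h u‖ ^ 2 := by gcongr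
  have e2 : D * δ ^ 2 * Q ≤ η * Q := by gcongr
  have e3 : (2 * T + 4 * ((2 * Real.pi * A) ^ 2 * δ ^ 2 * (k * Q))) * b =
      b * 2 * T + D * δ ^ 2 * Q := by rw [hD]; ring
  rw [e3] at hlow
  linarith

end Rellich

namespace RMetric

section SobolevInequalities

set_option linter.unusedSectionVars false

variable {n : ℕ} {M : Type*} [TopologicalSpace M] [ChartedSpace (EuclideanSpace ℝ (Fin n)) M]
  [IsManifold (𝓡 n) ∞ M]

/-! ### Localization in a chart -/

variable (n) in
/-- The expression in the chart at `p` of a function supported in the domain of this chart,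
extended by zero to the model space. -/
noncomputable def chartLocal (p : M) (f : M → ℝ) : EuclideanSpace ℝ (Fin n) → ℝ :=
  (chartAt (EuclideanSpace ℝ (Fin n)) p).target.indicator
    fun u => f ((chartAt (EuclideanSpace ℝ (Fin n)) p).symm u)

theorem chartLocal_of_mem (p : M) (f : M → ℝ) {u : EuclideanSpace ℝ (Fin n)}
    (hu : u ∈ (chartAt (EuclideanSpace ℝ (Fin n)) p).target) :
    chartLocal n p f u = f ((chartAt (EuclideanSpace ℝ (Fin n)) p).symm u) :=
  Set.indicator_of_mem hu _

theorem chartLocal_of_notMem (p : M) (f : M → ℝ) {u : EuclideanSpace ℝ (Fin n)}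
    (hu : u ∉ (chartAt (EuclideanSpace ℝ (Fin n)) p).target) : chartLocal n p f u = 0 :=
  Set.indicator_of_notMem hu _

theorem contDiff_chartLocal [CompactSpace M] (p : M) {f : M → ℝ}
    (hf : ContMDiff (𝓡 n) 𝓘(ℝ, ℝ) ∞ f)
    (hfp : tsupport f ⊆ (chartAt (EuclideanSpace ℝ (Fin n)) p).source) :
    ContDiff ℝ ∞ (chartLocal n p f) :=
  contDiff_indicator_of_isCompact (chartAt (EuclideanSpace ℝ (Fin n)) p).open_target
    (isCompact_chart_image p hfp) (chart_image_subset p hfp) (contDiffOn_comp_chart_symm hf p)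
    fun _ hu hK => eq_zero_of_notMem_chart_image p hu hK

theorem exists_sqrtDet_bounds (g : RMetric n M) (p : M) {K : Set (EuclideanSpace ℝ (Fin n))}
    (hK : IsCompact K) (hKV : K ⊆ (chartAt (EuclideanSpace ℝ (Fin n)) p).target) :
    ∃ C : ℝ, 0 < C ∧ ∀ u ∈ K, g.sqrtDet p u ≤ C ∧ 1 ≤ C * g.sqrtDet p u := by
  have hc := (g.contDiffOn_sqrtDet p).continuousOn.mono hKV
  obtain ⟨A, hA⟩ := hK.exists_bound_of_continuousOn hc
  obtain ⟨B, hB⟩ := hK.exists_bound_of_continuousOn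
    (hc.inv₀ fun u hu => (g.sqrtDet_pos p (hKV hu)).ne')
  refine ⟨|A| + |B| + 1, by positivity, fun u hu => ⟨?_, ?_⟩⟩
  · have := (le_abs_self _).trans ((hA u hu).trans (le_abs_self A))
    linarith [abs_nonneg B]
  · have hp := g.sqrtDet_pos p (hKV hu)
    have h1 : (g.sqrtDet p u)⁻¹ ≤ |B| :=
      (le_abs_self _).trans ((hB u hu).trans (le_abs_self B))
    rw [inv_le_iff_one_le_mul₀ hp] at h1
    nlinarith [abs_nonneg A]

theorem exists_coordMetric_bound (g : RMetric n M) (p : M) {K : Set (EuclideanSpace ℝ (Fin n))}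
    (hK : IsCompact K) (hKV : K ⊆ (chartAt (EuclideanSpace ℝ (Fin n)) p).target) :
    ∃ C : ℝ, 0 ≤ C ∧ ∀ u ∈ K, ∀ v, g.coordMetric p u v v ≤ C * ‖v‖ ^ 2 := by
  choose B hB using fun i j => hK.exists_bound_of_continuousOn
    ((g.contDiffOn_gram_apply p i j).continuousOn.mono hKV)
  refine ⟨∑ i, ∑ j, |B i j|, by positivity, fun u hu v => ?_⟩
  rw [coordMetric_eq_sum, Finset.sum_mul]
  refine Finset.sum_le_sum fun i _ => ?_
  rw [Finset.sum_mul]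
  refine Finset.sum_le_sum fun j _ => ?_
  calc v i * v j * g.gram p u i j ≤ |v i * v j * g.gram p u i j| := le_abs_self _
    _ = |v i| * |v j| * |g.gram p u i j| := by rw [abs_mul, abs_mul]
    _ ≤ ‖v‖ * ‖v‖ * |B i j| :=
      mul_le_mul (mul_le_mul (PiLp.norm_apply_le v i) (PiLp.norm_apply_le v j) (abs_nonneg _)
        (norm_nonneg _)) ((hB i j u hu).trans (le_abs_self _)) (abs_nonneg _) (by positivity)
    _ = |B i j| * ‖v‖ ^ 2 := by ring

theorem normSq_add_le (g : RMetric n M) (x : M) (v w : TangentSpace (𝓡 n) x) :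
    g.normSq x (v + w) ≤ 2 * (g.normSq x v + g.normSq x w) := by
  have h1 := g.normSq_nonneg x (v - w)
  rw [normSq_sub] at h1
  rw [normSq_add]
  linarith

variable [MeasurableSpace M] [BorelSpace M] [T2Space M] [CompactSpace M]

theorem exists_abs_le_of_continuous {f : M → ℝ} (hf : Continuous f) :
    ∃ C : ℝ, 0 ≤ C ∧ ∀ x, |f x| ≤ C := by
  obtain ⟨C, hC⟩ := isCompact_univ.exists_bound_of_continuousOn hf.continuousOn
  exact ⟨|C|, abs_nonneg C, fun x => (hC x trivial).trans (le_abs_self C)⟩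

/-- The first Sobolev norm of a product with a fixed smooth function. -/
theorem exists_normSq_grad_mul_le (g : RMetric n M) {ρ : M → ℝ}
    (hρ : ContMDiff (𝓡 n) 𝓘(ℝ, ℝ) ∞ ρ) :
    ∃ C : ℝ, 0 ≤ C ∧ ∀ f : M → ℝ, ContMDiff (𝓡 n) 𝓘(ℝ, ℝ) ∞ f → ∀ x,
      g.normSq x (g.grad (ρ * f) x) ≤ C * (g.normSq x (g.grad f x) + f x ^ 2) := by
  obtain ⟨A, hA0, hA⟩ := exists_abs_le_of_continuous hρ.continuous
  obtain ⟨B, hB0, hB⟩ := exists_abs_le_of_continuous (g.continuous_inner_grad hρ hρ)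
  refine ⟨2 * (A ^ 2 + B), by positivity, fun f hf x => ?_⟩
  rw [g.grad_mul (mdifferentiableAt_of_smooth hρ x) (mdifferentiableAt_of_smooth hf x)]
  refine (g.normSq_add_le x _ _).trans ?_
  rw [normSq_smul, normSq_smul]
  have h1 : ρ x ^ 2 ≤ A ^ 2 := sq_le_sq' (abs_le.1 (hA x)).1 (abs_le.1 (hA x)).2
  have h2 : g.normSq x (g.grad ρ x) ≤ B := (le_abs_self _).trans (hB x)
  have h3 := g.normSq_nonneg x (g.grad f x)
  have h4 : ρ x ^ 2 * g.normSq x (g.grad f x) ≤ (A ^ 2 + B) * g.normSq x (g.grad f x) := by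
    gcongr; linarith
  have h5 : f x ^ 2 * g.normSq x (g.grad ρ x) ≤ f x ^ 2 * (A ^ 2 + B) := by
    gcongr; linarith [sq_nonneg A]
  linarith

/-- Comparison of the Riemannian volume with the Lebesgue measure in a chart. -/
theorem exists_integral_le (g : RMetric n M) (p : M) {S : Set M} (hS : IsClosed S)
    (hSp : S ⊆ (chartAt (EuclideanSpace ℝ (Fin n)) p).source) :
    ∃ C : ℝ, 0 < C ∧ ∀ F : M → ℝ, Continuous F → (∀ x, 0 ≤ F x) → (∀ x ∉ S, F x = 0) →
      ∫ x, F x ∂g.vol ≤ C * ∫ u in (chartAt (EuclideanSpace ℝ (Fin n)) p).target,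
        F ((chartAt (EuclideanSpace ℝ (Fin n)) p).symm u) ∧
      ∫ u in (chartAt (EuclideanSpace ℝ (Fin n)) p).target,
        F ((chartAt (EuclideanSpace ℝ (Fin n)) p).symm u) ≤ C * ∫ x, F x ∂g.vol := by
  set e := chartAt (EuclideanSpace ℝ (Fin n)) p with he
  have hK : IsCompact (e '' S) := hS.isCompact.image_of_continuousOn (e.continuousOn.mono hSp)
  have hKV : e '' S ⊆ e.target := by
    rintro _ ⟨x, hx, rfl⟩
    exact e.map_source (hSp hx)
  obtain ⟨C, hC, hb⟩ := g.exists_sqrtDet_bounds p hK hKV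
  refine ⟨C, hC, fun F hF hF0 hFS => ?_⟩
  have hV := e.open_target.measurableSet
  have hout : ∀ u ∈ e.target, u ∉ e '' S → F (e.symm u) = 0 := fun u hu hKu =>
    hFS _ fun h => hKu ⟨_, h, e.right_inv hu⟩
  have hFc : ContinuousOn (fun u => F (e.symm u)) e.target :=
    hF.comp_continuousOn e.continuousOn_symm
  have hint : ∀ w : EuclideanSpace ℝ (Fin n) → ℝ, ContinuousOn w e.target →
      (∀ u ∈ e.target, u ∉ e '' S → w u = 0) → IntegrableOn w e.target := fun w hw h0 =>
    ((hw.mono hKV).integrableOn_compact hK).of_forall_sdiff_eq_zero hV fun u hu => h0 u hu.1 hu.2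
  have e1 : ∫ x, F x ∂g.vol = ∫ u in e.target, g.sqrtDet p u * F (e.symm u) := by
    rw [← setIntegral_eq_integral_of_forall_compl_eq_zero (s := e.source)
      (fun x hx => hFS x fun h => hx (hSp h)), he, integral_source]
    exact hF.continuousOn.aestronglyMeasurable e.open_source.measurableSet
  have i1 := hint _ hFc hout
  have i2 := hint _ ((g.contDiffOn_sqrtDet p).continuousOn.mul hFc)
    fun u hu hKu => mul_eq_zero_of_right _ (hout u hu hKu)
  rw [e1, ← integral_const_mul, ← integral_const_mul]
  constructor
  · refine setIntegral_mono_on i2 (i1.const_mul C) hV fun u hu => ?_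
    by_cases hKu : u ∈ e '' S
    · exact mul_le_mul_of_nonneg_right (hb u hKu).1 (hF0 _)
    · rw [hout u hu hKu]; simp
  · refine setIntegral_mono_on i1 (i2.const_mul C) hV fun u hu => ?_
    by_cases hKu : u ∈ e '' S
    · rw [← mul_assoc]
      exact le_mul_of_one_le_left (hF0 _) (hb u hKu).2
    · rw [hout u hu hKu]; simp

/-- Transfer of `Lᵠ` norms from a chart: on a compact set the density of the Riemannian volume is
bounded. -/
theorem exists_eLpNorm_le_chartLocal (g : RMetric n M) (p : M) {S : Set M} (hS : IsClosed S)
    (hSp : S ⊆ (chartAt (EuclideanSpace ℝ (Fin n)) p).source) (q : ℝ≥0∞) (hq0 : q ≠ 0)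
    (hq : q ≠ ⊤) :
    ∃ C : NNReal, ∀ F : M → ℝ, Continuous F → (∀ x ∉ S, F x = 0) →
      eLpNorm F q g.vol ≤ C * eLpNorm (chartLocal n p F) q volume := by
  set e := chartAt (EuclideanSpace ℝ (Fin n)) p with he
  have hK : IsCompact (e '' S) := hS.isCompact.image_of_continuousOn (e.continuousOn.mono hSp)
  have hKV : e '' S ⊆ e.target := by
    rintro _ ⟨x, hx, rfl⟩
    exact e.map_source (hSp hx)
  obtain ⟨C, hC, hb⟩ := g.exists_sqrtDet_bounds p hK hKV
  have hqr : 0 < q.toReal := ENNReal.toReal_pos hq0 hq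
  refine ⟨C.toNNReal ^ (1 / q.toReal), fun F hF hFS => ?_⟩
  have hV := e.open_target.measurableSet
  rw [eLpNorm_eq_lintegral_rpow_enorm_toReal hq0 hq, eLpNorm_eq_lintegral_rpow_enorm_toReal hq0 hq,
    ENNReal.coe_rpow_of_nonneg _ (by positivity), ← ENNReal.mul_rpow_of_nonneg _ _ (by positivity)]
  refine ENNReal.rpow_le_rpow ?_ (by positivity)
  have e1 : ∫⁻ x, ‖F x‖ₑ ^ q.toReal ∂g.vol = ∫⁻ x in e.source, ‖F x‖ₑ ^ q.toReal ∂g.vol := by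
    refine (setLIntegral_eq_of_support_subset fun x hx => ?_).symm
    by_contra h
    exact hx (by simp [hFS x fun h' => h (hSp h'), hqr])
  rw [e1, he, g.lintegral_source p (by fun_prop)]
  calc ∫⁻ u in e.target, ENNReal.ofReal (g.sqrtDet p u) * ‖F (e.symm u)‖ₑ ^ q.toReal
      ≤ ∫⁻ u in e.target, ENNReal.ofReal C * ‖chartLocal n p F u‖ₑ ^ q.toReal := by
        refine setLIntegral_mono' hV fun u hu => ?_
        rw [chartLocal_of_mem p F hu]
        by_cases hKu : u ∈ e '' S
        · gcongr
          exact (hb u hKu).1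
        · have : F (e.symm u) = 0 := hFS _ fun h => hKu ⟨_, h, e.right_inv hu⟩
          rw [this]; simp [hqr]
    _ ≤ ∫⁻ u, ENNReal.ofReal C * ‖chartLocal n p F u‖ₑ ^ q.toReal := setLIntegral_le_lintegral _ _
    _ = _ := lintegral_const_mul' _ _ ENNReal.ofReal_ne_top

theorem integral_chartLocal_sq (p : M) (f : M → ℝ) :
    ∫ u, chartLocal n p f u ^ 2 = ∫ u in (chartAt (EuclideanSpace ℝ (Fin n)) p).target,
      f ((chartAt (EuclideanSpace ℝ (Fin n)) p).symm u) ^ 2 := by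
  rw [← setIntegral_eq_integral_of_forall_compl_eq_zero
    (s := (chartAt (EuclideanSpace ℝ (Fin n)) p).target)
    fun u hu => by rw [chartLocal_of_notMem p f hu]; simp]
  exact setIntegral_congr_fun (chartAt (EuclideanSpace ℝ (Fin n)) p).open_target.measurableSet
    fun u hu => by simp only [chartLocal_of_mem p f hu]

/-- The energy `∫ (|∇f|² + f²)` of a smooth function. -/
noncomputable def smoothEnergy (g : RMetric n M) (f : M → ℝ) : ℝ :=
  (∫ x, g.normSq x (g.grad f x) ∂g.vol) + ∫ x, f x ^ 2 ∂g.vol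

theorem smoothEnergy_nonneg (g : RMetric n M) (f : M → ℝ) : 0 ≤ g.smoothEnergy f :=
  add_nonneg (integral_nonneg fun x => g.normSq_nonneg x _) (integral_nonneg fun _ => sq_nonneg _)

/-- Multiplication by a cutoff function and passage to a chart is bounded from the first Sobolev
space of `M` to that of the model space. -/
theorem exists_chartLocal_energy_le (g : RMetric n M) (p : M) {ρ : M → ℝ}
    (hρ : ContMDiff (𝓡 n) 𝓘(ℝ, ℝ) ∞ ρ)
    (hsupp : tsupport ρ ⊆ (chartAt (EuclideanSpace ℝ (Fin n)) p).source) :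
    ∃ C : ℝ, 0 ≤ C ∧ ∀ f : M → ℝ, ContMDiff (𝓡 n) 𝓘(ℝ, ℝ) ∞ f →
      ∫ u, ‖fderiv ℝ (chartLocal n p (ρ * f)) u‖ ^ 2 ≤ C * g.smoothEnergy f ∧
      ∫ u, chartLocal n p (ρ * f) u ^ 2 ≤ C * g.smoothEnergy f ∧
      ∫ x, (ρ * f) x ^ 2 ∂g.vol ≤ C * ∫ u, chartLocal n p (ρ * f) u ^ 2 := by
  obtain ⟨C₁, hC₁, h1⟩ := g.exists_integral_le p (isClosed_tsupport ρ) hsupp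
  obtain ⟨C₂, hC₂, h2⟩ := g.exists_normSq_grad_mul_le hρ
  obtain ⟨C₃, hC₃, h3⟩ := g.exists_coordMetric_bound p (isCompact_chart_image p hsupp)
    (chart_image_subset p hsupp)
  obtain ⟨A, hA0, hA⟩ := exists_abs_le_of_continuous hρ.continuous
  refine ⟨C₃ * C₁ * C₂ + C₁ * A ^ 2 + C₁, by positivity, fun f hf => ?_⟩
  set e := chartAt (EuclideanSpace ℝ (Fin n)) p with he
  have hV := e.open_target
  have hρf : ContMDiff (𝓡 n) 𝓘(ℝ, ℝ) ∞ (ρ * f) := hρ.mul hf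
  have hsub : tsupport (ρ * f) ⊆ tsupport ρ := tsupport_mul_subset_left
  have hs := hsub.trans hsupp
  have hE := g.smoothEnergy_nonneg f
  have iG : Integrable (fun x => g.normSq x (g.grad f x)) g.vol :=
    (g.continuous_inner_grad hf hf).integrable_vol
  have iG' : Integrable (fun x => g.normSq x (g.grad (ρ * f) x)) g.vol :=
    (g.continuous_inner_grad hρf hρf).integrable_vol
  have iF : Integrable (fun x => f x ^ 2) g.vol := (hf.continuous.pow 2).integrable_vol
  have hgrad0 : ∀ x ∉ tsupport ρ, g.normSq x (g.grad (ρ * f) x) = 0 := by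
    intro x hx
    have h0 : ρ * f =ᶠ[𝓝 x] fun _ => (0 : ℝ) :=
      notMem_tsupport_iff_eventuallyEq.1 fun h => hx (hsub h)
    rw [g.grad_congr h0, grad_const]
    simp [normSq]
  have hsq0 : ∀ x ∉ tsupport ρ, (ρ * f) x ^ 2 = 0 := by
    intro x hx
    simp [image_eq_zero_of_notMem_tsupport hx]
  obtain ⟨a1, a2⟩ := h1 _ (g.continuous_inner_grad hρf hρf) (fun x => g.normSq_nonneg x _) hgrad0
  obtain ⟨b1, b2⟩ := h1 _ (hρf.continuous.pow 2) (fun x => sq_nonneg _) hsq0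
  have hG : ∫ x, g.normSq x (g.grad (ρ * f) x) ∂g.vol ≤ C₂ * g.smoothEnergy f := by
    unfold smoothEnergy
    rw [← integral_add iG iF, ← integral_const_mul]
    exact integral_mono iG' ((iG.add iF).const_mul _) (h2 f hf)
  have hF : ∫ x, (ρ * f) x ^ 2 ∂g.vol ≤ A ^ 2 * g.smoothEnergy f := by
    have : ∫ x, (ρ * f) x ^ 2 ∂g.vol ≤ A ^ 2 * ∫ x, f x ^ 2 ∂g.vol := by
      rw [← integral_const_mul]
      refine integral_mono (hρf.continuous.pow 2).integrable_vol (iF.const_mul _) fun x => ?_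
      simp only [Pi.mul_apply, mul_pow]
      gcongr ?_ * _
      exact sq_le_sq' (abs_le.1 (hA x)).1 (abs_le.1 (hA x)).2
    refine this.trans (mul_le_mul_of_nonneg_left ?_ (sq_nonneg _))
    exact le_add_of_nonneg_left (integral_nonneg fun x => g.normSq_nonneg x _)
  rw [integral_chartLocal_sq]
  refine ⟨?_, ?_, ?_⟩
  · have hzero : ∀ u ∉ e.target, ‖fderiv ℝ (chartLocal n p (ρ * f)) u‖ ^ 2 = 0 := by
      intro u hu
      unfold chartLocal
      rw [fderiv_eq_zero_of_hasCompactSupport_indicator (isCompact_chart_image p hs)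
        (chart_image_subset p hs) (fun u hu hK => eq_zero_of_notMem_chart_image p hu hK) hu]
      simp
    rw [← setIntegral_eq_integral_of_forall_compl_eq_zero hzero]
    have hpt : ∀ u ∈ e.target, ‖fderiv ℝ (chartLocal n p (ρ * f)) u‖ ^ 2 ≤
        C₃ * g.normSq _ (g.grad (ρ * f) (e.symm u)) := by
      intro u hu
      have hnn : 0 ≤ C₃ * g.normSq _ (g.grad (ρ * f) (e.symm u)) :=
        mul_nonneg hC₃ (g.normSq_nonneg _ _)
      unfold chartLocal
      rw [fderiv_indicator_of_mem hV hu]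
      by_cases hK : u ∈ e '' tsupport ρ
      · rw [← Real.sq_sqrt hnn]
        refine pow_le_pow_left₀ (norm_nonneg _) ?_ 2
        refine ContinuousLinearMap.opNorm_le_bound _ (Real.sqrt_nonneg _) fun v => ?_
        rw [g.fderiv_comp_chart_symm_eq_inner hρf p hu, Real.norm_eq_abs]
        refine (g.abs_inner_le _ _ _).trans ?_
        have h5 : g.gnorm _ (coordMap p u v) ≤ Real.sqrt C₃ * ‖v‖ := by
          refine Real.sqrt_le_iff.2 ⟨by positivity, ?_⟩
          rw [mul_pow, Real.sq_sqrt hC₃]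
          exact h3 u hK v
        rw [mul_comm C₃, Real.sqrt_mul (g.normSq_nonneg _ _), mul_assoc]
        exact mul_le_mul_of_nonneg_left h5 (g.gnorm_nonneg _ _)
      · have h0 : (fun u => (ρ * f) (e.symm u)) =ᶠ[𝓝 u] fun _ => (0 : ℝ) := by
          filter_upwards [hV.mem_nhds hu,
            (isCompact_chart_image p hsupp).isClosed.isOpen_compl.mem_nhds hK] with v hv hv'
          have h0' : ρ (e.symm v) = 0 := eq_zero_of_notMem_chart_image p hv hv'
          simp [h0']
        rw [h0.fderiv_eq]
        simpa using hnn
    have hcont : Continuous fun u => ‖fderiv ℝ (chartLocal n p (ρ * f)) u‖ ^ 2 :=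
      ((contDiff_chartLocal p hρf hs).continuous_fderiv (by simp)).norm.pow 2
    have i1 : IntegrableOn (fun u => ‖fderiv ℝ (chartLocal n p (ρ * f)) u‖ ^ 2) e.target := by
      refine (Continuous.integrable_of_hasCompactSupport hcont ?_).integrableOn
      exact ((hasCompactSupport_indicator (isCompact_chart_image p hs)
        (fun u hu hK => eq_zero_of_notMem_chart_image p hu hK)).fderiv ℝ).comp_left
          (g := fun L : EuclideanSpace ℝ (Fin n) →L[ℝ] ℝ => ‖L‖ ^ 2) (by simp)
    have i2 : IntegrableOn (fun u => C₃ * g.normSq _ (g.grad (ρ * f) (e.symm u))) e.target := by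
      refine Integrable.const_mul ?_ _
      refine (((g.contDiffOn_inner_grad hρf hρf p).continuousOn.mono
        (chart_image_subset p hsupp)).integrableOn_compact
          (isCompact_chart_image p hsupp)).of_forall_sdiff_eq_zero hV.measurableSet fun u hu => ?_
      exact hgrad0 _ fun h => hu.2 ⟨_, h, e.right_inv hu.1⟩
    calc ∫ u in e.target, ‖fderiv ℝ (chartLocal n p (ρ * f)) u‖ ^ 2
        ≤ ∫ u in e.target, C₃ * g.normSq _ (g.grad (ρ * f) (e.symm u)) :=
          setIntegral_mono_on i1 i2 hV.measurableSet hpt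
      _ = C₃ * ∫ u in e.target, g.normSq _ (g.grad (ρ * f) (e.symm u)) :=
          integral_const_mul _ _
      _ ≤ C₃ * (C₁ * (C₂ * g.smoothEnergy f)) := by
          refine mul_le_mul_of_nonneg_left (a2.trans ?_) hC₃
          exact mul_le_mul_of_nonneg_left hG hC₁.le
      _ ≤ _ := by nlinarith [mul_nonneg hC₁.le hE, mul_nonneg (mul_nonneg hC₁.le (sq_nonneg A)) hE]
  · calc _ ≤ C₁ * (A ^ 2 * g.smoothEnergy f) :=
          b2.trans (mul_le_mul_of_nonneg_left hF hC₁.le)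
      _ ≤ _ := by
          nlinarith [mul_nonneg hC₁.le hE, mul_nonneg (mul_nonneg (mul_nonneg hC₃ hC₁.le) hC₂) hE]
  · refine b1.trans ?_
    have hnn : 0 ≤ ∫ u in e.target, (ρ * f) (e.symm u) ^ 2 := integral_nonneg fun u => sq_nonneg _
    refine mul_le_mul_of_nonneg_right ?_ hnn
    have : 0 ≤ C₃ * C₁ * C₂ + C₁ * A ^ 2 := by positivity
    linarith

end SobolevInequalities
end RMetric

namespace RMetric

section SobolevRellich

set_option linter.unusedSectionVars false

variable {n : ℕ} {M : Type*} [TopologicalSpace M] [ChartedSpace (EuclideanSpace ℝ (Fin n)) M]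
  [IsManifold (𝓡 n) ∞ M] [MeasurableSpace M] [BorelSpace M] [T2Space M] [CompactSpace M]

/-! ### The Sobolev inequality and Rellich's inequality on smooth functions -/

theorem eLpNorm_fderiv_two {h : EuclideanSpace ℝ (Fin n) → ℝ} (hh : ContDiff ℝ ∞ h)
    (hc : HasCompactSupport h) :
    eLpNorm (fderiv ℝ h) 2 volume = ENNReal.ofReal (Real.sqrt (∫ u, ‖fderiv ℝ h u‖ ^ 2)) := by
  have hm : MemLp (fderiv ℝ h) 2 volume :=
    (hh.continuous_fderiv (by simp)).memLp_of_hasCompactSupport (hc.fderiv ℝ)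
  rw [hm.eLpNorm_eq_integral_rpow_norm (by simp) (by simp), Real.sqrt_eq_rpow]
  simp

/-- The Sobolev inequality for a function localized in a chart, from the Gagliardo–Nirenberg–Sobolev
inequality in Euclidean space. -/
theorem exists_eLpNorm_mul_le (hn : 3 ≤ n) (g : RMetric n M) {q : NNReal} (hq0 : q ≠ 0)
    (hq : (2 : ℝ)⁻¹ - (n : ℝ)⁻¹ ≤ (q : ℝ)⁻¹) (p : M) {ρ : M → ℝ}
    (hρ : ContMDiff (𝓡 n) 𝓘(ℝ, ℝ) ∞ ρ)
    (hsupp : tsupport ρ ⊆ (chartAt (EuclideanSpace ℝ (Fin n)) p).source) :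
    ∃ C : NNReal, ∀ f : M → ℝ, ContMDiff (𝓡 n) 𝓘(ℝ, ℝ) ∞ f →
      eLpNorm (ρ * f) q g.vol ≤ C * ENNReal.ofReal (Real.sqrt (g.smoothEnergy f)) := by
  obtain ⟨C, hC, h⟩ := g.exists_chartLocal_energy_le p hρ hsupp
  obtain ⟨D, hD⟩ := g.exists_eLpNorm_le_chartLocal p (isClosed_tsupport ρ) hsupp q
    (by exact_mod_cast hq0) ENNReal.coe_ne_top
  set K := chartAt (EuclideanSpace ℝ (Fin n)) p '' tsupport ρ with hK
  have hKc : IsCompact K := isCompact_chart_image p hsupp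
  set S := eLpNormLESNormFDerivOfLeConst ℝ (volume : Measure (EuclideanSpace ℝ (Fin n))) K 2 q
  refine ⟨D * (S * (Real.sqrt C).toNNReal), fun f hf => ?_⟩
  have hρf : ContMDiff (𝓡 n) 𝓘(ℝ, ℝ) ∞ (ρ * f) := hρ.mul hf
  have hs : tsupport (ρ * f) ⊆ (chartAt (EuclideanSpace ℝ (Fin n)) p).source :=
    tsupport_mul_subset_left.trans hsupp
  have hcd := contDiff_chartLocal p hρf hs
  have hcs : HasCompactSupport (chartLocal n p (ρ * f)) :=
    hasCompactSupport_indicator (isCompact_chart_image p hs)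
      (fun u hu hK => eq_zero_of_notMem_chart_image p hu hK)
  have hsub : (chartLocal n p (ρ * f)).support ⊆ K := by
    intro u hu
    by_contra huK
    refine hu ?_
    by_cases huV : u ∈ (chartAt (EuclideanSpace ℝ (Fin n)) p).target
    · rw [chartLocal_of_mem p _ huV, Pi.mul_apply,
        eq_zero_of_notMem_chart_image p huV huK, zero_mul]
    · exact chartLocal_of_notMem p _ huV
  have h1 := eLpNorm_le_eLpNorm_fderiv_of_le (μ := volume) (p := 2) (q := q)
    (hcd.of_le (by simp)) hsub (by norm_num)
    (by rw [finrank_euclideanSpace_fin]; exact_mod_cast hn)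
    (by rw [finrank_euclideanSpace_fin]; exact_mod_cast hq) hKc.isBounded
  have h2 : eLpNorm (fderiv ℝ (chartLocal n p (ρ * f))) ((2 : NNReal) : ℝ≥0∞) volume ≤
      (Real.sqrt C).toNNReal * ENNReal.ofReal (Real.sqrt (g.smoothEnergy f)) := by
    rw [show ((2 : NNReal) : ℝ≥0∞) = 2 from rfl, eLpNorm_fderiv_two hcd hcs,
      show (((Real.sqrt C).toNNReal : NNReal) : ℝ≥0∞) = ENNReal.ofReal (Real.sqrt C) from rfl,
      ← ENNReal.ofReal_mul (Real.sqrt_nonneg _), ← Real.sqrt_mul hC]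
    exact ENNReal.ofReal_le_ofReal (Real.sqrt_le_sqrt (h f hf).1)
  calc eLpNorm (ρ * f) q g.vol ≤ D * eLpNorm (chartLocal n p (ρ * f)) q volume :=
        hD _ hρf.continuous fun x hx => by
          rw [Pi.mul_apply, image_eq_zero_of_notMem_tsupport hx, zero_mul]
    _ ≤ D * (S * ((Real.sqrt C).toNNReal * ENNReal.ofReal (Real.sqrt (g.smoothEnergy f)))) := by
        gcongr
        exact h1.trans (by gcongr)
    _ = _ := by push_cast; ring

theorem sum_mul_eq_self {t : Finset M} {ρ : M → M → ℝ} (hsum : ∀ x, ∑ p ∈ t, ρ p x = 1)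
    (f : M → ℝ) : f = ∑ p ∈ t, ρ p * f := by
  funext x
  rw [Finset.sum_apply]
  simp only [Pi.mul_apply]
  rw [← Finset.sum_mul, hsum, one_mul]

/-- The **Sobolev inequality** for smooth functions on a compact Riemannian manifold. -/
theorem exists_eLpNorm_le_smoothEnergy (hn : 3 ≤ n) (g : RMetric n M) {q : NNReal} (hq1 : 1 ≤ q)
    (hq : (2 : ℝ)⁻¹ - (n : ℝ)⁻¹ ≤ (q : ℝ)⁻¹) :
    ∃ C : NNReal, ∀ f : M → ℝ, ContMDiff (𝓡 n) 𝓘(ℝ, ℝ) ∞ f →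
      eLpNorm f q g.vol ≤ C * ENNReal.ofReal (Real.sqrt (g.smoothEnergy f)) := by
  obtain ⟨t, ρ, hρ, hsupp, hsum⟩ := exists_partitionOfUnity n M
  choose C hC using fun p => g.exists_eLpNorm_mul_le hn (zero_lt_one.trans_le hq1).ne' hq p
    (hρ p) (hsupp p)
  refine ⟨∑ p ∈ t, C p, fun f hf => ?_⟩
  conv_lhs => rw [sum_mul_eq_self hsum f]
  refine (eLpNorm_sum_le (fun p _ => ?_) (by exact_mod_cast hq1)).trans ?_
  · exact (((hρ p).mul hf).continuous (I := 𝓡 n) (I' := 𝓘(ℝ, ℝ))).aestronglyMeasurable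
  · push_cast
    rw [Finset.sum_mul]
    exact Finset.sum_le_sum fun p _ => hC p f hf

/-- An integral of a localized function against a function of the coordinates is an integral over
`M` against a continuous function. -/
theorem exists_integral_mul_chartLocal_eq (g : RMetric n M) (p : M) {ρ : M → ℝ}
    (hρ : ContMDiff (𝓡 n) 𝓘(ℝ, ℝ) ∞ ρ)
    (hsupp : tsupport ρ ⊆ (chartAt (EuclideanSpace ℝ (Fin n)) p).source)
    {w : EuclideanSpace ℝ (Fin n) → ℝ} (hw : Continuous w) :
    ∃ W : M → ℝ, Continuous W ∧ ∀ f : M → ℝ, Continuous f →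
      ∫ u, w u * chartLocal n p (ρ * f) u = ∫ x, W x * f x ∂g.vol := by
  set e := chartAt (EuclideanSpace ℝ (Fin n)) p with he
  have hW : Continuous fun x => ρ x * (w (e x) / g.sqrtDet p (e x)) := by
    refine continuous_mul_of_tsupport_subset e.open_source hρ.continuous hsupp ?_
    refine (hw.comp_continuousOn e.continuousOn).div
      ((g.contDiffOn_sqrtDet p).continuousOn.comp e.continuousOn fun x hx => e.map_source hx)
      fun x hx => (g.sqrtDet_pos p (e.map_source hx)).ne'
  refine ⟨_, hW, fun f hf => ?_⟩
  rw [← setIntegral_eq_integral_of_forall_compl_eq_zero (s := e.source) (μ := g.vol)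
      fun x hx => by
        rw [image_eq_zero_of_notMem_tsupport fun h => hx (hsupp h), zero_mul, zero_mul],
    he, g.integral_source p (h := fun x => ρ x * (w (e x) / g.sqrtDet p (e x)) * f x)
      (hW.mul hf).aestronglyMeasurable,
    ← setIntegral_eq_integral_of_forall_compl_eq_zero (s := e.target) (μ := volume)
      fun u hu => by rw [chartLocal_of_notMem p _ hu, mul_zero]]
  refine setIntegral_congr_fun e.open_target.measurableSet fun u hu => ?_
  have hne := (g.sqrtDet_pos p hu).ne'
  simp only [chartLocal_of_mem p _ hu, Pi.mul_apply]
  rw [← he, e.right_inv hu]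
  field_simp

/-- Rellich's inequality for a function localized in a chart: the Fourier coefficients of the localized
function are integrals over `M` against continuous functions. -/
theorem exists_integral_mul_sq_le (g : RMetric n M) {η : ℝ} (hη : 0 < η) (p : M) {ρ : M → ℝ}
    (hρ : ContMDiff (𝓡 n) 𝓘(ℝ, ℝ) ∞ ρ)
    (hsupp : tsupport ρ ⊆ (chartAt (EuclideanSpace ℝ (Fin n)) p).source) :
    ∃ (s : Finset (M → ℝ)) (c : ℝ), 0 ≤ c ∧ (∀ w ∈ s, Continuous w) ∧
      ∀ f : M → ℝ, ContMDiff (𝓡 n) 𝓘(ℝ, ℝ) ∞ f →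
        ∫ x, (ρ * f) x ^ 2 ∂g.vol ≤
          η * g.smoothEnergy f + c * ∑ w ∈ s, (∫ x, w x * f x ∂g.vol) ^ 2 := by
  classical
  obtain ⟨C, hC, h⟩ := g.exists_chartLocal_energy_le p hρ hsupp
  obtain ⟨t, c, hc, ht⟩ := exists_integral_sq_le_fourier (isCompact_chart_image p hsupp)
    (η := η / (2 * C ^ 2 + 1)) (by positivity)
  choose W hWc hW using fun ξ : EuclideanSpace ℝ (Fin n) =>
    g.exists_integral_mul_chartLocal_eq p hρ hsupp
      (w := fun v => Real.cos (2 * Real.pi * inner ℝ v ξ)) (by fun_prop)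
  choose Z hZc hZ using fun ξ : EuclideanSpace ℝ (Fin n) =>
    g.exists_integral_mul_chartLocal_eq p hρ hsupp
      (w := fun v => Real.sin (2 * Real.pi * inner ℝ v ξ)) (by fun_prop)
  refine ⟨t.image W ∪ t.image Z, C * (c * (t.card * 2)), by positivity, ?_, fun f hf => ?_⟩
  · intro w hw
    rcases Finset.mem_union.1 hw with hw | hw <;> obtain ⟨ξ, -, rfl⟩ := Finset.mem_image.1 hw
    exacts [hWc ξ, hZc ξ]
  have hρf : ContMDiff (𝓡 n) 𝓘(ℝ, ℝ) ∞ (ρ * f) := hρ.mul hf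
  have hs : tsupport (ρ * f) ⊆ (chartAt (EuclideanSpace ℝ (Fin n)) p).source :=
    tsupport_mul_subset_left.trans hsupp
  have h1 := ht _ (contDiff_chartLocal p hρf hs) fun u hu => by
    by_cases huV : u ∈ (chartAt (EuclideanSpace ℝ (Fin n)) p).target
    · rw [chartLocal_of_mem p _ huV, Pi.mul_apply,
        eq_zero_of_notMem_chart_image p huV hu, zero_mul]
    · exact chartLocal_of_notMem p _ huV
  obtain ⟨e1, e2, e3⟩ := h f hf
  set A := ∑ w ∈ t.image W ∪ t.image Z, (∫ x, w x * f x ∂g.vol) ^ 2 with hA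
  have hE := g.smoothEnergy_nonneg f
  have hle : ∀ w ∈ t.image W ∪ t.image Z, (∫ x, w x * f x ∂g.vol) ^ 2 ≤ A := fun w hw =>
    Finset.single_le_sum (f := fun w : M → ℝ => (∫ x, w x * f x ∂g.vol) ^ 2)
      (fun _ _ => sq_nonneg _) hw
  have hsum : ∑ ξ ∈ t,
      ((∫ v, Real.cos (2 * Real.pi * inner ℝ v ξ) * chartLocal n p (ρ * f) v) ^ 2 +
        (∫ v, Real.sin (2 * Real.pi * inner ℝ v ξ) * chartLocal n p (ρ * f) v) ^ 2) ≤
      t.card * 2 * A := by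
    rw [mul_assoc, ← nsmul_eq_mul]
    refine Finset.sum_le_card_nsmul _ _ _ fun ξ hξ => ?_
    rw [hW ξ f hf.continuous, hZ ξ f hf.continuous, two_mul]
    exact add_le_add (hle _ (Finset.mem_union_left _ (Finset.mem_image_of_mem _ hξ)))
      (hle _ (Finset.mem_union_right _ (Finset.mem_image_of_mem _ hξ)))
  have hηC : C * (η / (2 * C ^ 2 + 1) * (C * g.smoothEnergy f + C * g.smoothEnergy f)) ≤
      η * g.smoothEnergy f := by
    rw [show C * (η / (2 * C ^ 2 + 1) * (C * g.smoothEnergy f + C * g.smoothEnergy f)) =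
      (2 * C ^ 2 / (2 * C ^ 2 + 1)) * (η * g.smoothEnergy f) by field_simp; ring]
    refine mul_le_of_le_one_left (by positivity) ?_
    rw [div_le_one (by positivity)]
    linarith
  calc ∫ x, (ρ * f) x ^ 2 ∂g.vol ≤ C * ∫ u, chartLocal n p (ρ * f) u ^ 2 := e3
    _ ≤ C * (η / (2 * C ^ 2 + 1) * (C * g.smoothEnergy f + C * g.smoothEnergy f) +
          c * (t.card * 2 * A)) := by
        refine mul_le_mul_of_nonneg_left (h1.trans (add_le_add ?_ ?_)) hC
        · exact mul_le_mul_of_nonneg_left (add_le_add e1 e2) (by positivity)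
        · exact mul_le_mul_of_nonneg_left hsum hc
    _ ≤ _ := by
        rw [mul_add]
        refine add_le_add hηC (le_of_eq ?_)
        ring

/-- **Rellich's theorem** as an inequality: up to a small multiple of the energy, the `L²`-norm of
a smooth function is controlled by finitely many continuous linear functionals on `L²`. -/
theorem exists_integral_sq_le (g : RMetric n M) {η : ℝ} (hη : 0 < η) :
    ∃ (s : Finset (M → ℝ)) (c : ℝ), 0 ≤ c ∧ (∀ w ∈ s, Continuous w) ∧
      ∀ f : M → ℝ, ContMDiff (𝓡 n) 𝓘(ℝ, ℝ) ∞ f →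
        ∫ x, f x ^ 2 ∂g.vol ≤
          η * g.smoothEnergy f + c * ∑ w ∈ s, (∫ x, w x * f x ∂g.vol) ^ 2 := by
  classical
  obtain ⟨t, ρ, hρ, hsupp, hsum⟩ := exists_partitionOfUnity n M
  choose s c hc hs h using fun p => g.exists_integral_mul_sq_le
    (η := η / ((t.card : ℝ) ^ 2 + 1)) (by positivity) p (hρ p) (hsupp p)
  refine ⟨t.biUnion s, t.card * ∑ p ∈ t, c p,
    mul_nonneg (Nat.cast_nonneg _) (Finset.sum_nonneg fun p _ => hc p), ?_, fun f hf => ?_⟩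
  · intro w hw
    obtain ⟨p, -, hp⟩ := Finset.mem_biUnion.1 hw
    exact hs p w hp
  have hE := g.smoothEnergy_nonneg f
  set A := ∑ w ∈ t.biUnion s, (∫ x, w x * f x ∂g.vol) ^ 2 with hA
  have hi : ∀ p, Integrable (fun x => (ρ p * f) x ^ 2) g.vol := fun p =>
    Continuous.integrable_vol
      ((((hρ p).mul hf).continuous (I := 𝓡 n) (I' := 𝓘(ℝ, ℝ))).pow 2)
  calc ∫ x, f x ^ 2 ∂g.vol ≤ ∫ x, t.card * ∑ p ∈ t, (ρ p * f) x ^ 2 ∂g.vol := by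
        refine integral_mono (Continuous.integrable_vol (hf.continuous.pow 2))
          ((integrable_finsetSum _ fun p _ => hi p).const_mul _) fun x => ?_
        have hx : f x = ∑ p ∈ t, (ρ p * f) x := by
          conv_lhs => rw [sum_mul_eq_self hsum f]
          rw [Finset.sum_apply]
        simp only
        rw [hx]
        exact sq_sum_le_card_mul_sum_sq
    _ = t.card * ∑ p ∈ t, ∫ x, (ρ p * f) x ^ 2 ∂g.vol := by
        rw [integral_const_mul, integral_finsetSum _ fun p _ => hi p]
    _ ≤ t.card * ∑ p ∈ t, (η / ((t.card : ℝ) ^ 2 + 1) * g.smoothEnergy f + c p * A) := by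
        refine mul_le_mul_of_nonneg_left (Finset.sum_le_sum fun p hp => (h p f hf).trans ?_)
          (Nat.cast_nonneg _)
        refine add_le_add le_rfl (mul_le_mul_of_nonneg_left ?_ (hc p))
        exact Finset.sum_le_sum_of_subset_of_nonneg (Finset.subset_biUnion_of_mem s hp)
          fun _ _ _ => sq_nonneg _
    _ = (t.card : ℝ) ^ 2 / ((t.card : ℝ) ^ 2 + 1) * (η * g.smoothEnergy f) +
          t.card * (∑ p ∈ t, c p) * A := by
        rw [Finset.sum_add_distrib, Finset.sum_const, nsmul_eq_mul, ← Finset.sum_mul]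
        ring
    _ ≤ _ := by
        refine add_le_add (mul_le_of_le_one_left (by positivity) ?_) le_rfl
        rw [div_le_one (by positivity)]
        linarith

end SobolevRellich

end RMetric

namespace RMetric

section VectorFields

set_option linter.unusedSectionVars false

variable {n : ℕ} {M : Type*} [TopologicalSpace M] [ChartedSpace (EuclideanSpace ℝ (Fin n)) M]
  [IsManifold (𝓡 n) ∞ M]

/-! ### A finite family of gradients spanning all tangent spaces -/

/-- The vector field on the domain of the chart at `p` with constant components `c`. -/
noncomputable def coordField (p : M) (c : M → EuclideanSpace ℝ (Fin n)) (x : M) :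
    TangentSpace (𝓡 n) x :=
  (coordMap p (chartAt (EuclideanSpace ℝ (Fin n)) p x) (c x) : EuclideanSpace ℝ (Fin n))

theorem coordField_symm (p : M) (c : M → EuclideanSpace ℝ (Fin n)) {u : EuclideanSpace ℝ (Fin n)}
    (hu : u ∈ (chartAt (EuclideanSpace ℝ (Fin n)) p).target) :
    coordField p c ((chartAt (EuclideanSpace ℝ (Fin n)) p).symm u) =
      coordMap p u (c ((chartAt (EuclideanSpace ℝ (Fin n)) p).symm u)) := by
  have h := (chartAt (EuclideanSpace ℝ (Fin n)) p).right_inv hu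
  exact congrArg (fun v => (coordMap p v (c ((chartAt (EuclideanSpace ℝ (Fin n)) p).symm u)) :
    EuclideanSpace ℝ (Fin n))) h

theorem exists_chart_symm_eq (p : M) {x : M}
    (hx : x ∈ (chartAt (EuclideanSpace ℝ (Fin n)) p).source) :
    ∃ u ∈ (chartAt (EuclideanSpace ℝ (Fin n)) p).target,
      (chartAt (EuclideanSpace ℝ (Fin n)) p).symm u = x :=
  ⟨_, (chartAt (EuclideanSpace ℝ (Fin n)) p).map_source hx,
    (chartAt (EuclideanSpace ℝ (Fin n)) p).left_inv hx⟩

theorem chartMap_injective (p : M) {x : M}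
    (hx : x ∈ (chartAt (EuclideanSpace ℝ (Fin n)) p).source) :
    Function.Injective (chartMap (n := n) p x) := by
  obtain ⟨u, hu, rfl⟩ := exists_chart_symm_eq p hx
  exact Function.LeftInverse.injective (coordMap_chartMap p hu)

theorem chartMap_coordField (p : M) (c : M → EuclideanSpace ℝ (Fin n)) {x : M}
    (hx : x ∈ (chartAt (EuclideanSpace ℝ (Fin n)) p).source) :
    chartMap p x (coordField p c x) = c x := by
  obtain ⟨u, hu, rfl⟩ := exists_chart_symm_eq p hx
  rw [coordField_symm p c hu, chartMap_coordMap p hu]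

theorem continuousOn_chartMap_coordField (p q : M) {c : M → EuclideanSpace ℝ (Fin n)}
    (hc : ContinuousOn c (chartAt (EuclideanSpace ℝ (Fin n)) p).source) :
    ContinuousOn (fun x => chartMap q x (coordField p c x))
      ((chartAt (EuclideanSpace ℝ (Fin n)) p).source ∩
        (chartAt (EuclideanSpace ℝ (Fin n)) q).source) := by
  set e := chartAt (EuclideanSpace ℝ (Fin n)) p with he
  set e' := chartAt (EuclideanSpace ℝ (Fin n)) q with he'
  have hO : IsOpen (e.target ∩ e.symm ⁻¹' e'.source) := e.symm.isOpen_inter_preimage e'.open_source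
  have h1 : ContDiffOn ℝ ∞ (fun u => e' (e.symm u)) (e.target ∩ e.symm ⁻¹' e'.source) := by
    rw [← contMDiffOn_iff_contDiffOn]
    exact (contMDiffOn_chart (x := q)).comp (contMDiffOn_chart_symm.mono Set.inter_subset_left)
      fun u hu => hu.2
  have h2 := (h1.continuousOn_fderiv_of_isOpen hO (by simp)).comp
    (e.continuousOn.mono (Set.inter_subset_left (t := e'.source)))
    fun x hx => ⟨e.map_source hx.1, by
      rw [Set.mem_preimage, e.left_inv hx.1]; exact hx.2⟩
  refine (h2.clm_apply (hc.mono Set.inter_subset_left)).congr fun x hx => ?_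
  obtain ⟨u, hu, rfl⟩ := exists_chart_symm_eq p hx.1
  rw [coordField_symm p c hu]
  simp only [Function.comp]
  rw [← he, e.right_inv hu, (hasFDerivAt_transition p q hu hx.2).fderiv]
  rfl

variable [MeasurableSpace M] [BorelSpace M]

/-! ### Measurable vector fields -/

theorem AEMeasurableField.add {g : RMetric n M} {X Y : ∀ x : M, TangentSpace (𝓡 n) x}
    (hX : g.AEMeasurableField X) (hY : g.AEMeasurableField Y) :
    g.AEMeasurableField fun x => X x + Y x := fun p =>
  ((hX p).add (hY p)).congr (Eventually.of_forall fun x =>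
    ((chartMap p x).map_add (X x) (Y x)).symm)

theorem AEMeasurableField.sub {g : RMetric n M} {X Y : ∀ x : M, TangentSpace (𝓡 n) x}
    (hX : g.AEMeasurableField X) (hY : g.AEMeasurableField Y) :
    g.AEMeasurableField fun x => X x - Y x := fun p =>
  ((hX p).sub (hY p)).congr (Eventually.of_forall fun x =>
    ((chartMap p x).map_sub (X x) (Y x)).symm)

theorem AEMeasurableField.smul {g : RMetric n M} {X : ∀ x : M, TangentSpace (𝓡 n) x}
    (hX : g.AEMeasurableField X) {f : M → ℝ} (hf : AEMeasurable f g.vol) :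
    g.AEMeasurableField fun x => f x • X x := fun p =>
  (hf.restrict.smul (hX p)).congr (Eventually.of_forall fun x =>
    ((chartMap p x).map_smul (f x) (X x)).symm)

theorem AEMeasurableField.sum {g : RMetric n M} {ι : Type*} {s : Finset ι}
    {X : ι → ∀ x : M, TangentSpace (𝓡 n) x}
    (hX : ∀ i ∈ s, g.AEMeasurableField (X i)) : g.AEMeasurableField fun x => ∑ i ∈ s, X i x :=
  fun p => (Finset.aemeasurable_fun_sum s fun i hi => hX i hi p).congr
    (Eventually.of_forall fun x => (map_sum (chartMap p x) (fun i => X i x) s).symm)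

variable [T2Space M] [CompactSpace M]

theorem aemeasurable_of_charts {β : Type*} [MeasurableSpace β] {μ : Measure M} {h : M → β}
    (hh : ∀ p : M, AEMeasurable h (μ.restrict (chartAt (EuclideanSpace ℝ (Fin n)) p).source)) :
    AEMeasurable h μ := by
  obtain ⟨t, ht⟩ := isCompact_univ.elim_finite_subcover
    (fun p : M => (chartAt (EuclideanSpace ℝ (Fin n)) p).source)
    (fun p => (chartAt (EuclideanSpace ℝ (Fin n)) p).open_source)
    (fun x _ => Set.mem_iUnion.2 ⟨x, mem_chart_source _ x⟩)
  have h1 : AEMeasurable h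
      (μ.restrict (⋃ p : t, (chartAt (EuclideanSpace ℝ (Fin n)) (p : M)).source)) :=
    AEMeasurable.iUnion fun p => hh p
  have h2 : (⋃ p : t, (chartAt (EuclideanSpace ℝ (Fin n)) (p : M)).source) = Set.univ :=
    Set.eq_univ_of_forall fun x => by
      obtain ⟨p, hp, hx⟩ := Set.mem_iUnion₂.1 (ht (Set.mem_univ x))
      exact Set.mem_iUnion.2 ⟨⟨p, hp⟩, hx⟩
  rwa [h2, Measure.restrict_univ] at h1

theorem AEMeasurableField.inner {g : RMetric n M} {X Y : ∀ x : M, TangentSpace (𝓡 n) x}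
    (hX : g.AEMeasurableField X) (hY : g.AEMeasurableField Y) :
    AEMeasurable (fun x => g.inner x (X x) (Y x)) g.vol := by
  refine aemeasurable_of_charts (n := n) fun p => ?_
  have hG : ∀ i j, AEMeasurable (fun x => g.gram p (chartAt (EuclideanSpace ℝ (Fin n)) p x) i j)
      (g.vol.restrict (chartAt (EuclideanSpace ℝ (Fin n)) p).source) := fun i j =>
    (((g.contDiffOn_gram_apply p i j).continuousOn.comp
      (chartAt (EuclideanSpace ℝ (Fin n)) p).continuousOn
      (chartAt (EuclideanSpace ℝ (Fin n)) p).mapsTo)).aemeasurable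
      (chartAt (EuclideanSpace ℝ (Fin n)) p).open_source.measurableSet
  have hc : ∀ {Z : ∀ x : M, TangentSpace (𝓡 n) x}, g.AEMeasurableField Z → ∀ i,
      AEMeasurable (fun x => components p Z x i)
        (g.vol.restrict (chartAt (EuclideanSpace ℝ (Fin n)) p).source) := fun hZ i =>
    (EuclideanSpace.proj (𝕜 := ℝ) i : EuclideanSpace ℝ (Fin n) →L[ℝ] ℝ).measurable.comp_aemeasurable
      (hZ p)
  have h1 : AEMeasurable (fun x => ∑ i, ∑ j, components p X x i * components p Y x j *
      g.gram p (chartAt (EuclideanSpace ℝ (Fin n)) p x) i j)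
      (g.vol.restrict (chartAt (EuclideanSpace ℝ (Fin n)) p).source) :=
    Finset.aemeasurable_fun_sum _ fun i _ => Finset.aemeasurable_fun_sum _ fun j _ =>
      ((hc hX i).mul (hc hY j)).mul (hG i j)
  refine h1.congr ?_
  refine (ae_restrict_iff' (chartAt (EuclideanSpace ℝ (Fin n)) p).open_source.measurableSet).2
    (Eventually.of_forall fun x hx => ?_)
  obtain ⟨u, hu, rfl⟩ := exists_chart_symm_eq p hx
  beta_reduce
  rw [g.inner_eq_sum_components p X Y hu, (chartAt (EuclideanSpace ℝ (Fin n)) p).right_inv hu]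

theorem AEMeasurableField.normSq {g : RMetric n M} {X : ∀ x : M, TangentSpace (𝓡 n) x}
    (hX : g.AEMeasurableField X) : AEMeasurable (fun x => g.normSq x (X x)) g.vol :=
  hX.inner hX

theorem AEMeasurableField.gnorm {g : RMetric n M} {X : ∀ x : M, TangentSpace (𝓡 n) x}
    (hX : g.AEMeasurableField X) : AEMeasurable (fun x => g.gnorm x (X x)) g.vol :=
  hX.normSq.sqrt

theorem aemeasurableField_grad (g : RMetric n M) {f : M → ℝ}
    (hf : ContMDiff (𝓡 n) 𝓘(ℝ, ℝ) ∞ f) : g.AEMeasurableField (g.grad f) := by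
  intro p
  have hc : ContinuousOn (components p (g.grad f))
      (chartAt (EuclideanSpace ℝ (Fin n)) p).source := by
    have h1 : ∀ i, ContinuousOn (fun x => components p (g.grad f) x i)
        (chartAt (EuclideanSpace ℝ (Fin n)) p).source := fun i => by
      refine ((g.contDiffOn_components_grad hf p i).continuousOn.comp
        (chartAt (EuclideanSpace ℝ (Fin n)) p).continuousOn
        (chartAt (EuclideanSpace ℝ (Fin n)) p).mapsTo).congr fun x hx => ?_
      simp only [Function.comp]
      rw [(chartAt (EuclideanSpace ℝ (Fin n)) p).left_inv hx]
    exact (PiLp.continuous_toLp 2 _).comp_continuousOn (continuousOn_pi.2 h1)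
  exact hc.aemeasurable (chartAt (EuclideanSpace ℝ (Fin n)) p).open_source.measurableSet

theorem aemeasurableField_indicator_coordField (g : RMetric n M) (p : M) {S : Set M}
    (hS : MeasurableSet S) (hSp : S ⊆ (chartAt (EuclideanSpace ℝ (Fin n)) p).source)
    {c : M → EuclideanSpace ℝ (Fin n)}
    (hc : ContinuousOn c (chartAt (EuclideanSpace ℝ (Fin n)) p).source) :
    g.AEMeasurableField fun x => S.indicator (fun _ => (1 : ℝ)) x • coordField p c x := by
  classical
  intro q
  have hq := (chartAt (EuclideanSpace ℝ (Fin n)) q).open_source.measurableSet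
  have h1 : AEMeasurable (S.indicator fun x => chartMap q x (coordField p c x))
      (g.vol.restrict (chartAt (EuclideanSpace ℝ (Fin n)) q).source) := by
    rw [aemeasurable_indicator_iff hS, Measure.restrict_restrict hS]
    exact ((continuousOn_chartMap_coordField p q hc).mono
      (Set.inter_subset_inter_left _ hSp)).aemeasurable (hS.inter hq)
  refine h1.congr (Eventually.of_forall fun x => ?_)
  rw [components_eq, map_smul]
  by_cases hx : x ∈ S <;> simp [hx]

/-- Finitely many gradients span all tangent spaces, with bounded measurable coefficient fields.
The functions are `ρ` and `ρ xⁱ`, where `xⁱ` are the coordinates in a chart and `ρ` runs over a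
partition of unity: `ρ dxⁱ = d(ρ xⁱ) - xⁱ dρ`. -/
theorem exists_gradient_frame (g : RMetric n M) :
    ∃ (s : Finset (M × Option (Fin n))) (ψ : M × Option (Fin n) → M → ℝ)
      (Z : M × Option (Fin n) → ∀ x : M, TangentSpace (𝓡 n) x) (C : ℝ), 0 ≤ C ∧
      (∀ k, ContMDiff (𝓡 n) 𝓘(ℝ, ℝ) ∞ (ψ k)) ∧ (∀ k, g.AEMeasurableField (Z k)) ∧
      (∀ k ∈ s, ∀ x, g.normSq x (Z k x) ≤ C) ∧
      ∀ (x : M) (v : TangentSpace (𝓡 n) x),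
        v = ∑ k ∈ s, g.inner x (g.grad (ψ k) x) v • Z k x := by
  classical
  obtain ⟨t, ρ, hρ, hsupp, hsum⟩ := exists_partitionOfUnity n M
  let S : M → Set M := fun p => tsupport (ρ p)
  let c : M × Option (Fin n) → M → EuclideanSpace ℝ (Fin n) := fun k x =>
    k.2.elim (-chartAt (EuclideanSpace ℝ (Fin n)) k.1 x)
      fun i => EuclideanSpace.single i (1 : ℝ)
  let ψ : M × Option (Fin n) → M → ℝ := fun k x =>
    k.2.elim (ρ k.1 x) fun i => ρ k.1 x * chartAt (EuclideanSpace ℝ (Fin n)) k.1 x i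
  let Z : M × Option (Fin n) → ∀ x : M, TangentSpace (𝓡 n) x := fun k x =>
    (S k.1).indicator (fun _ => (1 : ℝ)) x • coordField k.1 (c k) x
  have hcc : ∀ k, ContinuousOn (c k) (chartAt (EuclideanSpace ℝ (Fin n)) k.1).source := by
    rintro ⟨p, _ | i⟩
    · exact (chartAt (EuclideanSpace ℝ (Fin n)) p).continuousOn.neg
    · exact continuousOn_const
  have hxi : ∀ (p : M) (i : Fin n), ∀ x ∈ (chartAt (EuclideanSpace ℝ (Fin n)) p).source,
      ContMDiffAt (𝓡 n) 𝓘(ℝ, ℝ) ∞ (fun x => chartAt (EuclideanSpace ℝ (Fin n)) p x i) x := by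
    intro p i x hx
    have h1 := (contMDiffOn_chart (I := 𝓡 n) (n := ∞) (x := p)).contMDiffAt
      ((chartAt (EuclideanSpace ℝ (Fin n)) p).open_source.mem_nhds hx)
    exact (EuclideanSpace.proj (𝕜 := ℝ) i :
      EuclideanSpace ℝ (Fin n) →L[ℝ] ℝ).contMDiff.contMDiffAt.comp x h1
  have hψ : ∀ k, ContMDiff (𝓡 n) 𝓘(ℝ, ℝ) ∞ (ψ k) := by
    rintro ⟨p, _ | i⟩
    · exact hρ p
    · refine contMDiff_of_tsupport fun x hx => ?_
      exact ((hρ p).contMDiffAt).mul (hxi p i x (hsupp p (tsupport_mul_subset_left hx)))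
  have hb : ∀ k, ∃ C, 0 ≤ C ∧ ∀ x, g.normSq x (Z k x) ≤ C := by
    intro k
    obtain ⟨C, hC, hCb⟩ := g.exists_coordMetric_bound k.1 (isCompact_chart_image k.1 (hsupp k.1))
      (chart_image_subset k.1 (hsupp k.1))
    obtain ⟨D, hD⟩ := (isClosed_tsupport (ρ k.1)).isCompact.exists_bound_of_continuousOn
      ((hcc k).mono (hsupp k.1))
    refine ⟨C * D ^ 2, by positivity, fun x => ?_⟩
    by_cases hx : x ∈ S k.1
    · have hx' := hsupp k.1 hx
      have e1 : g.normSq x (Z k x) = g.coordMetric k.1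
          (chartAt (EuclideanSpace ℝ (Fin n)) k.1 x) (c k x) (c k x) := by
        simp only [Z, Set.indicator_of_mem hx, one_smul]
        unfold RMetric.normSq
        rw [g.inner_eq_coordMetric k.1 hx', chartMap_coordField k.1 _ hx']
      rw [e1]
      refine (hCb _ ⟨x, hx, rfl⟩ _).trans (mul_le_mul_of_nonneg_left ?_ hC)
      exact pow_le_pow_left₀ (norm_nonneg _) (hD x hx) 2
    · have : Z k x = 0 := by simp [Z, hx]
      rw [this]
      simp only [RMetric.normSq, map_zero]
      positivity
  choose C hC0 hC using hb
  refine ⟨t ×ˢ Finset.univ, ψ, Z, ∑ k ∈ t ×ˢ Finset.univ, C k,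
    Finset.sum_nonneg fun k _ => hC0 k, hψ, fun k => ?_, fun k hk x => ?_, fun x v => ?_⟩
  · exact g.aemeasurableField_indicator_coordField k.1 (isClosed_tsupport _).measurableSet
      (hsupp k.1) (hcc k)
  · exact (hC k x).trans (Finset.single_le_sum (fun k _ => hC0 k) hk)
  · have key : ∀ p, ρ p x • v = ∑ a : Option (Fin n),
        g.inner x (g.grad (ψ (p, a)) x) v • Z (p, a) x := by
      intro p
      by_cases hx : x ∈ S p
      · have hx' := hsupp p hx
        have hi : ∀ i, g.inner x (g.grad (ψ (p, some i)) x) v =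
            ρ p x * chartMap p x v i +
              chartAt (EuclideanSpace ℝ (Fin n)) p x i * g.inner x (g.grad (ρ p) x) v := by
          intro i
          have e1 := g.grad_mul (mdifferentiableAt_of_smooth (hρ p) x)
            ((hxi p i x hx').mdifferentiableAt (by simp))
          have e2 : ψ (p, some i) =
            ρ p * fun x => chartAt (EuclideanSpace ℝ (Fin n)) p x i := rfl
          rw [e2, e1, map_add, _root_.add_apply, map_smul, map_smul, _root_.smul_apply,
            _root_.smul_apply, smul_eq_mul, smul_eq_mul]
          congr 2
          rw [inner_grad]
          have : IsManifold (𝓡 n) 1 M := isManifold_one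
          have h1 := ((mdifferentiable_chart (I := 𝓡 n) p).mdifferentiableAt hx').hasMFDerivAt
          have h2 := (EuclideanSpace.proj (𝕜 := ℝ) i :
            EuclideanSpace ℝ (Fin n) →L[ℝ] ℝ).hasMFDerivAt
              (x := chartAt (EuclideanSpace ℝ (Fin n)) p x)
          have h3 := (h2.comp x h1).mfderiv
          exact congrArg (fun L => L v) h3
        refine chartMap_injective (n := n) p hx' ?_
        have hZ : ∀ a, chartMap p x (Z (p, a) x) = c (p, a) x := by
          intro a
          simp only [Z, Set.indicator_of_mem hx, one_smul]
          exact chartMap_coordField p _ hx'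
        rw [map_smul, map_sum]
        simp only [map_smul, hZ, Fintype.sum_option, hi]
        ext j
        simp [c, ψ, Finset.sum_apply, Pi.single_apply]
        ring
      · have h0 : ρ p x = 0 := image_eq_zero_of_notMem_tsupport hx
        rw [h0, zero_smul]
        refine (Finset.sum_eq_zero fun a _ => ?_).symm
        simp [Z, hx]
    rw [Finset.sum_product, ← Finset.sum_congr rfl fun p _ => key p, ← Finset.sum_smul, hsum,
      one_smul]

end VectorFields

end RMetric

namespace RMetric

section SobolevSpace

set_option linter.unusedSectionVars false

variable {n : ℕ} {M : Type*} [TopologicalSpace M] [ChartedSpace (EuclideanSpace ℝ (Fin n)) M]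
  [IsManifold (𝓡 n) ∞ M] [MeasurableSpace M] [BorelSpace M] [T2Space M] [CompactSpace M]

/-! ### Square integrable vector fields -/

instance instIsFiniteMeasureVol (g : RMetric n M) : IsFiniteMeasure g.vol := g.isFiniteMeasure_vol

/-- Square integrable vector fields. -/
def IsL2Field (g : RMetric n M) (X : ∀ x : M, TangentSpace (𝓡 n) x) : Prop :=
  g.AEMeasurableField X ∧ Integrable (fun x => g.normSq x (X x)) g.vol

theorem IsL2Field.integrable_inner {g : RMetric n M} {X Y : ∀ x : M, TangentSpace (𝓡 n) x}
    (hX : g.IsL2Field X) (hY : g.IsL2Field Y) :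
    Integrable (fun x => g.inner x (X x) (Y x)) g.vol := by
  refine (hX.2.add hY.2).mono' (hX.1.inner hY.1).aestronglyMeasurable
    (Eventually.of_forall fun x => ?_)
  refine (g.abs_inner_le x _ _).trans ?_
  simp only [Pi.add_apply]
  rw [← gnorm_sq, ← gnorm_sq]
  nlinarith [sq_nonneg (g.gnorm x (X x) - g.gnorm x (Y x)), g.gnorm_nonneg x (X x),
    g.gnorm_nonneg x (Y x), mul_nonneg (g.gnorm_nonneg x (X x)) (g.gnorm_nonneg x (Y x))]

theorem IsL2Field.add {g : RMetric n M} {X Y : ∀ x : M, TangentSpace (𝓡 n) x}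
    (hX : g.IsL2Field X) (hY : g.IsL2Field Y) : g.IsL2Field fun x => X x + Y x := by
  refine ⟨hX.1.add hY.1, ?_⟩
  simp only [normSq_add]
  exact (hX.2.add ((hX.integrable_inner hY).const_mul 2)).add hY.2

theorem IsL2Field.smul {g : RMetric n M} {X : ∀ x : M, TangentSpace (𝓡 n) x}
    (hX : g.IsL2Field X) (c : ℝ) : g.IsL2Field fun x => c • X x := by
  refine ⟨hX.1.smul aemeasurable_const, ?_⟩
  simp only [normSq_smul]
  exact hX.2.const_mul _

theorem IsL2Field.sub {g : RMetric n M} {X Y : ∀ x : M, TangentSpace (𝓡 n) x}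
    (hX : g.IsL2Field X) (hY : g.IsL2Field Y) : g.IsL2Field fun x => X x - Y x := by
  refine ⟨hX.1.sub hY.1, ?_⟩
  simp only [normSq_sub]
  exact (hX.2.sub ((hX.integrable_inner hY).const_mul 2)).add hY.2

theorem isL2Field_grad (g : RMetric n M) {f : M → ℝ} (hf : ContMDiff (𝓡 n) 𝓘(ℝ, ℝ) ∞ f) :
    g.IsL2Field (g.grad f) :=
  ⟨g.aemeasurableField_grad hf, (g.continuous_inner_grad hf hf).integrable_vol⟩

theorem integral_inner_sub_left {g : RMetric n M} {X Y Z : ∀ x : M, TangentSpace (𝓡 n) x}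
    (hX : g.IsL2Field X) (hY : g.IsL2Field Y) (hZ : g.IsL2Field Z) :
    ∫ x, g.inner x (X x - Y x) (Z x) ∂g.vol =
      (∫ x, g.inner x (X x) (Z x) ∂g.vol) - ∫ x, g.inner x (Y x) (Z x) ∂g.vol := by
  rw [← integral_sub (hX.integrable_inner hZ) (hY.integrable_inner hZ)]
  simp only [map_sub, _root_.sub_apply]

theorem abs_integral_inner_le {g : RMetric n M} {X Y : ∀ x : M, TangentSpace (𝓡 n) x}
    (hX : g.IsL2Field X) (hY : g.IsL2Field Y) :
    |∫ x, g.inner x (X x) (Y x) ∂g.vol| ≤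
      Real.sqrt (∫ x, g.normSq x (X x) ∂g.vol) * Real.sqrt (∫ x, g.normSq x (Y x) ∂g.vol) := by
  have hi : Integrable (fun x => g.gnorm x (X x) * g.gnorm x (Y x)) g.vol := by
    refine (hX.2.add hY.2).mono' (hX.1.gnorm.mul hY.1.gnorm).aestronglyMeasurable
      (Eventually.of_forall fun x => ?_)
    rw [Real.norm_of_nonneg (mul_nonneg (g.gnorm_nonneg _ _) (g.gnorm_nonneg _ _))]
    simp only [Pi.add_apply]
    rw [← gnorm_sq, ← gnorm_sq]
    nlinarith [sq_nonneg (g.gnorm x (X x) - g.gnorm x (Y x)),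
      mul_nonneg (g.gnorm_nonneg x (X x)) (g.gnorm_nonneg x (Y x))]
  have h1 : |∫ x, g.inner x (X x) (Y x) ∂g.vol| ≤
      ∫ x, g.gnorm x (X x) * g.gnorm x (Y x) ∂g.vol :=
    abs_integral_le_integral_abs.trans
      (integral_mono (hX.integrable_inner hY).abs hi fun x => g.abs_inner_le x _ _)
  have h2 := sq_integral_mul_le (μ := g.vol) (f := fun x => g.gnorm x (X x))
    (h := fun x => g.gnorm x (Y x)) (by simpa only [gnorm_sq] using hX.2)
    (by simpa only [gnorm_sq] using hY.2) hi
  simp only [gnorm_sq] at h2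
  rw [← Real.sqrt_mul (integral_nonneg fun x => g.normSq_nonneg x _)]
  exact h1.trans ((le_abs_self _).trans (Real.abs_le_sqrt h2))

theorem tendsto_integral_inner {g : RMetric n M} {Y : ℕ → ∀ x : M, TangentSpace (𝓡 n) x}
    {X W : ∀ x : M, TangentSpace (𝓡 n) x} (hY : ∀ j, g.IsL2Field (Y j)) (hX : g.IsL2Field X)
    (hW : g.IsL2Field W)
    (h : Tendsto (fun j => ∫ x, g.normSq x (Y j x - X x) ∂g.vol) atTop (𝓝 0)) :
    Tendsto (fun j => ∫ x, g.inner x (Y j x) (W x) ∂g.vol) atTop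
      (𝓝 (∫ x, g.inner x (X x) (W x) ∂g.vol)) := by
  rw [tendsto_iff_norm_sub_tendsto_zero]
  have h1 : Tendsto (fun j => Real.sqrt (∫ x, g.normSq x (Y j x - X x) ∂g.vol) *
      Real.sqrt (∫ x, g.normSq x (W x) ∂g.vol)) atTop (𝓝 0) := by
    simpa using h.sqrt.mul_const (Real.sqrt (∫ x, g.normSq x (W x) ∂g.vol))
  refine squeeze_zero (fun j => norm_nonneg _) (fun j => ?_) h1
  rw [← integral_inner_sub_left (hY j) hX hW]
  exact abs_integral_inner_le ((hY j).sub hX) hW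

theorem tendsto_integral_normSq {g : RMetric n M} {Y : ℕ → ∀ x : M, TangentSpace (𝓡 n) x}
    {X : ∀ x : M, TangentSpace (𝓡 n) x} (hY : ∀ j, g.IsL2Field (Y j)) (hX : g.IsL2Field X)
    (h : Tendsto (fun j => ∫ x, g.normSq x (Y j x - X x) ∂g.vol) atTop (𝓝 0)) :
    Tendsto (fun j => ∫ x, g.normSq x (Y j x) ∂g.vol) atTop
      (𝓝 (∫ x, g.normSq x (X x) ∂g.vol)) := by
  have h1 := (tendsto_integral_inner hY hX hX h).const_mul 2
  have h2 := (h.add h1).sub_const (∫ x, g.normSq x (X x) ∂g.vol)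
  have e : 0 + 2 * ∫ x, g.inner x (X x) (X x) ∂g.vol - ∫ x, g.normSq x (X x) ∂g.vol =
      ∫ x, g.normSq x (X x) ∂g.vol := by
    simp only [normSq]; ring
  rw [zero_add] at h2 e
  rw [e] at h2
  refine h2.congr fun j => ?_
  simp only [normSq_sub]
  have i1 : Integrable (fun x => g.normSq x (Y j x) - 2 * g.inner x (Y j x) (X x)) g.vol :=
    (hY j).2.sub (((hY j).integrable_inner hX).const_mul 2)
  rw [integral_add i1 hX.2, integral_sub (hY j).2 (((hY j).integrable_inner hX).const_mul 2), integral_const_mul]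
  ring

/-! ### Smooth functions as elements of `L²` -/

/-- The class in `L²` of a smooth function. -/
noncomputable def smoothLp (g : RMetric n M) {f : M → ℝ} (hf : ContMDiff (𝓡 n) 𝓘(ℝ, ℝ) ∞ f) :
    Lp ℝ 2 g.vol :=
  (hf.continuous.memLp_of_hasCompactSupport
    (HasCompactSupport.of_compactSpace f) : MemLp f 2 g.vol).toLp f

theorem coeFn_smoothLp (g : RMetric n M) {f : M → ℝ} (hf : ContMDiff (𝓡 n) 𝓘(ℝ, ℝ) ∞ f) :
    g.smoothLp hf =ᵐ[g.vol] f := MemLp.coeFn_toLp _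

theorem inner_smoothLp (g : RMetric n M) {f : M → ℝ} (hf : ContMDiff (𝓡 n) 𝓘(ℝ, ℝ) ∞ f)
    (φ : Lp ℝ 2 g.vol) : inner ℝ φ (g.smoothLp hf) = ∫ x, f x * φ x ∂g.vol := by
  rw [L2.inner_def]
  refine integral_congr_ae ?_
  filter_upwards [g.coeFn_smoothLp hf] with x hx
  rw [hx]
  simp

theorem norm_smoothLp_sq (g : RMetric n M) {f : M → ℝ} (hf : ContMDiff (𝓡 n) 𝓘(ℝ, ℝ) ∞ f) :
    ‖g.smoothLp hf‖ ^ 2 = ∫ x, f x ^ 2 ∂g.vol := by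
  rw [← real_inner_self_eq_norm_sq, inner_smoothLp]
  refine integral_congr_ae ?_
  filter_upwards [g.coeFn_smoothLp hf] with x hx
  rw [hx, sq]

theorem eLpNorm_sub_eq (g : RMetric n M) {f : M → ℝ} (hf : ContMDiff (𝓡 n) 𝓘(ℝ, ℝ) ∞ f)
    (φ : Lp ℝ 2 g.vol) :
    eLpNorm (fun x => f x - φ x) 2 g.vol = ENNReal.ofReal ‖g.smoothLp hf - φ‖ := by
  rw [Lp.norm_def, ENNReal.ofReal_toReal (Lp.eLpNorm_ne_top _)]
  refine eLpNorm_congr_ae ?_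
  filter_upwards [g.coeFn_smoothLp hf, Lp.coeFn_sub (g.smoothLp hf) φ] with x h1 h2
  rw [h2, Pi.sub_apply, h1]

theorem tendsto_ofReal_zero_iff {ι : Type*} {l : Filter ι} {u : ι → ℝ} (hu : ∀ i, 0 ≤ u i) :
    Tendsto (fun i => ENNReal.ofReal (u i)) l (𝓝 0) ↔ Tendsto u l (𝓝 0) := by
  rw [← ENNReal.ofReal_zero]
  refine ⟨fun h => ?_, fun h => ENNReal.tendsto_ofReal h⟩
  have := (ENNReal.tendsto_toReal ENNReal.ofReal_ne_top).comp h
  simpa [Function.comp_def, ENNReal.toReal_ofReal (hu _)] using this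

/-! ### Algebra of Sobolev gradients -/

theorem HasSobolevGrad.isL2Field {g : RMetric n M} {φ : Lp ℝ 2 g.vol}
    {X : ∀ x : M, TangentSpace (𝓡 n) x} (h : g.HasSobolevGrad φ X) : g.IsL2Field X := by
  obtain ⟨hX, f, hf, -, hg⟩ := h
  obtain ⟨j, hj⟩ := (hg.eventually (gt_mem_nhds ENNReal.zero_lt_top)).exists
  have hd : g.IsL2Field fun x => g.grad (f j) x - X x := by
    have hm := (g.aemeasurableField_grad (hf j)).sub hX
    refine ⟨hm, hm.normSq.aestronglyMeasurable, ?_⟩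
    rwa [hasFiniteIntegral_iff_ofReal (Eventually.of_forall fun x => g.normSq_nonneg x _)]
  simpa using (g.isL2Field_grad (hf j)).sub hd

theorem lintegral_normSq {g : RMetric n M} {X : ∀ x : M, TangentSpace (𝓡 n) x}
    (hX : g.IsL2Field X) : ∫⁻ x, ENNReal.ofReal (g.normSq x (X x)) ∂g.vol =
      ENNReal.ofReal (∫ x, g.normSq x (X x) ∂g.vol) :=
  (ofReal_integral_eq_lintegral_ofReal hX.2
    (Eventually.of_forall fun x => g.normSq_nonneg x _)).symm

theorem HasSobolevGrad.exists_seq {g : RMetric n M} {φ : Lp ℝ 2 g.vol}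
    {X : ∀ x : M, TangentSpace (𝓡 n) x} (h : g.HasSobolevGrad φ X) :
    ∃ (f : ℕ → M → ℝ) (hf : ∀ j, ContMDiff (𝓡 n) 𝓘(ℝ, ℝ) ∞ (f j)),
      Tendsto (fun j => g.smoothLp (hf j)) atTop (𝓝 φ) ∧
      Tendsto (fun j => ∫ x, g.normSq x (g.grad (f j) x - X x) ∂g.vol) atTop (𝓝 0) := by
  have hX := h.isL2Field
  obtain ⟨-, f, hf, h1, h2⟩ := h
  refine ⟨f, hf, ?_, ?_⟩
  · rw [tendsto_iff_norm_sub_tendsto_zero]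
    simp only [fun j => g.eLpNorm_sub_eq (hf j) φ] at h1
    exact (tendsto_ofReal_zero_iff fun j => norm_nonneg _).1 h1
  · simp only [fun j => lintegral_normSq ((g.isL2Field_grad (hf j)).sub hX)] at h2
    exact (tendsto_ofReal_zero_iff fun j => integral_nonneg fun x => g.normSq_nonneg x _).1 h2

theorem hasSobolevGrad_of_forall {g : RMetric n M} {φ : Lp ℝ 2 g.vol}
    {X : ∀ x : M, TangentSpace (𝓡 n) x} (hX : g.IsL2Field X)
    (h : ∀ η : ℝ, 0 < η → ∃ (f : M → ℝ) (hf : ContMDiff (𝓡 n) 𝓘(ℝ, ℝ) ∞ f),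
      ‖g.smoothLp hf - φ‖ < η ∧ ∫ x, g.normSq x (g.grad f x - X x) ∂g.vol < η) :
    g.HasSobolevGrad φ X := by
  choose f hf h1 h2 using fun j : ℕ => h (1 / ((j : ℝ) + 1)) (by positivity)
  refine ⟨hX.1, f, hf, ?_, ?_⟩
  · simp only [fun j => g.eLpNorm_sub_eq (hf j) φ]
    refine (tendsto_ofReal_zero_iff fun j => norm_nonneg _).2 ?_
    exact squeeze_zero (fun j => norm_nonneg _) (fun j => (h1 j).le)
      tendsto_one_div_add_atTop_nhds_zero_nat
  · simp only [fun j => lintegral_normSq ((g.isL2Field_grad (hf j)).sub hX)]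
    refine (tendsto_ofReal_zero_iff fun j => integral_nonneg fun x => g.normSq_nonneg x _).2 ?_
    exact squeeze_zero (fun j => integral_nonneg fun x => g.normSq_nonneg x _)
      (fun j => (h2 j).le) tendsto_one_div_add_atTop_nhds_zero_nat

theorem HasSobolevGrad.exists_smooth {g : RMetric n M} {φ : Lp ℝ 2 g.vol}
    {X : ∀ x : M, TangentSpace (𝓡 n) x} (h : g.HasSobolevGrad φ X) {η : ℝ} (hη : 0 < η) :
    ∃ (f : M → ℝ) (hf : ContMDiff (𝓡 n) 𝓘(ℝ, ℝ) ∞ f),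
      ‖g.smoothLp hf - φ‖ < η ∧ ∫ x, g.normSq x (g.grad f x - X x) ∂g.vol < η := by
  obtain ⟨f, hf, h1, h2⟩ := h.exists_seq
  rw [tendsto_iff_norm_sub_tendsto_zero] at h1
  obtain ⟨j, a, b⟩ :=
    ((h1.eventually (gt_mem_nhds hη)).and (h2.eventually (gt_mem_nhds hη))).exists
  exact ⟨f j, hf j, a, b⟩

theorem hasSobolevGrad_smoothLp (g : RMetric n M) {f : M → ℝ}
    (hf : ContMDiff (𝓡 n) 𝓘(ℝ, ℝ) ∞ f) : g.HasSobolevGrad (g.smoothLp hf) (g.grad f) :=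
  hasSobolevGrad_of_forall (g.isL2Field_grad hf) fun η hη =>
    ⟨f, hf, by simpa using hη, by simpa [normSq] using hη⟩

theorem integral_normSq_add_le {g : RMetric n M} {X Y : ∀ x : M, TangentSpace (𝓡 n) x}
    (hX : g.IsL2Field X) (hY : g.IsL2Field Y) :
    ∫ x, g.normSq x (X x + Y x) ∂g.vol ≤
      2 * ((∫ x, g.normSq x (X x) ∂g.vol) + ∫ x, g.normSq x (Y x) ∂g.vol) := by
  rw [← integral_add hX.2 hY.2, ← integral_const_mul]
  exact integral_mono (hX.add hY).2 ((hX.2.add hY.2).const_mul 2) fun x => g.normSq_add_le x _ _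

theorem HasSobolevGrad.add {g : RMetric n M} {φ ψ : Lp ℝ 2 g.vol}
    {X Y : ∀ x : M, TangentSpace (𝓡 n) x} (h : g.HasSobolevGrad φ X)
    (h' : g.HasSobolevGrad ψ Y) : g.HasSobolevGrad (φ + ψ) fun x => X x + Y x := by
  refine hasSobolevGrad_of_forall (h.isL2Field.add h'.isL2Field) fun η hη => ?_
  obtain ⟨f, hf, a1, a2⟩ := h.exists_smooth (η := η / 4) (by positivity)
  obtain ⟨k, hk, b1, b2⟩ := h'.exists_smooth (η := η / 4) (by positivity)
  have hfk : ContMDiff (𝓡 n) 𝓘(ℝ, ℝ) ∞ (f + k) := hf.add hk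
  refine ⟨f + k, hfk, ?_, ?_⟩
  · have e : g.smoothLp hfk - (φ + ψ) = (g.smoothLp hf - φ) + (g.smoothLp hk - ψ) := by
      have : g.smoothLp hfk = g.smoothLp hf + g.smoothLp hk := MemLp.toLp_add _ _
      rw [this]; abel
    rw [e]
    exact (norm_add_le _ _).trans_lt (by linarith)
  · have e : ∀ x, g.grad (f + k) x - (X x + Y x) = (g.grad f x - X x) + (g.grad k x - Y x) := by
      intro x
      rw [g.grad_add (mdifferentiableAt_of_smooth hf x) (mdifferentiableAt_of_smooth hk x)]
      abel
    simp only [e]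
    refine (integral_normSq_add_le ((g.isL2Field_grad hf).sub h.isL2Field)
      ((g.isL2Field_grad hk).sub h'.isL2Field)).trans_lt ?_
    linarith

theorem HasSobolevGrad.smul {g : RMetric n M} {φ : Lp ℝ 2 g.vol}
    {X : ∀ x : M, TangentSpace (𝓡 n) x} (h : g.HasSobolevGrad φ X) (c : ℝ) :
    g.HasSobolevGrad (c • φ) fun x => c • X x := by
  refine hasSobolevGrad_of_forall (h.isL2Field.smul c) fun η hη => ?_
  obtain ⟨f, hf, a1, a2⟩ := h.exists_smooth (η := η / (c ^ 2 + |c| + 1)) (by positivity)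
  have hfk : ContMDiff (𝓡 n) 𝓘(ℝ, ℝ) ∞ (c • f) :=
    (contMDiff_const : ContMDiff (𝓡 n) 𝓘(ℝ, ℝ) ∞ fun _ : M => c).mul hf
  rw [lt_div_iff₀ (by positivity)] at a1 a2
  refine ⟨c • f, hfk, ?_, ?_⟩
  · have e : g.smoothLp hfk - c • φ = c • (g.smoothLp hf - φ) := by
      have : g.smoothLp hfk = c • g.smoothLp hf := MemLp.toLp_const_smul _ _
      rw [this, smul_sub]
    rw [e, norm_smul, Real.norm_eq_abs]
    nlinarith [norm_nonneg (g.smoothLp hf - φ), sq_nonneg c]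
  · have e : ∀ x, g.grad (c • f) x - c • X x = c • (g.grad f x - X x) := by
      intro x
      rw [g.grad_const_smul c (mdifferentiableAt_of_smooth hf x), smul_sub]
    simp only [e, normSq_smul]
    rw [integral_const_mul]
    have h0 : 0 ≤ ∫ x, g.normSq x (g.grad f x - X x) ∂g.vol :=
      integral_nonneg fun x => g.normSq_nonneg x _
    nlinarith [abs_nonneg c, mul_nonneg (abs_nonneg c) h0]

/-! ### Closability of the gradient -/

/-- The weak formulation of the gradient. The right-hand side does not involve `X`, which is why
the gradient of a function in the Sobolev space is unique. -/
theorem HasSobolevGrad.integral_mul_inner_grad {g : RMetric n M} {φ : Lp ℝ 2 g.vol}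
    {X : ∀ x : M, TangentSpace (𝓡 n) x} (h : g.HasSobolevGrad φ X) {η ψ : M → ℝ}
    (hη : ContMDiff (𝓡 n) 𝓘(ℝ, ℝ) ∞ η) (hψ : ContMDiff (𝓡 n) 𝓘(ℝ, ℝ) ∞ ψ) :
    ∫ x, η x * g.inner x (X x) (g.grad ψ x) ∂g.vol =
      -∫ x, (η x * g.laplacian ψ x + g.inner x (g.grad η x) (g.grad ψ x)) * φ x ∂g.vol := by
  obtain ⟨f, hf, h1, h2⟩ := h.exists_seq
  set k : M → ℝ := fun x => η x * g.laplacian ψ x + g.inner x (g.grad η x) (g.grad ψ x) with hk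
  have hkc : Continuous k :=
    (hη.continuous.mul (g.continuous_laplacian hψ)).add (g.continuous_inner_grad hη hψ)
  have hkm : MemLp k 2 g.vol :=
    hkc.memLp_of_hasCompactSupport (HasCompactSupport.of_compactSpace k)
  have hW : g.IsL2Field fun x => η x • g.grad ψ x := by
    refine ⟨(g.aemeasurableField_grad hψ).smul hη.continuous.measurable.aemeasurable, ?_⟩
    simp only [normSq_smul]
    exact ((hη.continuous.pow 2).mul (g.continuous_inner_grad hψ hψ)).integrable_vol
  have l1 := tendsto_integral_inner (fun j => g.isL2Field_grad (hf j)) h.isL2Field hW h2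
  have hin : ∀ ξ : Lp ℝ 2 g.vol, inner ℝ ξ (hkm.toLp k) = ∫ x, k x * ξ x ∂g.vol := by
    intro ξ
    rw [L2.inner_def]
    refine integral_congr_ae ?_
    filter_upwards [hkm.coeFn_toLp] with x hx
    rw [hx]
    simp
  have l2 : Tendsto (fun j => -inner ℝ (g.smoothLp (hf j)) (hkm.toLp k)) atTop
      (𝓝 (-inner ℝ φ (hkm.toLp k))) := (h1.inner tendsto_const_nhds).neg
  have hj : ∀ j, ∫ x, g.inner x (g.grad (f j) x) (η x • g.grad ψ x) ∂g.vol =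
      -inner ℝ (g.smoothLp (hf j)) (hkm.toLp k) := by
    intro j
    have hfη : ContMDiff (𝓡 n) 𝓘(ℝ, ℝ) ∞ (f j * η) := (hf j).mul hη
    have e1 := g.integral_mul_laplacian hfη hψ
    have e2 : ∀ x, g.inner x (g.grad (f j * η) x) (g.grad ψ x) =
        f j x * g.inner x (g.grad η x) (g.grad ψ x) +
          g.inner x (g.grad (f j) x) (η x • g.grad ψ x) := by
      intro x
      rw [g.grad_mul (mdifferentiableAt_of_smooth (hf j) x) (mdifferentiableAt_of_smooth hη x)]
      simp
    have i1 : Integrable (fun x => f j x * g.inner x (g.grad η x) (g.grad ψ x)) g.vol :=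
      ((hf j).continuous.mul (g.continuous_inner_grad hη hψ)).integrable_vol
    have i2 : Integrable (fun x => (f j * η) x * g.laplacian ψ x) g.vol :=
      (((hf j).continuous.mul hη.continuous).mul (g.continuous_laplacian hψ)).integrable_vol
    simp only [e2] at e1
    rw [integral_add i1 ((g.isL2Field_grad (hf j)).integrable_inner hW)] at e1
    have e3 : inner ℝ (g.smoothLp (hf j)) (hkm.toLp k) =
        (∫ x, (f j * η) x * g.laplacian ψ x ∂g.vol) +
          ∫ x, f j x * g.inner x (g.grad η x) (g.grad ψ x) ∂g.vol := by
      rw [hin, ← integral_add i2 i1]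
      refine integral_congr_ae ?_
      filter_upwards [g.coeFn_smoothLp (hf j)] with x hx
      rw [hx, hk]
      simp only [Pi.mul_apply]
      ring
    rw [e3]
    linarith
  simp only [hj] at l1
  have := tendsto_nhds_unique l1 l2
  rw [hin] at this
  simpa using this

/-- Two gradients of the same function have the same components along every smooth gradient, by the
weak formulation, and finitely many smooth gradients determine a tangent vector. -/
theorem HasSobolevGrad.ae_eq {g : RMetric n M} {φ : Lp ℝ 2 g.vol}
    {X Y : ∀ x : M, TangentSpace (𝓡 n) x} (hX : g.HasSobolevGrad φ X)
    (hY : g.HasSobolevGrad φ Y) : ∀ᵐ x ∂g.vol, X x = Y x := by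
  obtain ⟨s, ψ, Z, C, -, hψ, -, -, hv⟩ := g.exists_gradient_frame
  have hk : ∀ k, ∀ᵐ x ∂g.vol,
      g.inner x (X x) (g.grad (ψ k) x) = g.inner x (Y x) (g.grad (ψ k) x) := by
    intro k
    have i1 := hX.isL2Field.integrable_inner (g.isL2Field_grad (hψ k))
    have i2 := hY.isL2Field.integrable_inner (g.isL2Field_grad (hψ k))
    refine ae_eq_of_integral_contMDiff_smul_eq (𝓡 n) i1.locallyIntegrable i2.locallyIntegrable
      fun η hη _ => ?_
    simp only [smul_eq_mul]
    rw [hX.integral_mul_inner_grad hη (hψ k), hY.integral_mul_inner_grad hη (hψ k)]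
  have hall : ∀ᵐ x ∂g.vol, ∀ k ∈ s,
      g.inner x (X x) (g.grad (ψ k) x) = g.inner x (Y x) (g.grad (ψ k) x) :=
    (s.eventually_all).2 fun k _ => hk k
  filter_upwards [hall] with x hx
  rw [hv x (X x), hv x (Y x)]
  refine Finset.sum_congr rfl fun k hks => ?_
  rw [g.symm x (g.grad (ψ k) x) (X x), g.symm x (g.grad (ψ k) x) (Y x), hx k hks]

theorem hasSobolevGrad_sobolevGrad {g : RMetric n M} {φ : Lp ℝ 2 g.vol}
    (h : φ ∈ g.sobolevSpace) : g.HasSobolevGrad φ (g.sobolevGrad φ) := by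
  have h' : ∃ X : ∀ x : M, TangentSpace (𝓡 n) x, g.HasSobolevGrad φ X := h
  rw [sobolevGrad, dif_pos h']
  exact h'.choose_spec

end SobolevSpace

end RMetric

namespace RMetric

section Completeness

set_option linter.unusedSectionVars false

variable {n : ℕ} {M : Type*} [TopologicalSpace M] [ChartedSpace (EuclideanSpace ℝ (Fin n)) M]
  [IsManifold (𝓡 n) ∞ M] [MeasurableSpace M] [BorelSpace M] [T2Space M] [CompactSpace M]

/-! ### The Sobolev space with its Dirichlet form -/

/-- The Sobolev space as a subspace of `L²`. -/
def sobolevSubmodule (g : RMetric n M) : Submodule ℝ (Lp ℝ 2 g.vol) where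
  carrier := g.sobolevSpace
  add_mem' h h' := ⟨_, (hasSobolevGrad_sobolevGrad h).add (hasSobolevGrad_sobolevGrad h')⟩
  zero_mem' := ⟨_, by
    simpa using (hasSobolevGrad_smoothLp g (contMDiff_const (c := (0 : ℝ)))).smul 0⟩
  smul_mem' c _ h := ⟨_, (hasSobolevGrad_sobolevGrad h).smul c⟩

theorem hasSobolevGrad_coe {g : RMetric n M} (φ : g.sobolevSubmodule) :
    g.HasSobolevGrad φ (g.sobolevGrad φ) := hasSobolevGrad_sobolevGrad φ.2

theorem integral_inner_congr {g : RMetric n M} {φ ψ : Lp ℝ 2 g.vol}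
    {X X' Y Y' : ∀ x : M, TangentSpace (𝓡 n) x} (hX : g.HasSobolevGrad φ X)
    (hX' : g.HasSobolevGrad φ X') (hY : g.HasSobolevGrad ψ Y) (hY' : g.HasSobolevGrad ψ Y') :
    ∫ x, g.inner x (X x) (Y x) ∂g.vol = ∫ x, g.inner x (X' x) (Y' x) ∂g.vol := by
  refine integral_congr_ae ?_
  filter_upwards [hX.ae_eq hX', hY.ae_eq hY'] with x h1 h2
  rw [h1, h2]

/-- The Dirichlet form `∫ g(∇φ, ∇ψ)`. -/
noncomputable def dirichletForm (g : RMetric n M) : LinearMap.BilinForm ℝ g.sobolevSubmodule :=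
  LinearMap.mk₂ ℝ
    (fun φ ψ => ∫ x, g.inner x (g.sobolevGrad φ x) (g.sobolevGrad ψ x) ∂g.vol)
    (fun φ φ' ψ => by
      have h := hasSobolevGrad_coe φ
      have h' := hasSobolevGrad_coe φ'
      have hψ := hasSobolevGrad_coe ψ
      rw [integral_inner_congr (hasSobolevGrad_coe (φ + φ')) (h.add h') hψ hψ,
        ← integral_add (h.isL2Field.integrable_inner hψ.isL2Field)
          (h'.isL2Field.integrable_inner hψ.isL2Field)]
      simp only [map_add, _root_.add_apply])
    (fun c φ ψ => by
      have h := hasSobolevGrad_coe φ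
      have hψ := hasSobolevGrad_coe ψ
      rw [integral_inner_congr (hasSobolevGrad_coe (c • φ)) (h.smul c) hψ hψ, smul_eq_mul,
        ← integral_const_mul]
      simp only [map_smul, _root_.smul_apply, smul_eq_mul])
    (fun φ ψ ψ' => by
      have h := hasSobolevGrad_coe ψ
      have h' := hasSobolevGrad_coe ψ'
      have hφ := hasSobolevGrad_coe φ
      rw [integral_inner_congr hφ hφ (hasSobolevGrad_coe (ψ + ψ')) (h.add h'),
        ← integral_add (hφ.isL2Field.integrable_inner h.isL2Field)
          (hφ.isL2Field.integrable_inner h'.isL2Field)]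
      simp only [map_add])
    (fun c φ ψ => by
      have h := hasSobolevGrad_coe ψ
      have hφ := hasSobolevGrad_coe φ
      rw [integral_inner_congr hφ hφ (hasSobolevGrad_coe (c • ψ)) (h.smul c), smul_eq_mul,
        ← integral_const_mul]
      simp only [map_smul, smul_eq_mul])

theorem dirichletForm_apply (g : RMetric n M) (φ ψ : g.sobolevSubmodule) :
    g.dirichletForm φ ψ = ∫ x, g.inner x (g.sobolevGrad φ x) (g.sobolevGrad ψ x) ∂g.vol := rfl

theorem dirichletForm_eq {g : RMetric n M} {φ ψ : g.sobolevSubmodule}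
    {X Y : ∀ x : M, TangentSpace (𝓡 n) x} (hX : g.HasSobolevGrad φ X)
    (hY : g.HasSobolevGrad ψ Y) :
    g.dirichletForm φ ψ = ∫ x, g.inner x (X x) (Y x) ∂g.vol :=
  integral_inner_congr (hasSobolevGrad_coe φ) hX (hasSobolevGrad_coe ψ) hY

theorem dirichletForm_comm (g : RMetric n M) (φ ψ : g.sobolevSubmodule) :
    g.dirichletForm φ ψ = g.dirichletForm ψ φ := by
  rw [dirichletForm_apply, dirichletForm_apply]
  exact integral_congr_ae (Eventually.of_forall fun x => g.symm x _ _)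

theorem dirichletForm_self_nonneg (g : RMetric n M) (φ : g.sobolevSubmodule) :
    0 ≤ g.dirichletForm φ φ := integral_nonneg fun x => g.normSq_nonneg x _

/-- A smooth function as an element of the Sobolev space. -/
noncomputable def smoothSobolev (g : RMetric n M) {f : M → ℝ}
    (hf : ContMDiff (𝓡 n) 𝓘(ℝ, ℝ) ∞ f) : g.sobolevSubmodule :=
  ⟨g.smoothLp hf, g.grad f, g.hasSobolevGrad_smoothLp hf⟩

/-- Green's formula on the Sobolev space. -/
theorem dirichletForm_smoothSobolev (g : RMetric n M) (φ : g.sobolevSubmodule) {ψ : M → ℝ}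
    (hψ : ContMDiff (𝓡 n) 𝓘(ℝ, ℝ) ∞ ψ) :
    g.dirichletForm φ (g.smoothSobolev hψ) =
      -∫ x, (φ : Lp ℝ 2 g.vol) x * g.laplacian ψ x ∂g.vol := by
  have h1 : ContMDiff (𝓡 n) 𝓘(ℝ, ℝ) ∞ fun _ : M => (1 : ℝ) := contMDiff_const
  have h := (hasSobolevGrad_coe φ).integral_mul_inner_grad h1 hψ
  simp only [one_mul] at h
  have h2 : g.dirichletForm φ (g.smoothSobolev hψ) =
      ∫ x, g.inner x (g.sobolevGrad φ x) (g.grad ψ x) ∂g.vol :=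
    dirichletForm_eq (hasSobolevGrad_coe φ) (g.hasSobolevGrad_smoothLp hψ)
  rw [h2, h]
  congr 1
  refine integral_congr_ae (Eventually.of_forall fun x => ?_)
  have h0 : g.grad (fun _ : M => (1 : ℝ)) x = 0 := g.grad_const 1 x
  simp only
  rw [h0, map_zero, _root_.zero_apply, add_zero, mul_comm]

/-! ### Completeness of the Sobolev space -/

theorem gnorm_sum_le (g : RMetric n M) (x : M) {ι : Type*} (s : Finset ι)
    (v : ι → TangentSpace (𝓡 n) x) : g.gnorm x (∑ k ∈ s, v k) ≤ ∑ k ∈ s, g.gnorm x (v k) :=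
  Finset.le_sum_of_subadditive (g.gnorm x) (by simp [gnorm, normSq]) (g.gnorm_add_le x) s v

theorem normSq_sum_le (g : RMetric n M) (x : M) {ι : Type*} (s : Finset ι)
    (v : ι → TangentSpace (𝓡 n) x) :
    g.normSq x (∑ k ∈ s, v k) ≤ s.card * ∑ k ∈ s, g.normSq x (v k) := by
  simp only [← gnorm_sq]
  exact (pow_le_pow_left₀ (g.gnorm_nonneg _ _) (g.gnorm_sum_le x s v) 2).trans
    sq_sum_le_card_mul_sum_sq

/-- The components of a square integrable vector field along a fixed gradient are bounded operators
into `L²`. -/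
theorem exists_inner_grad_sq_le (g : RMetric n M) {ψ : M → ℝ}
    (hψ : ContMDiff (𝓡 n) 𝓘(ℝ, ℝ) ∞ ψ) :
    ∃ D : ℝ, 0 ≤ D ∧ ∀ X : ∀ x : M, TangentSpace (𝓡 n) x, g.IsL2Field X →
      MemLp (fun x => g.inner x (g.grad ψ x) (X x)) 2 g.vol ∧
      ∫ x, g.inner x (g.grad ψ x) (X x) ^ 2 ∂g.vol ≤ D * ∫ x, g.normSq x (X x) ∂g.vol := by
  obtain ⟨D, hD0, hD⟩ := exists_abs_le_of_continuous (g.continuous_inner_grad hψ hψ)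
  refine ⟨D, hD0, fun X hX => ?_⟩
  have hb : ∀ x, g.inner x (g.grad ψ x) (X x) ^ 2 ≤ D * g.normSq x (X x) := by
    intro x
    have h1 := pow_le_pow_left₀ (abs_nonneg _) (g.abs_inner_le x (g.grad ψ x) (X x)) 2
    rw [sq_abs, mul_pow, gnorm_sq, gnorm_sq] at h1
    exact h1.trans (mul_le_mul_of_nonneg_right ((le_abs_self _).trans (hD x))
      (g.normSq_nonneg x _))
  have hm : AEStronglyMeasurable (fun x => g.inner x (g.grad ψ x) (X x)) g.vol :=
    ((g.aemeasurableField_grad hψ).inner hX.1).aestronglyMeasurable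
  have hi : Integrable (fun x => g.inner x (g.grad ψ x) (X x) ^ 2) g.vol :=
    (hX.2.const_mul D).mono' (hm.pow 2) (Eventually.of_forall fun x => by
      rw [Real.norm_of_nonneg (sq_nonneg _)]; exact hb x)
  refine ⟨(memLp_two_iff_integrable_sq hm).2 hi, ?_⟩
  rw [← integral_const_mul]
  exact integral_mono hi (hX.2.const_mul D) hb

theorem norm_toLp_sq {α : Type*} [MeasurableSpace α] {μ : Measure α} {f : α → ℝ}
    (hf : MemLp f 2 μ) : ‖hf.toLp f‖ ^ 2 = ∫ x, f x ^ 2 ∂μ := by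
  rw [← real_inner_self_eq_norm_sq, L2.inner_def]
  refine integral_congr_ae ?_
  filter_upwards [hf.coeFn_toLp] with x hx
  rw [hx]
  simp [sq]

/-- Square integrable vector fields form a complete space: in a frame of gradients this is the
completeness of `L²`. -/
theorem exists_tendsto_of_cauchy (g : RMetric n M) {X : ℕ → ∀ x : M, TangentSpace (𝓡 n) x}
    (hX : ∀ j, g.IsL2Field (X j))
    (hc : ∀ η > 0, ∃ N, ∀ i ≥ N, ∀ j ≥ N, ∫ x, g.normSq x (X i x - X j x) ∂g.vol < η) :
    ∃ Y : ∀ x : M, TangentSpace (𝓡 n) x, g.IsL2Field Y ∧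
      Tendsto (fun j => ∫ x, g.normSq x (X j x - Y x) ∂g.vol) atTop (𝓝 0) := by
  obtain ⟨s, ψ, Z, C, hC, hψ, hZ, hZC, hv⟩ := g.exists_gradient_frame
  choose D hD0 hD using fun k => g.exists_inner_grad_sq_le (hψ k)
  set A : M × Option (Fin n) → ℕ → Lp ℝ 2 g.vol := fun k j => (hD k (X j) (hX j)).1.toLp _ with hA
  have hAc : ∀ k, CauchySeq (A k) := by
    intro k
    rw [Metric.cauchySeq_iff]
    intro δ hδ
    obtain ⟨N, hN⟩ := hc (δ ^ 2 / (D k + 1)) (div_pos (by positivity) (by linarith [hD0 k]))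
    refine ⟨N, fun i hi j hj => ?_⟩
    have h1 : ‖A k i - A k j‖ ^ 2 ≤ D k * ∫ x, g.normSq x (X i x - X j x) ∂g.vol := by
      have e : A k i - A k j = (hD k _ ((hX i).sub (hX j))).1.toLp _ := by
        rw [hA, ← MemLp.toLp_sub]
        congr 1
        funext x
        simp
      rw [e, norm_toLp_sq]
      exact (hD k _ ((hX i).sub (hX j))).2
    have h2 := hN i hi j hj
    rw [lt_div_iff₀ (by linarith [hD0 k])] at h2
    have h3 : 0 ≤ ∫ x, g.normSq x (X i x - X j x) ∂g.vol :=
      integral_nonneg fun x => g.normSq_nonneg x _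
    rw [dist_eq_norm]
    refine lt_of_pow_lt_pow_left₀ 2 hδ.le ?_
    linarith
  choose a ha using fun k => cauchySeq_tendsto_of_complete (hAc k)
  set Y : ∀ x : M, TangentSpace (𝓡 n) x := fun x => ∑ k ∈ s, (a k) x • Z k x with hY
  have hYm : g.AEMeasurableField Y := AEMeasurableField.sum fun k _ =>
    (hZ k).smul (Lp.aestronglyMeasurable (a k)).aemeasurable
  have hpt : ∀ j x, g.normSq x (X j x - Y x) ≤
      s.card * ∑ k ∈ s, C * (g.inner x (g.grad (ψ k) x) (X j x) - a k x) ^ 2 := by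
    intro j x
    have e : X j x - Y x =
        ∑ k ∈ s, (g.inner x (g.grad (ψ k) x) (X j x) - a k x) • Z k x := by
      conv_lhs => rw [hv x (X j x), hY]
      simp only [sub_smul, Finset.sum_sub_distrib]
    rw [e]
    refine (g.normSq_sum_le x s _).trans ?_
    refine mul_le_mul_of_nonneg_left (Finset.sum_le_sum fun k hk => ?_) (Nat.cast_nonneg _)
    rw [normSq_smul, mul_comm]
    exact mul_le_mul_of_nonneg_right (hZC k hk x) (sq_nonneg _)
  have hmem : ∀ j k, MemLp (fun x => g.inner x (g.grad (ψ k) x) (X j x) - a k x) 2 g.vol :=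
    fun j k => (hD k (X j) (hX j)).1.sub (Lp.memLp (a k))
  have hint : ∀ j k, ∫ x, (g.inner x (g.grad (ψ k) x) (X j x) - a k x) ^ 2 ∂g.vol =
      ‖A k j - a k‖ ^ 2 := by
    intro j k
    rw [← norm_toLp_sq (hmem j k)]
    congr 2
    have : (hmem j k).toLp _ = (hD k (X j) (hX j)).1.toLp _ - (Lp.memLp (a k)).toLp _ :=
      MemLp.toLp_sub _ _
    rw [this, Lp.toLp_coeFn]
  have hbi : ∀ j, Integrable (fun x => s.card * ∑ k ∈ s,
      C * (g.inner x (g.grad (ψ k) x) (X j x) - a k x) ^ 2) g.vol := fun j =>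
    (integrable_finsetSum _ fun k _ => (hmem j k).integrable_sq.const_mul C).const_mul _
  have hsub : ∀ j, g.IsL2Field fun x => X j x - Y x := by
    intro j
    have hm := (hX j).1.sub hYm
    refine ⟨hm, (hbi j).mono' hm.normSq.aestronglyMeasurable (Eventually.of_forall fun x => ?_)⟩
    rw [Real.norm_of_nonneg (g.normSq_nonneg x _)]
    exact hpt j x
  refine ⟨Y, by simpa using (hX 0).sub (hsub 0), ?_⟩
  have hlim : Tendsto (fun j => s.card * ∑ k ∈ s, C * ‖A k j - a k‖ ^ 2) atTop (𝓝 0) := by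
    have h1 : ∀ k, Tendsto (fun j => C * ‖A k j - a k‖ ^ 2) atTop (𝓝 0) := fun k => by
      simpa using ((tendsto_iff_norm_sub_tendsto_zero.1 (ha k)).pow 2).const_mul C
    simpa using (tendsto_finsetSum s fun k _ => h1 k).const_mul (s.card : ℝ)
  refine squeeze_zero (fun j => integral_nonneg fun x => g.normSq_nonneg x _) (fun j => ?_) hlim
  refine (integral_mono (hsub j).2 (hbi j) (hpt j)).trans_eq ?_
  rw [integral_const_mul, integral_finsetSum _ fun k _ => (hmem j k).integrable_sq.const_mul C]
  simp only [integral_const_mul, hint]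

/-- The Sobolev space is complete: the gradient is a closed operator. -/
theorem exists_sobolev_limit (g : RMetric n M) {u : ℕ → g.sobolevSubmodule} {φ : Lp ℝ 2 g.vol}
    (hu : Tendsto (fun j => (u j : Lp ℝ 2 g.vol)) atTop (𝓝 φ))
    (hc : ∀ η > 0, ∃ N, ∀ i ≥ N, ∀ j ≥ N, g.dirichletForm (u i - u j) (u i - u j) < η) :
    ∃ ψ : g.sobolevSubmodule, (ψ : Lp ℝ 2 g.vol) = φ ∧
      Tendsto (fun j => g.dirichletForm (u j - ψ) (u j - ψ)) atTop (𝓝 0) := by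
  have hg := fun j => hasSobolevGrad_coe (u j)
  have hsub : ∀ {ψ ψ' : Lp ℝ 2 g.vol} {X X' : ∀ x : M, TangentSpace (𝓡 n) x},
      g.HasSobolevGrad ψ X → g.HasSobolevGrad ψ' X' →
      g.HasSobolevGrad (ψ - ψ') fun x => X x - X' x := fun h h' => by
    simpa [sub_eq_add_neg] using h.add (h'.smul (-1))
  have hE : ∀ (ψ ψ' : g.sobolevSubmodule) {X X' : ∀ x : M, TangentSpace (𝓡 n) x},
      g.HasSobolevGrad ψ X → g.HasSobolevGrad ψ' X' → g.dirichletForm (ψ - ψ') (ψ - ψ') =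
        ∫ x, g.normSq x (X x - X' x) ∂g.vol := by
    intro ψ ψ' X X' h h'
    have h2 : g.HasSobolevGrad (ψ - ψ' : g.sobolevSubmodule) fun x => X x - X' x := by
      rw [Submodule.coe_sub]
      exact hsub h h'
    exact dirichletForm_eq h2 h2
  simp only [fun i j => hE (u i) (u j) (hg i) (hg j)] at hc
  obtain ⟨Y, hY, hlim⟩ := g.exists_tendsto_of_cauchy (fun j => (hg j).isL2Field) hc
  have hφ : g.HasSobolevGrad φ Y := by
    refine hasSobolevGrad_of_forall hY fun η hη => ?_
    rw [tendsto_iff_norm_sub_tendsto_zero] at hu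
    obtain ⟨j, h1, h2⟩ := ((hu.eventually (gt_mem_nhds (show 0 < η / 4 by positivity))).and
      (hlim.eventually (gt_mem_nhds (show 0 < η / 4 by positivity)))).exists
    obtain ⟨f, hf, a1, a2⟩ := (hg j).exists_smooth (show 0 < η / 4 by positivity)
    refine ⟨f, hf, ?_, ?_⟩
    · rw [← sub_add_sub_cancel _ (u j : Lp ℝ 2 g.vol) φ]
      exact (norm_add_le _ _).trans_lt (by linarith)
    · have h3 := integral_normSq_add_le ((g.isL2Field_grad hf).sub (hg j).isL2Field)
        ((hg j).isL2Field.sub hY)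
      simp only [sub_add_sub_cancel] at h3
      linarith
  set ψ : g.sobolevSubmodule := ⟨φ, Y, hφ⟩ with hψ
  have hψg : g.HasSobolevGrad ψ Y := hφ
  exact ⟨ψ, rfl, hlim.congr fun j => (hE (u j) ψ (hg j) hψg).symm⟩

/-! ### The Sobolev inequality and Rellich's inequality on the Sobolev space -/

/-- Every element of the Sobolev space is a limit of smooth functions. -/
theorem exists_smooth_seq (g : RMetric n M) (φ : g.sobolevSubmodule) :
    ∃ (f : ℕ → M → ℝ) (hf : ∀ j, ContMDiff (𝓡 n) 𝓘(ℝ, ℝ) ∞ (f j)),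
      Tendsto (fun j => g.smoothLp (hf j)) atTop (𝓝 (φ : Lp ℝ 2 g.vol)) ∧
      Tendsto (fun j => g.smoothEnergy (f j)) atTop
        (𝓝 (g.dirichletForm φ φ + ‖(φ : Lp ℝ 2 g.vol)‖ ^ 2)) := by
  have hφ := hasSobolevGrad_coe φ
  obtain ⟨f, hf, h1, h2⟩ := hφ.exists_seq
  refine ⟨f, hf, h1, ?_⟩
  have h3 := tendsto_integral_normSq (fun j => g.isL2Field_grad (hf j)) hφ.isL2Field h2
  refine (h3.add (h1.norm.pow 2)).congr fun j => ?_
  rw [norm_smoothLp_sq, smoothEnergy]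

/-- The Sobolev inequality passes from smooth functions to their limits by Fatou's lemma, along a
subsequence that converges almost everywhere. -/
theorem exists_eLpNorm_le (hn : 3 ≤ n) (g : RMetric n M) {q : NNReal} (hq1 : 1 ≤ q)
    (hq : (2 : ℝ)⁻¹ - (n : ℝ)⁻¹ ≤ (q : ℝ)⁻¹) :
    ∃ C : NNReal, ∀ φ : g.sobolevSubmodule, eLpNorm (φ : Lp ℝ 2 g.vol) q g.vol ≤
      C * ENNReal.ofReal (Real.sqrt (g.dirichletForm φ φ + ‖(φ : Lp ℝ 2 g.vol)‖ ^ 2)) := by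
  obtain ⟨C, hC⟩ := g.exists_eLpNorm_le_smoothEnergy hn hq1 hq
  refine ⟨C, fun φ => ?_⟩
  obtain ⟨f, hf, h1, h2⟩ := g.exists_smooth_seq φ
  obtain ⟨ns, hns, hae⟩ := (tendstoInMeasure_of_tendsto_Lp h1).exists_seq_tendsto_ae
  have hl := Lp.eLpNorm_lim_le_liminf_eLpNorm (p := q) (μ := g.vol)
    (f := fun i => (g.smoothLp (hf (ns i)) : M → ℝ))
    (fun i => Lp.aestronglyMeasurable _) (φ : Lp ℝ 2 g.vol) hae
  refine hl.trans ?_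
  have h3 : Tendsto (fun i => C * ENNReal.ofReal (Real.sqrt (g.smoothEnergy (f (ns i))))) atTop
      (𝓝 (C * ENNReal.ofReal
        (Real.sqrt (g.dirichletForm φ φ + ‖(φ : Lp ℝ 2 g.vol)‖ ^ 2)))) :=
    ENNReal.Tendsto.const_mul
      (ENNReal.tendsto_ofReal (h2.comp hns.tendsto_atTop).sqrt) (Or.inr ENNReal.coe_ne_top)
  rw [← h3.liminf_eq]
  refine liminf_le_liminf (Eventually.of_forall fun i => ?_)
  rw [eLpNorm_congr_ae (g.coeFn_smoothLp (hf (ns i)))]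
  exact hC _ (hf _)

/-- Rellich's inequality passes from smooth functions to their limits, since every term in it is
continuous. -/
theorem exists_norm_sq_le (g : RMetric n M) {η : ℝ} (hη : 0 < η) :
    ∃ (s : Finset (Lp ℝ 2 g.vol)) (c : ℝ), 0 ≤ c ∧ ∀ φ : g.sobolevSubmodule,
      ‖(φ : Lp ℝ 2 g.vol)‖ ^ 2 ≤ η * (g.dirichletForm φ φ + ‖(φ : Lp ℝ 2 g.vol)‖ ^ 2) +
        c * ∑ w ∈ s, (inner ℝ w (φ : Lp ℝ 2 g.vol)) ^ 2 := by
  classical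
  obtain ⟨s, c, hc, hs, h⟩ := g.exists_integral_sq_le hη
  have hmem : ∀ w : s, MemLp w.1 2 g.vol := fun w =>
    (hs w.1 w.2).memLp_of_hasCompactSupport (HasCompactSupport.of_compactSpace _)
  set W : s → Lp ℝ 2 g.vol := fun w => (hmem w).toLp _ with hW
  refine ⟨Finset.univ.image W, c * s.card, by positivity, fun φ => ?_⟩
  obtain ⟨f, hf, h1, h2⟩ := g.exists_smooth_seq φ
  have l1 := h1.norm.pow 2
  have l2 : Tendsto (fun j => ∑ w : s, (inner ℝ (W w) (g.smoothLp (hf j))) ^ 2) atTop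
      (𝓝 (∑ w : s, (inner ℝ (W w) (φ : Lp ℝ 2 g.vol)) ^ 2)) :=
    tendsto_finsetSum _ fun w _ => ((tendsto_const_nhds.inner h1).pow 2)
  have l3 := (h2.const_mul η).add (l2.const_mul c)
  have hlim := le_of_tendsto_of_tendsto' l1 l3 fun j => by
    have e : ∀ w : s, inner ℝ (W w) (g.smoothLp (hf j)) = ∫ x, w.1 x * f j x ∂g.vol := by
      intro w
      rw [inner_smoothLp]
      refine integral_congr_ae ?_
      filter_upwards [(hmem w).coeFn_toLp] with x hx
      rw [hW, hx, mul_comm]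
    simp only [e, norm_smoothLp_sq]
    rw [Finset.sum_coe_sort s fun w => (∫ x, w x * f j x ∂g.vol) ^ 2]
    exact h _ (hf j)
  refine hlim.trans (add_le_add le_rfl ?_)
  rw [mul_assoc]
  refine mul_le_mul_of_nonneg_left ?_ hc
  have hcard : (s.card : ℝ) = (Finset.univ : Finset s).card := by simp
  rw [hcard, ← nsmul_eq_mul]
  exact Finset.sum_le_card_nsmul _ _ _ fun w _ =>
    Finset.single_le_sum (f := fun w => (inner ℝ w (φ : Lp ℝ 2 g.vol)) ^ 2)
      (fun _ _ => sq_nonneg _) (Finset.mem_image_of_mem W (Finset.mem_univ w))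

end Completeness

end RMetric

section LogPotential

/-! ### The logarithmic potential -/

/-- The potential `-t² log|t| + c t²`. -/
noncomputable def logPotential (c t : ℝ) : ℝ := -(t ^ 2 * Real.log |t|) + c * t ^ 2

/-- The derivative of the logarithmic potential. -/
noncomputable def logPotentialDeriv (c t : ℝ) : ℝ := -(2 * (t * Real.log |t|) + t) + 2 * c * t

theorem measurable_logPotential {α : Type*} [MeasurableSpace α] {c f : α → ℝ} (hc : Measurable c)
    (hf : Measurable f) : Measurable fun x => logPotential (c x) (f x) := by
  have := Real.measurable_log.comp hf.abs
  exact ((hf.pow_const 2).mul this).neg.add (hc.mul (hf.pow_const 2))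

theorem measurable_logPotentialDeriv {α : Type*} [MeasurableSpace α] {c f : α → ℝ}
    (hc : Measurable c) (hf : Measurable f) :
    Measurable fun x => logPotentialDeriv (c x) (f x) := by
  have := Real.measurable_log.comp hf.abs
  exact (((hf.mul this).const_mul 2).add hf).neg.add ((hc.const_mul 2).mul hf)

theorem hasDerivAt_sq_mul_log_abs (t : ℝ) :
    HasDerivAt (fun t : ℝ => t ^ 2 * Real.log |t|) (2 * (t * Real.log |t|) + t) t := by
  simp only [Real.log_abs]
  by_cases ht : t = 0
  · subst ht
    rw [hasDerivAt_iff_tendsto_slope]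
    have h1 : Tendsto (fun t : ℝ => t * Real.log t) (𝓝[≠] 0) (𝓝 0) := by
      have := (Real.continuous_mul_log.tendsto 0).mono_left (nhdsWithin_le_nhds (s := {0}ᶜ))
      simpa using this
    have e : (2 * ((0 : ℝ) * Real.log 0) + 0) = 0 := by simp
    rw [e]
    refine h1.congr' ?_
    filter_upwards [self_mem_nhdsWithin] with t ht
    have ht' : t ≠ 0 := ht
    rw [slope_def_field]
    field_simp
    simp
    ring
  · refine ((hasDerivAt_pow 2 t).mul (Real.hasDerivAt_log ht)).congr_deriv ?_
    field_simp
    ring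

theorem hasDerivAt_logPotential (c t : ℝ) :
    HasDerivAt (logPotential c) (logPotentialDeriv c t) t := by
  refine ((hasDerivAt_sq_mul_log_abs t).neg.add ((hasDerivAt_pow 2 t).const_mul c)).congr_deriv ?_
  simp only [logPotentialDeriv]
  ring

/-- For `|t| ≤ 1` the left-hand side is bounded by `1`, otherwise the logarithm is dominated by
`|t|^(r-1)/(r-1)`. -/
theorem abs_mul_log_abs_le {r : ℝ} (hr : 1 < r) (t : ℝ) :
    |t * Real.log (|t|)| ≤ 1 + (r - 1)⁻¹ * |t| ^ r := by
  have hr' : 0 < r - 1 := by linarith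
  rw [abs_mul]
  rcases le_or_gt |t| 1 with h | h
  · have h1 : |t| * |Real.log (|t|)| ≤ 1 := by
      rcases (abs_nonneg t).eq_or_lt with h0 | h0
      · rw [← h0]; simp
      · have := Real.abs_log_mul_self_lt |t| h0 h
        rw [abs_mul, abs_abs, mul_comm] at this
        exact this.le
    have h2 : 0 ≤ (r - 1)⁻¹ * |t| ^ r := by positivity
    linarith
  · have h0 : 0 < |t| := by linarith
    have h1 := Real.log_le_rpow_div (abs_nonneg t) hr'
    rw [abs_of_nonneg (Real.log_nonneg h.le)]
    calc |t| * Real.log |t| ≤ |t| * (|t| ^ (r - 1) / (r - 1)) := by gcongr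
      _ = (r - 1)⁻¹ * |t| ^ r := by
          rw [show r = 1 + (r - 1) by ring, Real.rpow_add h0, Real.rpow_one]
          ring_nf
      _ ≤ _ := by linarith

theorem abs_le_one_add_rpow {r : ℝ} (hr : 1 < r) (t : ℝ) : |t| ≤ 1 + |t| ^ r := by
  rcases le_or_gt |t| 1 with h | h
  · have : 0 ≤ |t| ^ r := by positivity
    linarith
  · have := Real.rpow_le_rpow_of_exponent_le h.le hr.le
    rw [Real.rpow_one] at this
    linarith

/-- The derivative of the logarithmic potential grows less than any power of exponent larger than
one. -/
theorem exists_abs_logPotentialDeriv_le {r : ℝ} (hr : 1 < r) {K : ℝ} (hK : 0 ≤ K) :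
    ∃ C : ℝ, 0 ≤ C ∧ ∀ c, |c| ≤ K → ∀ t, |logPotentialDeriv c t| ≤ C * (1 + |t| ^ r) := by
  have hr' : 0 < r - 1 := by linarith
  refine ⟨2 * (1 + (r - 1)⁻¹) + 1 + 2 * K, by positivity, fun c hc t => ?_⟩
  have h1 := abs_mul_log_abs_le hr t
  have h2 := abs_le_one_add_rpow hr t
  have h3 : 0 ≤ |t| ^ r := by positivity
  have h4 : |logPotentialDeriv c t| ≤ 2 * |t * Real.log (|t|)| + |t| + 2 * |c| * |t| := by
    unfold logPotentialDeriv
    refine (abs_add_le _ _).trans ?_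
    rw [abs_neg, abs_mul (2 * c), abs_mul 2 c, abs_two]
    refine add_le_add ((abs_add_le _ _).trans ?_) le_rfl
    rw [abs_mul 2, abs_two]
  have h5 : |c| * |t| ≤ K * (1 + |t| ^ r) := mul_le_mul hc h2 (abs_nonneg _) hK
  have h6 : 0 ≤ (r - 1)⁻¹ := by positivity
  calc _ ≤ _ := h4
    _ ≤ 2 * (1 + (r - 1)⁻¹ * |t| ^ r) + (1 + |t| ^ r) + 2 * (K * (1 + |t| ^ r)) := by linarith
    _ ≤ _ := by nlinarith

/-- The mean value inequality for the logarithmic potential. -/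
theorem exists_abs_logPotential_sub_le {r : ℝ} (hr : 1 < r) {K : ℝ} (hK : 0 ≤ K) :
    ∃ C : ℝ, 0 ≤ C ∧ ∀ c, |c| ≤ K → ∀ s t, |logPotential c s - logPotential c t| ≤
      C * (|s - t| * (1 + |s| ^ r + |t| ^ r)) := by
  obtain ⟨C, hC, h⟩ := exists_abs_logPotentialDeriv_le hr hK
  refine ⟨C, hC, fun c hc s t => ?_⟩
  have hb : ∀ x ∈ Set.uIcc s t, ‖logPotentialDeriv c x‖ ≤ C * (1 + |s| ^ r + |t| ^ r) := by
    intro x hx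
    refine (h c hc x).trans (mul_le_mul_of_nonneg_left ?_ hC)
    have hs : 0 ≤ |s| ^ r := by positivity
    have ht : 0 ≤ |t| ^ r := by positivity
    have hx' : |x| ≤ max |s| |t| := by
      rcases le_total s t with hst | hst
      · rw [Set.uIcc_of_le hst] at hx
        exact abs_le_max_abs_abs hx.1 hx.2
      · rw [Set.uIcc_of_ge hst] at hx
        rw [max_comm]
        exact abs_le_max_abs_abs hx.1 hx.2
    rcases max_choice |s| |t| with hm | hm <;> rw [hm] at hx'
    · have := Real.rpow_le_rpow (abs_nonneg x) hx' (by linarith : (0 : ℝ) ≤ r)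
      linarith
    · have := Real.rpow_le_rpow (abs_nonneg x) hx' (by linarith : (0 : ℝ) ≤ r)
      linarith
  have := Convex.norm_image_sub_le_of_norm_hasDerivWithin_le (f := logPotential c)
    (s := Set.uIcc s t) (x := t) (y := s)
    (fun x _ => (hasDerivAt_logPotential c x).hasDerivWithinAt) hb (convex_uIcc s t)
    Set.right_mem_uIcc Set.left_mem_uIcc
  rw [Real.norm_eq_abs, Real.norm_eq_abs] at this
  linarith

theorem logPotential_zero (c : ℝ) : logPotential c 0 = 0 := by simp [logPotential]

theorem logPotential_mul (c : ℝ) {l : ℝ} (hl : 0 < l) (t : ℝ) :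
    logPotential c (l * t) = l ^ 2 * logPotential c t - l ^ 2 * Real.log l * t ^ 2 := by
  unfold logPotential
  by_cases ht : t = 0
  · simp [ht]
  · rw [abs_mul, abs_of_pos hl, Real.log_mul hl.ne' (abs_ne_zero.2 ht)]
    ring

/-- The tangent line of the logarithm at `A`. -/
theorem log_le_div_add {A y : ℝ} (hA : 0 < A) (hy : 0 < y) :
    Real.log y ≤ y / A + Real.log A - 1 := by
  have := Real.log_le_sub_one_of_pos (div_pos hy hA)
  rw [Real.log_div hy.ne' hA.ne'] at this
  linarith

/-- Concavity of the logarithm bounds `t² log|t|` by its tangent line in the variable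
`|t|^(2r-2)`. -/
theorem sq_mul_log_abs_le {r : ℝ} (hr : 1 < r) {A : ℝ} (hA : 0 < A) (t : ℝ) :
    t ^ 2 * Real.log |t| ≤
      (2 * (r - 1))⁻¹ * (|t| ^ (2 * r) / A + (Real.log A - 1) * t ^ 2) := by
  by_cases ht : t = 0
  · have : (0 : ℝ) ^ (2 * r) = 0 := Real.zero_rpow (by linarith)
    simp [ht, this]
  have h0 : 0 < |t| := abs_pos.2 ht
  have hr' : 0 < 2 * (r - 1) := by linarith
  have h1 := log_le_div_add hA (Real.rpow_pos_of_pos h0 (2 * (r - 1)))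
  rw [Real.log_rpow h0] at h1
  have h2 : t ^ 2 * |t| ^ (2 * (r - 1)) = |t| ^ (2 * r) := by
    rw [← sq_abs, ← Real.rpow_natCast, ← Real.rpow_add h0]
    congr 1
    push_cast
    ring
  rw [inv_mul_eq_div, le_div_iff₀ hr']
  calc t ^ 2 * Real.log |t| * (2 * (r - 1)) = t ^ 2 * (2 * (r - 1) * Real.log |t|) := by ring
    _ ≤ t ^ 2 * (|t| ^ (2 * (r - 1)) / A + Real.log A - 1) := by gcongr
    _ = (t ^ 2 * |t| ^ (2 * (r - 1))) / A + (Real.log A - 1) * t ^ 2 := by ring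
    _ = _ := by rw [h2]

end LogPotential

/-! ### Sobolev forms -/

/-- A closed nonnegative quadratic form on a subspace of `L²` which satisfies a Sobolev inequality
with exponent `2r` and Rellich's compactness property. This is all that the
variational argument needs to know about the Dirichlet form of a compact manifold. -/
structure SobolevForm {α : Type*} [MeasurableSpace α] (μ : Measure α) (r : ℝ) where
  /-- The domain of the form. -/
  domain : Submodule ℝ (Lp ℝ 2 μ)
  /-- The form. -/
  form : LinearMap.BilinForm ℝ domain
  comm : ∀ u v, form u v = form v u
  nonneg : ∀ u, 0 ≤ form u u
  /-- The constant in the Sobolev inequality. -/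
  const : ℝ
  const_pos : 0 < const
  integrable_rpow : ∀ u : domain, Integrable (fun x => |u.1 x| ^ (2 * r)) μ
  sobolev : ∀ u : domain, ∫ x, |u.1 x| ^ (2 * r) ∂μ ≤ (const * (form u u + ‖u.1‖ ^ 2)) ^ r
  rellich : ∀ η : ℝ, 0 < η → ∃ (s : Finset (Lp ℝ 2 μ)) (c : ℝ), 0 ≤ c ∧ ∀ u : domain,
    ‖u.1‖ ^ 2 ≤ η * (form u u + ‖u.1‖ ^ 2) + c * ∑ w ∈ s, (inner ℝ w u.1) ^ 2
  complete : ∀ (u : ℕ → domain) (φ : Lp ℝ 2 μ), Tendsto (fun j => (u j).1) atTop (𝓝 φ) →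
    (∀ η > 0, ∃ N, ∀ i ≥ N, ∀ j ≥ N, form (u i - u j) (u i - u j) < η) →
    ∃ v : domain, v.1 = φ ∧ Tendsto (fun j => form (u j - v) (u j - v)) atTop (𝓝 0)

namespace SobolevForm

variable {α : Type*} [MeasurableSpace α] {μ : Measure α} {r : ℝ}

/-- The square of the norm of the domain of a Sobolev form. -/
noncomputable def energy (D : SobolevForm μ r) (u : D.domain) : ℝ := D.form u u + ‖u.1‖ ^ 2

theorem energy_nonneg (D : SobolevForm μ r) (u : D.domain) : 0 ≤ D.energy u :=
  add_nonneg (D.nonneg u) (sq_nonneg _)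

theorem form_add (D : SobolevForm μ r) (u v : D.domain) :
    D.form (u + v) (u + v) = D.form u u + 2 * D.form u v + D.form v v := by
  simp only [map_add, LinearMap.add_apply]
  rw [D.comm v u]; ring

theorem form_sub (D : SobolevForm μ r) (u v : D.domain) :
    D.form (u - v) (u - v) = D.form u u - 2 * D.form u v + D.form v v := by
  simp only [map_sub, LinearMap.sub_apply]
  rw [D.comm v u]; ring

theorem form_smul (D : SobolevForm μ r) (a : ℝ) (u : D.domain) :
    D.form (a • u) (a • u) = a ^ 2 * D.form u u := by
  simp only [map_smul, LinearMap.smul_apply, smul_eq_mul]; ring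

theorem form_add_le (D : SobolevForm μ r) (u v : D.domain) :
    D.form (u + v) (u + v) ≤ 2 * D.form u u + 2 * D.form v v := by
  have := D.nonneg (u - v)
  rw [form_sub] at this
  rw [form_add]
  linarith

theorem energy_add_le (D : SobolevForm μ r) (u v : D.domain) :
    D.energy (u + v) ≤ 2 * D.energy u + 2 * D.energy v := by
  have h1 := D.form_add_le u v
  have h2 : ‖(u + v).1‖ ≤ ‖u.1‖ + ‖v.1‖ := norm_add_le _ _
  have h3 : ‖(u + v).1‖ ^ 2 ≤ (‖u.1‖ + ‖v.1‖) ^ 2 := pow_le_pow_left₀ (norm_nonneg _) h2 2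
  unfold energy
  nlinarith [sq_nonneg (‖u.1‖ - ‖v.1‖)]

theorem abs_form_le (D : SobolevForm μ r) (u v : D.domain) :
    |D.form u v| ≤ Real.sqrt (D.form u u) * Real.sqrt (D.form v v) := by
  have h := LinearMap.BilinForm.apply_mul_apply_le_of_forall_zero_le D.form D.nonneg u v
  rw [D.comm v u, ← sq] at h
  rw [← Real.sqrt_mul (D.nonneg u)]
  exact Real.abs_le_sqrt h

end SobolevForm

section Lp

variable {α : Type*} [MeasurableSpace α] {μ : Measure α}

theorem norm_sq_eq_integral (u : Lp ℝ 2 μ) : ‖u‖ ^ 2 = ∫ x, u x ^ 2 ∂μ := by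
  rw [← real_inner_self_eq_norm_sq, L2.inner_def]
  simp [sq]

theorem inner_eq_integral (u v : Lp ℝ 2 μ) : inner ℝ u v = ∫ x, u x * v x ∂μ := by
  rw [L2.inner_def]
  simp [mul_comm]

theorem integral_sub_sq (u v : Lp ℝ 2 μ) : ∫ x, (u x - v x) ^ 2 ∂μ = ‖u - v‖ ^ 2 := by
  rw [norm_sq_eq_integral]
  refine integral_congr_ae ?_
  filter_upwards [Lp.coeFn_sub u v] with x hx
  rw [hx, Pi.sub_apply]

end Lp

namespace SobolevForm

variable {α : Type*} [MeasurableSpace α] {μ : Measure α} {r : ℝ}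

/-! ### The potential energy -/

theorem memLp_rpow (D : SobolevForm μ r) (u : D.domain) : MemLp (fun x => |u.1 x| ^ r) 2 μ := by
  have hm : AEStronglyMeasurable (fun x => |u.1 x| ^ r) μ :=
    ((Lp.aestronglyMeasurable u.1).aemeasurable.abs.pow_const r).aestronglyMeasurable
  rw [memLp_two_iff_integrable_sq hm]
  refine (D.integrable_rpow u).congr (Eventually.of_forall fun x => ?_)
  simp only
  rw [mul_comm, Real.rpow_mul (abs_nonneg _), Real.rpow_two]

variable [IsFiniteMeasure μ]

theorem memLp_weight (D : SobolevForm μ r) (u v : D.domain) :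
    MemLp (fun x => 1 + |u.1 x| ^ r + |v.1 x| ^ r) 2 μ :=
  ((memLp_const (1 : ℝ)).add (D.memLp_rpow u)).add (D.memLp_rpow v)

theorem integral_weight_sq_le (D : SobolevForm μ r) (u v : D.domain) :
    ∫ x, (1 + |u.1 x| ^ r + |v.1 x| ^ r) ^ 2 ∂μ ≤
      3 * (μ.real Set.univ + (D.const * D.energy u) ^ r + (D.const * D.energy v) ^ r) := by
  have i1 := D.integrable_rpow u
  have i2 := D.integrable_rpow v
  have h1 : ∀ t : ℝ, (|t| ^ r) ^ 2 = |t| ^ (2 * r) := fun t => by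
    rw [mul_comm, Real.rpow_mul (abs_nonneg _), Real.rpow_two]
  have i3 : Integrable (fun x => 1 + |u.1 x| ^ (2 * r)) μ := (integrable_const 1).add i1
  calc ∫ x, (1 + |u.1 x| ^ r + |v.1 x| ^ r) ^ 2 ∂μ
      ≤ ∫ x, 3 * (1 + |u.1 x| ^ (2 * r) + |v.1 x| ^ (2 * r)) ∂μ := by
        refine integral_mono (D.memLp_weight u v).integrable_sq ((i3.add i2).const_mul 3)
          fun x => ?_
        simp only
        rw [← h1, ← h1]
        nlinarith [sq_nonneg (1 - |u.1 x| ^ r), sq_nonneg (1 - |v.1 x| ^ r),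
          sq_nonneg (|u.1 x| ^ r - |v.1 x| ^ r)]
    _ = 3 * (μ.real Set.univ + (∫ x, |u.1 x| ^ (2 * r) ∂μ) + ∫ x, |v.1 x| ^ (2 * r) ∂μ) := by
        rw [integral_const_mul, integral_add i3 i2, integral_add (integrable_const 1) i1]
        simp
    _ ≤ _ := by
        have := D.sobolev u
        have := D.sobolev v
        unfold energy
        linarith

theorem integrable_abs_sub_mul_weight (D : SobolevForm μ r) (u v : D.domain) :
    Integrable (fun x => |u.1 x - v.1 x| * (1 + |u.1 x| ^ r + |v.1 x| ^ r)) μ :=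
  ((Lp.memLp u.1).sub (Lp.memLp v.1)).abs.integrable_mul (D.memLp_weight u v)

theorem integral_abs_sub_mul_weight_le (D : SobolevForm μ r) (u v : D.domain) :
    ∫ x, |u.1 x - v.1 x| * (1 + |u.1 x| ^ r + |v.1 x| ^ r) ∂μ ≤ ‖u.1 - v.1‖ *
      Real.sqrt (3 * (μ.real Set.univ + (D.const * D.energy u) ^ r +
        (D.const * D.energy v) ^ r)) := by
  have h := sq_integral_mul_le (μ := μ) (f := fun x => |u.1 x - v.1 x|)
    (h := fun x => 1 + |u.1 x| ^ r + |v.1 x| ^ r)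
    ((Lp.memLp u.1).sub (Lp.memLp v.1)).abs.integrable_sq
    (D.memLp_weight u v).integrable_sq (D.integrable_abs_sub_mul_weight u v)
  simp only [sq_abs] at h
  rw [integral_sub_sq] at h
  refine (le_abs_self _).trans ?_
  rw [← Real.sqrt_sq (norm_nonneg (u.1 - v.1)), ← Real.sqrt_mul (sq_nonneg _)]
  refine Real.abs_le_sqrt (h.trans ?_)
  exact mul_le_mul_of_nonneg_left (D.integral_weight_sq_le u v) (sq_nonneg _)

theorem integrable_logPotential (D : SobolevForm μ r) (hr : 1 < r) {c : α → ℝ}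
    (hc : Measurable c) {K : ℝ} (hK : ∀ x, |c x| ≤ K) (u : D.domain) :
    Integrable (fun x => logPotential (c x) (u.1 x)) μ := by
  obtain ⟨C, hC, h⟩ := exists_abs_logPotential_sub_le hr (abs_nonneg K)
  have hi : Integrable (fun x => C * (|u.1 x| * (1 + |u.1 x| ^ r))) μ :=
    ((Lp.memLp u.1).abs.integrable_mul
      ((memLp_const (1 : ℝ)).add (D.memLp_rpow u))).const_mul C
  refine hi.mono' (measurable_logPotential hc
    (Lp.stronglyMeasurable u.1).measurable).aestronglyMeasurable (Eventually.of_forall fun x => ?_)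
  have := h (c x) ((hK x).trans (le_abs_self K)) (u.1 x) 0
  rw [logPotential_zero, sub_zero, sub_zero, abs_zero, Real.zero_rpow (by linarith),
    add_zero] at this
  exact this

/-- The potential energy `∫ (-u² log|u| + c u²)`. -/
noncomputable def potential (μ : Measure α) (c : α → ℝ) (u : Lp ℝ 2 μ) : ℝ :=
  ∫ x, logPotential (c x) (u x) ∂μ

/-- The potential energy is Lipschitz in the `L²`-norm on bounded sets of the domain. -/
theorem exists_abs_potential_sub_le (D : SobolevForm μ r) (hr : 1 < r) {c : α → ℝ}
    (hc : Measurable c) {K : ℝ} (hK : ∀ x, |c x| ≤ K) (R : ℝ) :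
    ∃ L : ℝ, 0 ≤ L ∧ ∀ u v : D.domain, D.energy u ≤ R → D.energy v ≤ R →
      |potential μ c u.1 - potential μ c v.1| ≤ L * ‖u.1 - v.1‖ := by
  obtain ⟨C, hC, h⟩ := exists_abs_logPotential_sub_le hr (abs_nonneg K)
  set A := Real.sqrt (3 * (μ.real Set.univ + (D.const * R) ^ r + (D.const * R) ^ r)) with hA
  refine ⟨C * A, by positivity, fun u v hu hv => ?_⟩
  have hS := D.const_pos
  have hmono : ∀ w : D.domain, D.energy w ≤ R → (D.const * D.energy w) ^ r ≤ (D.const * R) ^ r :=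
    fun w hw => Real.rpow_le_rpow (mul_nonneg hS.le (D.energy_nonneg w))
      (mul_le_mul_of_nonneg_left hw hS.le) (by linarith)
  unfold potential
  rw [← integral_sub (D.integrable_logPotential hr hc hK u) (D.integrable_logPotential hr hc hK v)]
  calc _ ≤ ∫ x, |logPotential (c x) (u.1 x) - logPotential (c x) (v.1 x)| ∂μ :=
        abs_integral_le_integral_abs
    _ ≤ ∫ x, C * (|u.1 x - v.1 x| * (1 + |u.1 x| ^ r + |v.1 x| ^ r)) ∂μ :=
        integral_mono ((D.integrable_logPotential hr hc hK u).sub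
          (D.integrable_logPotential hr hc hK v)).abs
          ((D.integrable_abs_sub_mul_weight u v).const_mul C)
          fun x => h (c x) ((hK x).trans (le_abs_self K)) _ _
    _ = C * ∫ x, |u.1 x - v.1 x| * (1 + |u.1 x| ^ r + |v.1 x| ^ r) ∂μ := integral_const_mul _ _
    _ ≤ C * (‖u.1 - v.1‖ * A) := by
        refine mul_le_mul_of_nonneg_left ((D.integral_abs_sub_mul_weight_le u v).trans ?_) hC
        refine mul_le_mul_of_nonneg_left (Real.sqrt_le_sqrt ?_) (norm_nonneg _)
        have := hmono u hu
        have := hmono v hv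
        linarith
    _ = _ := by ring

/-! ### The functional -/

/-- The functional `ε B(u, u) + ∫ (-u² log|u| + c u²)`. -/
noncomputable def functional (D : SobolevForm μ r) (ε : ℝ) (c : α → ℝ) (u : D.domain) : ℝ :=
  ε * D.form u u + potential μ c u.1

/-- Continuity of the functional in the norm of the domain: the form is continuous, and the potential
energy is Lipschitz in `L²` on a ball around `u`. -/
theorem continuous_functional (D : SobolevForm μ r) (hr : 1 < r) (ε : ℝ) {c : α → ℝ}
    (hc : Measurable c) {K : ℝ} (hK : ∀ x, |c x| ≤ K) (u : D.domain) {η : ℝ} (hη : 0 < η) :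
    ∃ δ > 0, ∀ v : D.domain, Real.sqrt (D.energy (v - u)) < δ →
      |D.functional ε c v - D.functional ε c u| < η := by
  obtain ⟨L, hL, h⟩ := D.exists_abs_potential_sub_le hr hc hK (2 * D.energy u + 2)
  set A := |ε| * (1 + 2 * Real.sqrt (D.form u u)) + L with hA
  have hA0 : 0 ≤ A := by positivity
  refine ⟨min 1 (η / (A + 1)), by positivity, fun v hv => ?_⟩
  set d := Real.sqrt (D.energy (v - u)) with hd
  have hd0 : 0 ≤ d := Real.sqrt_nonneg _
  have hd1 : d < 1 := hv.trans_le (min_le_left _ _)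
  have hd2 : d * (A + 1) < η := (lt_div_iff₀ (by positivity)).1 (hv.trans_le (min_le_right _ _))
  have hdsq : d ^ 2 = D.energy (v - u) := Real.sq_sqrt (D.energy_nonneg _)
  have hn : ‖v.1 - u.1‖ ≤ d := by
    refine Real.le_sqrt_of_sq_le ?_
    have := D.nonneg (v - u)
    unfold energy
    rw [Submodule.coe_sub]
    linarith
  have hB : D.form (v - u) (v - u) ≤ d ^ 2 := by
    rw [hdsq]
    unfold energy
    linarith [sq_nonneg ‖(v - u).1‖]
  have hBs : Real.sqrt (D.form (v - u) (v - u)) ≤ d := (Real.sqrt_le_left hd0).2 hB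
  have hE : D.energy v ≤ 2 * D.energy u + 2 := by
    have := D.energy_add_le u (v - u)
    rw [add_sub_cancel, ← hdsq] at this
    nlinarith
  have hp := h v u hE (by linarith [D.energy_nonneg u])
  have hf : D.form v v - D.form u u = 2 * D.form u (v - u) + D.form (v - u) (v - u) := by
    have := D.form_add u (v - u)
    rw [add_sub_cancel] at this
    linarith
  have hf' : |D.form v v - D.form u u| ≤ (1 + 2 * Real.sqrt (D.form u u)) * d := by
    rw [hf]
    refine (abs_add_le _ _).trans ?_
    rw [abs_mul, abs_two, abs_of_nonneg (D.nonneg (v - u))]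
    have h1 := D.abs_form_le u (v - u)
    have h2 : Real.sqrt (D.form u u) * Real.sqrt (D.form (v - u) (v - u)) ≤
        Real.sqrt (D.form u u) * d := mul_le_mul_of_nonneg_left hBs (Real.sqrt_nonneg _)
    nlinarith
  have e : D.functional ε c v - D.functional ε c u =
      ε * (D.form v v - D.form u u) + (potential μ c v.1 - potential μ c u.1) := by
    unfold functional; ring
  rw [e]
  refine (abs_add_le _ _).trans_lt ?_
  rw [abs_mul]
  have h1 : |ε| * |D.form v v - D.form u u| ≤ |ε| * ((1 + 2 * Real.sqrt (D.form u u)) * d) :=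
    mul_le_mul_of_nonneg_left hf' (abs_nonneg _)
  have h2 : L * ‖v.1 - u.1‖ ≤ L * d := mul_le_mul_of_nonneg_left hn hL
  have h3 : |ε| * ((1 + 2 * Real.sqrt (D.form u u)) * d) + L * d = A * d := by rw [hA]; ring
  nlinarith

/-- Scaling: `I(l u) = l² I(u) - l² log l ‖u‖²`. -/
theorem functional_smul (D : SobolevForm μ r) (hr : 1 < r) (ε : ℝ) {c : α → ℝ}
    (hc : Measurable c) {K : ℝ} (hK : ∀ x, |c x| ≤ K) (u : D.domain) {l : ℝ} (hl : 0 < l) :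
    D.functional ε c (l • u) = l ^ 2 * D.functional ε c u - l ^ 2 * Real.log l * ‖u.1‖ ^ 2 := by
  have h1 : potential μ c (l • u).1 =
      ∫ x, (l ^ 2 * logPotential (c x) (u.1 x) - l ^ 2 * Real.log l * u.1 x ^ 2) ∂μ := by
    refine integral_congr_ae ?_
    filter_upwards [Lp.coeFn_smul l u.1] with x hx
    rw [Submodule.coe_smul, hx, Pi.smul_apply, smul_eq_mul, logPotential_mul _ hl]
  unfold functional
  rw [h1, integral_sub ((D.integrable_logPotential hr hc hK u).const_mul _)
    ((Lp.memLp u.1).integrable_sq.const_mul _), integral_const_mul, integral_const_mul,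
    ← norm_sq_eq_integral, form_smul]
  unfold potential
  ring

/-- The functional is coercive on the unit sphere: by the Sobolev inequality the logarithmic term
is at most logarithmic in the energy. -/
theorem exists_functional_ge (D : SobolevForm μ r) (hr : 1 < r) {ε : ℝ} (hε : 0 < ε) {c : α → ℝ}
    (hc : Measurable c) {K : ℝ} (hK : ∀ x, |c x| ≤ K) :
    ∃ C : ℝ, ∀ u : D.domain, ‖u.1‖ = 1 → ε / 2 * D.form u u - C ≤ D.functional ε c u := by
  have hr' : 0 < 2 * (r - 1) := by linarith
  have hS := D.const_pos
  set b := (2 * (r - 1))⁻¹ * r with hb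
  have hb0 : 0 < b := by positivity
  refine ⟨b * Real.log D.const + (ε / 2 + b * Real.log (2 * b / ε) - b) + K, fun u hu => ?_⟩
  set E := D.form u u with hE
  have hE0 : 0 ≤ E := D.nonneg u
  have hen : D.energy u = E + 1 := by unfold energy; rw [hu]; ring
  -- with the bound `A` of the Sobolev inequality as the point of tangency, the integral of
  -- `|u|^(2r) / A` is at most `1`, and what remains is `log A = r log (const (E + 1))`
  set A := (D.const * (E + 1)) ^ r with hA
  have hA0 : 0 < A := Real.rpow_pos_of_pos (by positivity) r
  have hsq : ∫ x, u.1 x ^ 2 ∂μ = 1 := by rw [← norm_sq_eq_integral, hu]; norm_num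
  have hi2 := (Lp.memLp u.1).integrable_sq
  have hir := D.integrable_rpow u
  have hpt : ∀ x, -((2 * (r - 1))⁻¹ * (|u.1 x| ^ (2 * r) / A + (Real.log A - 1) * u.1 x ^ 2)) -
      K * u.1 x ^ 2 ≤ logPotential (c x) (u.1 x) := by
    intro x
    have h1 := sq_mul_log_abs_le hr hA0 (u.1 x)
    have h2 : -(K * u.1 x ^ 2) ≤ c x * u.1 x ^ 2 := by
      have := (abs_le.1 (hK x)).1
      nlinarith [sq_nonneg (u.1 x)]
    unfold logPotential
    linarith
  have hp : -((2 * (r - 1))⁻¹ * ((∫ x, |u.1 x| ^ (2 * r) ∂μ) / A + (Real.log A - 1))) - K ≤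
      potential μ c u.1 := by
    have i1 := (((hir.div_const A).add (hi2.const_mul (Real.log A - 1))).const_mul
      (2 * (r - 1))⁻¹)
    have h := integral_mono (i1.neg.sub (hi2.const_mul K))
      (D.integrable_logPotential hr hc hK u) hpt
    refine le_trans (le_of_eq ?_) h
    have e1 : ∫ x, (|u.1 x| ^ (2 * r) / A + (Real.log A - 1) * u.1 x ^ 2) ∂μ =
        (∫ x, |u.1 x| ^ (2 * r) ∂μ) / A + (Real.log A - 1) := by
      rw [integral_add (hir.div_const A) (hi2.const_mul _), integral_div, integral_const_mul,
        hsq, mul_one]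
    calc _ = -((2 * (r - 1))⁻¹ *
          ∫ x, (|u.1 x| ^ (2 * r) / A + (Real.log A - 1) * u.1 x ^ 2) ∂μ) -
            ∫ x, K * u.1 x ^ 2 ∂μ := by rw [e1, integral_const_mul, hsq, mul_one]
      _ = _ := by
        rw [← integral_const_mul, ← integral_neg]
        exact (integral_sub i1.neg (hi2.const_mul K)).symm
  have hs : (∫ x, |u.1 x| ^ (2 * r) ∂μ) / A ≤ 1 := by
    rw [div_le_one hA0, hA, ← hen]
    exact D.sobolev u
  have hlogA : Real.log A = r * (Real.log D.const + Real.log (E + 1)) := by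
    rw [hA, Real.log_rpow (by positivity), Real.log_mul hS.ne' (by positivity)]
  -- the slope of this tangent line makes `b log (E + 1)` cost at most half of `ε E`
  have hlog := log_le_div_add (A := 2 * b / ε) (y := E + 1) (by positivity) (by positivity)
  have h1 : (2 * (r - 1))⁻¹ * ((∫ x, |u.1 x| ^ (2 * r) ∂μ) / A + (Real.log A - 1)) ≤
      b * (Real.log D.const + Real.log (E + 1)) := by
    rw [hb, mul_assoc, ← hlogA]
    refine mul_le_mul_of_nonneg_left ?_ (by positivity)
    linarith
  have h2 : b * Real.log (E + 1) ≤ ε / 2 * (E + 1) + b * Real.log (2 * b / ε) - b := by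
    calc b * Real.log (E + 1) ≤ b * ((E + 1) / (2 * b / ε) + Real.log (2 * b / ε) - 1) :=
          mul_le_mul_of_nonneg_left hlog hb0.le
      _ = _ := by field_simp
  unfold functional
  rw [← hE]
  nlinarith

end SobolevForm

namespace SobolevForm

variable {α : Type*} [MeasurableSpace α] {μ : Measure α} {r : ℝ}

/-! ### Compactness and existence of minimizers -/

theorem energy_smul (D : SobolevForm μ r) (a : ℝ) (u : D.domain) :
    D.energy (a • u) = a ^ 2 * D.energy u := by
  unfold energy
  rw [form_smul, Submodule.coe_smul, norm_smul, mul_pow, Real.norm_eq_abs, sq_abs]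
  ring

theorem energy_sub_le (D : SobolevForm μ r) (u v : D.domain) :
    D.energy (u - v) ≤ 2 * D.energy u + 2 * D.energy v := by
  have h := D.energy_add_le u ((-1 : ℝ) • v)
  rw [energy_smul] at h
  simpa [sub_eq_add_neg] using h

theorem norm_sq_le_energy (D : SobolevForm μ r) (u : D.domain) : ‖u.1‖ ^ 2 ≤ D.energy u := by
  have := D.nonneg u
  unfold energy
  linarith

/-- Bounded subsets of the domain are totally bounded in `L²`: by Rellich's inequality it suffices
to control finitely many linear functionals. -/
theorem totallyBounded_energy_le (D : SobolevForm μ r) (R : ℝ) :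
    TotallyBounded {φ : Lp ℝ 2 μ | ∃ u : D.domain, u.1 = φ ∧ D.energy u ≤ R} := by
  rw [Metric.totallyBounded_iff]
  intro δ hδ
  set S := {φ : Lp ℝ 2 μ | ∃ u : D.domain, u.1 = φ ∧ D.energy u ≤ R} with hS
  obtain ⟨s, c, hc, h⟩ := D.rellich (δ ^ 2 / (8 * (|R| + 1))) (by positivity)
  set k := c * s.card with hk
  have hk0 : 0 ≤ k := by positivity
  set ρ := δ / (2 * (k + 1)) with hρ
  have hρ0 : 0 < ρ := by positivity
  let Φ : Lp ℝ 2 μ →L[ℝ] (s → ℝ) := ContinuousLinearMap.pi fun w => innerSL ℝ w.1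
  have hSb : Bornology.IsBounded S := by
    refine (Metric.isBounded_closedBall (x := (0 : Lp ℝ 2 μ)) (r := Real.sqrt R)).subset ?_
    rintro _ ⟨u, rfl, hu⟩
    rw [mem_closedBall_zero_iff]
    exact Real.le_sqrt_of_sq_le ((D.norm_sq_le_energy u).trans hu)
  -- a bounded set in the finite-dimensional space `s → ℝ`
  have hΦ : TotallyBounded (Φ '' S) :=
    (Φ.lipschitz.isBounded_image hSb).isCompact_closure.totallyBounded.subset subset_closure
  obtain ⟨t', ht'S, ht'f, ht⟩ := Set.exists_subset_image_finite_and.1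
    (Metric.finite_approx_of_totallyBounded hΦ ρ hρ0)
  refine ⟨t', ht'f, fun φ hφ => ?_⟩
  obtain ⟨y, hy, hφy⟩ := Set.mem_iUnion₂.1 (ht (Set.mem_image_of_mem Φ hφ))
  obtain ⟨ψ, hψ, rfl⟩ := hy
  refine Set.mem_iUnion₂.2 ⟨ψ, hψ, ?_⟩
  obtain ⟨u, rfl, hu⟩ := hφ
  obtain ⟨v, rfl, hv⟩ := ht'S hψ
  rw [Metric.mem_ball, dist_eq_norm]
  have h1 := h (u - v)
  have h2 : D.form (u - v) (u - v) + ‖(u - v).1‖ ^ 2 ≤ 4 * R := by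
    have := D.energy_sub_le u v
    unfold energy at this hu hv
    linarith
  have h3 : ∀ w ∈ s, (inner ℝ w (u - v).1) ^ 2 ≤ ρ ^ 2 := by
    intro w hw
    rw [Metric.mem_ball, dist_eq_norm, ← map_sub] at hφy
    have h4 : |inner ℝ w (u - v).1| ≤ ‖Φ (u.1 - v.1)‖ := by
      have := norm_le_pi_norm (Φ (u.1 - v.1)) ⟨w, hw⟩
      simpa [Φ] using this
    rw [← sq_abs]
    exact pow_le_pow_left₀ (abs_nonneg _) (h4.trans hφy.le) 2
  have h5 : c * ∑ w ∈ s, (inner ℝ w (u - v).1) ^ 2 ≤ k * ρ ^ 2 := by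
    rw [hk, mul_assoc, ← nsmul_eq_mul]
    exact mul_le_mul_of_nonneg_left (Finset.sum_le_card_nsmul _ _ _ h3) hc
  have h6 : k * ρ ^ 2 ≤ δ ^ 2 / 4 := by
    rw [hρ, div_pow, mul_pow, ← mul_div_assoc, div_le_div_iff₀ (by positivity) (by positivity)]
    nlinarith [mul_nonneg (sq_nonneg δ) hk0, mul_nonneg (sq_nonneg δ) (mul_nonneg hk0 hk0),
      sq_nonneg δ]
  have h7 : δ ^ 2 / (8 * (|R| + 1)) * (D.form (u - v) (u - v) + ‖(u - v).1‖ ^ 2) ≤ δ ^ 2 / 2 := by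
    calc _ ≤ δ ^ 2 / (8 * (|R| + 1)) * (4 * (|R| + 1)) := by
          refine mul_le_mul_of_nonneg_left (h2.trans ?_) (by positivity)
          linarith [le_abs_self R]
      _ = δ ^ 2 / 2 := by field_simp; norm_num
  refine lt_of_pow_lt_pow_left₀ 2 hδ.le ?_
  rw [← Submodule.coe_sub]
  nlinarith [pow_pos hδ 2]

/-- Rellich's theorem for sequences. -/
theorem exists_subseq_tendsto (D : SobolevForm μ r) {R : ℝ} {u : ℕ → D.domain}
    (hu : ∀ j, D.energy (u j) ≤ R) :
    ∃ (φ : Lp ℝ 2 μ) (ns : ℕ → ℕ), StrictMono ns ∧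
      Tendsto (fun j => (u (ns j)).1) atTop (𝓝 φ) := by
  have hK : IsCompact (closure {φ : Lp ℝ 2 μ | ∃ u : D.domain, u.1 = φ ∧ D.energy u ≤ R}) :=
    (D.totallyBounded_energy_le R).closure.isCompact_of_isClosed isClosed_closure
  obtain ⟨φ, -, ns, hns, h⟩ := hK.tendsto_subseq (x := fun j => (u j).1)
    fun j => subset_closure ⟨u j, rfl, hu j⟩
  exact ⟨φ, ns, hns, h⟩

variable [IsFiniteMeasure μ]

/-- The lower bound on all of the domain which follows by scaling from a lower bound on the unit
sphere. -/
theorem le_functional (D : SobolevForm μ r) (hr : 1 < r) (ε : ℝ) {c : α → ℝ}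
    (hc : Measurable c) {K : ℝ} (hK : ∀ x, |c x| ≤ K) {κ : ℝ}
    (hκ : ∀ v : D.domain, ‖v.1‖ = 1 → κ ≤ D.functional ε c v) (u : D.domain) :
    κ * ‖u.1‖ ^ 2 - ‖u.1‖ ^ 2 * Real.log ‖u.1‖ ≤ D.functional ε c u := by
  by_cases h0 : ‖u.1‖ = 0
  · have hu : u = 0 := Subtype.ext (norm_eq_zero.1 h0)
    have h1 : D.functional ε c 0 = 0 := by
      have := D.functional_smul hr ε hc hK 0 zero_lt_two
      simp only [smul_zero, ZeroMemClass.coe_zero, norm_zero] at this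
      linarith
    rw [hu, h1]
    simp
  · have hs : 0 < ‖u.1‖ := (norm_nonneg _).lt_of_ne' h0
    set w : D.domain := ‖u.1‖⁻¹ • u with hw
    have hw1 : ‖w.1‖ = 1 := by
      rw [hw, Submodule.coe_smul, norm_smul, norm_inv, norm_norm, inv_mul_cancel₀ h0]
    have hu : u = ‖u.1‖ • w := by rw [hw, smul_smul, mul_inv_cancel₀ h0, one_smul]
    have h1 := D.functional_smul hr ε hc hK w hs
    rw [← hu, hw1] at h1
    rw [h1]
    nlinarith [hκ w hw1, sq_nonneg ‖u.1‖]

theorem tendsto_functional (D : SobolevForm μ r) (hr : 1 < r) (ε : ℝ) {c : α → ℝ}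
    (hc : Measurable c) {K : ℝ} (hK : ∀ x, |c x| ≤ K) {u : ℕ → D.domain} {v : D.domain}
    (h : Tendsto (fun j => D.energy (u j - v)) atTop (𝓝 0)) :
    Tendsto (fun j => D.functional ε c (u j)) atTop (𝓝 (D.functional ε c v)) := by
  rw [Metric.tendsto_nhds]
  intro η hη
  obtain ⟨δ, hδ, hb⟩ := D.continuous_functional hr ε hc hK v hη
  have h' := h.sqrt
  rw [Real.sqrt_zero] at h'
  filter_upwards [h'.eventually (gt_mem_nhds hδ)] with j hj
  exact hb _ hj

/-- A minimizing sequence which converges in `L²` is a Cauchy sequence in the domain: by the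
parallelogram law, the midpoints would otherwise have too small a value. -/
theorem tendsto_form_sub (D : SobolevForm μ r) (hr : 1 < r) {ε : ℝ} (hε : 0 < ε) {c : α → ℝ}
    (hc : Measurable c) {K : ℝ} (hK : ∀ x, |c x| ≤ K) {κ R : ℝ}
    (hκ : ∀ v : D.domain, ‖v.1‖ = 1 → κ ≤ D.functional ε c v) {u : ℕ → D.domain}
    (hu1 : ∀ j, ‖(u j).1‖ = 1) (huR : ∀ j, D.energy (u j) ≤ R)
    (huκ : Tendsto (fun j => D.functional ε c (u j)) atTop (𝓝 κ)) {φ : Lp ℝ 2 μ}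
    (huφ : Tendsto (fun j => (u j).1) atTop (𝓝 φ)) :
    Tendsto (fun p : ℕ × ℕ => D.form (u p.1 - u p.2) (u p.1 - u p.2)) atTop (𝓝 0) := by
  obtain ⟨L, hL, hLip⟩ := D.exists_abs_potential_sub_le hr hc hK R
  have hφ1 : ‖φ‖ = 1 :=
    tendsto_nhds_unique huφ.norm (by simpa only [hu1] using tendsto_const_nhds)
  have hfst : Tendsto (Prod.fst : ℕ × ℕ → ℕ) atTop atTop := by
    rw [← prod_atTop_atTop_eq]; exact tendsto_fst
  have hsnd : Tendsto (Prod.snd : ℕ × ℕ → ℕ) atTop atTop := by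
    rw [← prod_atTop_atTop_eq]; exact tendsto_snd
  -- the midpoints tend to `φ` in `L²` as well, so their norms tend to `1`
  let m : ℕ × ℕ → D.domain := fun p => (1 / 2 : ℝ) • (u p.1 + u p.2)
  have hm : Tendsto (fun p => ‖(m p).1‖) atTop (𝓝 1) := by
    have h1 := (((huφ.comp hfst).add (huφ.comp hsnd)).const_smul (1 / 2 : ℝ)).norm
    have e : (1 / 2 : ℝ) • (φ + φ) = φ := by
      rw [← two_smul ℝ φ, smul_smul]; norm_num
    rw [e, hφ1] at h1
    exact h1
  have hd : Tendsto (fun p : ℕ × ℕ => ‖(u p.1).1 - (u p.2).1‖) atTop (𝓝 0) := by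
    have h1 := ((huφ.comp hfst).sub (huφ.comp hsnd)).norm
    rw [sub_self, norm_zero] at h1
    exact h1
  have hh : Tendsto (fun p => κ * ‖(m p).1‖ ^ 2 - ‖(m p).1‖ ^ 2 * Real.log ‖(m p).1‖) atTop
      (𝓝 κ) := by
    have h1 := ((hm.pow 2).const_mul κ).sub ((hm.pow 2).mul (hm.log one_ne_zero))
    simpa using h1
  have hlim : Tendsto (fun p : ℕ × ℕ => (4 / ε) *
      ((1 / 2) * (D.functional ε c (u p.1) + D.functional ε c (u p.2)) -
        (κ * ‖(m p).1‖ ^ 2 - ‖(m p).1‖ ^ 2 * Real.log ‖(m p).1‖) +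
        L / 2 * ‖(u p.1).1 - (u p.2).1‖)) atTop (𝓝 0) := by
    have h1 := (((((huκ.comp hfst).add (huκ.comp hsnd)).const_mul (1 / 2)).sub hh).add
      (hd.const_mul (L / 2))).const_mul (4 / ε)
    have e : 4 / ε * (1 / 2 * (κ + κ) - κ + L / 2 * 0) = 0 := by ring
    rw [e] at h1
    exact h1
  refine squeeze_zero (fun p => D.nonneg _) (fun p => ?_) hlim
  set a := u p.1
  set b := u p.2
  have hmR : D.energy (m p) ≤ R := by
    have h1 := D.energy_add_le a b
    have h2 := huR p.1
    have h3 := huR p.2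
    change D.energy ((1 / 2 : ℝ) • (a + b)) ≤ R
    rw [energy_smul]
    linarith
  have hma : ‖(m p).1 - a.1‖ = 1 / 2 * ‖a.1 - b.1‖ := by
    have e : (m p).1 - a.1 = (-(1 / 2) : ℝ) • (a.1 - b.1) := by
      change (1 / 2 : ℝ) • (a.1 + b.1) - a.1 = _
      module
    rw [e, norm_smul]
    norm_num
  have hmb : ‖(m p).1 - b.1‖ = 1 / 2 * ‖a.1 - b.1‖ := by
    have e : (m p).1 - b.1 = (1 / 2 : ℝ) • (a.1 - b.1) := by
      change (1 / 2 : ℝ) • (a.1 + b.1) - b.1 = _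
      module
    rw [e, norm_smul]
    norm_num
  have ha := (abs_le.1 (hLip (m p) a hmR (huR p.1))).2
  have hb := (abs_le.1 (hLip (m p) b hmR (huR p.2))).2
  rw [hma] at ha
  rw [hmb] at hb
  have hlow := D.le_functional hr ε hc hK hκ (m p)
  have hform : D.form (m p) (m p) = 1 / 4 * D.form (a + b) (a + b) := by
    change D.form ((1 / 2 : ℝ) • (a + b)) ((1 / 2 : ℝ) • (a + b)) = _
    rw [form_smul]; norm_num
  rw [form_add] at hform
  rw [form_sub, div_mul_eq_mul_div, le_div_iff₀ hε]
  unfold functional at hlow ⊢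
  rw [hform] at hlow
  linarith

/-- The direct method: a minimizing sequence is bounded by coercivity, has an `L²`-convergent
subsequence by compactness, and this converges in the domain, where the functional is continuous. -/
theorem exists_minimizer (D : SobolevForm μ r) (hr : 1 < r) {ε : ℝ} (hε : 0 < ε) {c : α → ℝ}
    (hc : Measurable c) {K : ℝ} (hK : ∀ x, |c x| ≤ K) (hne : ∃ u : D.domain, ‖u.1‖ = 1) :
    ∃ u : D.domain, ‖u.1‖ = 1 ∧
      ∀ v : D.domain, ‖v.1‖ = 1 → D.functional ε c u ≤ D.functional ε c v := by
  obtain ⟨C, hC⟩ := D.exists_functional_ge hr hε hc hK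
  set S : Set ℝ := D.functional ε c '' {u | ‖u.1‖ = 1} with hS
  have hSne : S.Nonempty := Set.Nonempty.image _ hne
  have hSb : BddBelow S := by
    refine ⟨-C, ?_⟩
    rintro _ ⟨u, hu, rfl⟩
    have h1 := hC u hu
    have h2 : 0 ≤ ε / 2 * D.form u u := mul_nonneg (by positivity) (D.nonneg u)
    linarith
  obtain ⟨y, -, hy, hyS⟩ := exists_seq_tendsto_sInf hSne hSb
  choose u hu1 huy using hyS
  simp only [Set.mem_ofPred_eq] at hu1
  set κ := sInf S with hκdef
  have hκ : ∀ v : D.domain, ‖v.1‖ = 1 → κ ≤ D.functional ε c v := fun v hv =>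
    csInf_le hSb ⟨v, hv, rfl⟩
  have hu : Tendsto (fun j => D.functional ε c (u j)) atTop (𝓝 κ) := by simpa only [huy] using hy
  obtain ⟨Q, hQ⟩ := hu.bddAbove_range
  have huR : ∀ j, D.energy (u j) ≤ (Q + C) / (ε / 2) + 1 := by
    intro j
    have h1 := hC (u j) (hu1 j)
    have h2 : D.functional ε c (u j) ≤ Q := hQ ⟨j, rfl⟩
    unfold energy
    rw [hu1 j, one_pow]
    refine add_le_add ?_ le_rfl
    rw [le_div_iff₀ (by positivity)]
    linarith
  obtain ⟨φ, ns, hns, hφ⟩ := D.exists_subseq_tendsto huR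
  have hu' := hu.comp hns.tendsto_atTop
  have hcau := D.tendsto_form_sub hr hε hc hK hκ (u := fun j => u (ns j)) (fun j => hu1 _)
    (fun j => huR _) hu' hφ
  obtain ⟨v, hv, hlim⟩ := D.complete (fun j => u (ns j)) φ hφ fun η hη => by
    obtain ⟨N, hN⟩ := Filter.eventually_atTop.1 (hcau.eventually (gt_mem_nhds hη))
    exact ⟨max N.1 N.2, fun i hi j hj =>
      hN (i, j) ⟨(le_max_left _ _).trans hi, (le_max_right _ _).trans hj⟩⟩
  have hen : Tendsto (fun j => D.energy (u (ns j) - v)) atTop (𝓝 0) := by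
    have h1 := ((tendsto_iff_norm_sub_tendsto_zero.1 hφ).pow 2)
    have h2 := hlim.add h1
    rw [zero_pow two_ne_zero, add_zero] at h2
    refine h2.congr fun j => ?_
    unfold energy
    rw [Submodule.coe_sub, hv]
  have hfv := tendsto_nhds_unique (D.tendsto_functional hr ε hc hK hen) hu'
  refine ⟨v, ?_, fun w hw => hfv ▸ hκ w hw⟩
  rw [hv]
  exact tendsto_nhds_unique hφ.norm (by simpa only [hu1] using tendsto_const_nhds)

/-! ### The Euler–Lagrange equation -/

/-- The first variation of the potential energy, by dominated convergence. -/
theorem hasDerivAt_potential (D : SobolevForm μ r) (hr : 1 < r) {c : α → ℝ}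
    (hc : Measurable c) {K : ℝ} (hK : ∀ x, |c x| ≤ K) (u v : D.domain) :
    Integrable (fun x => logPotentialDeriv (c x) (u.1 x) * v.1 x) μ ∧
      HasDerivAt (fun t : ℝ => potential μ c (u + t • v).1)
        (∫ x, logPotentialDeriv (c x) (u.1 x) * v.1 x ∂μ) 0 := by
  obtain ⟨C, hC, h⟩ := exists_abs_logPotentialDeriv_le hr (abs_nonneg K)
  have hum := (Lp.stronglyMeasurable u.1).measurable
  have hvm := (Lp.stronglyMeasurable v.1).measurable
  have hbi : Integrable (fun x =>
      C * (|v.1 x| * (1 + 2 ^ r * (|u.1 x| ^ r + |v.1 x| ^ r)))) μ :=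
    ((Lp.memLp v.1).abs.integrable_mul ((memLp_const (1 : ℝ)).add
      (((D.memLp_rpow u).add (D.memLp_rpow v)).const_mul (2 ^ r)))).const_mul C
  have key := hasDerivAt_integral_of_dominated_loc_of_deriv_le (μ := μ) (x₀ := (0 : ℝ))
    (s := Metric.ball 0 1)
    (F := fun t x => logPotential (c x) (u.1 x + t * v.1 x))
    (F' := fun t x => logPotentialDeriv (c x) (u.1 x + t * v.1 x) * v.1 x)
    (bound := fun x => C * (|v.1 x| * (1 + 2 ^ r * (|u.1 x| ^ r + |v.1 x| ^ r))))
    (Metric.ball_mem_nhds _ one_pos)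
    (Eventually.of_forall fun t =>
      (measurable_logPotential hc (hum.add (hvm.const_mul t))).aestronglyMeasurable)
    (by simpa using D.integrable_logPotential hr hc hK u)
    ((measurable_logPotentialDeriv hc (hum.add (hvm.const_mul 0))).mul hvm).aestronglyMeasurable
    (Eventually.of_forall fun x t ht => by
      have ht1 : |t| ≤ 1 := by
        rw [mem_ball_zero_iff, Real.norm_eq_abs] at ht
        exact ht.le
      have h1 : |u.1 x + t * v.1 x| ≤ 2 * max |u.1 x| |v.1 x| := by
        have h2 : |t * v.1 x| ≤ |v.1 x| := by
          rw [abs_mul]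
          exact mul_le_of_le_one_left (abs_nonneg _) ht1
        have := abs_add_le (u.1 x) (t * v.1 x)
        linarith [le_max_left |u.1 x| |v.1 x|, le_max_right |u.1 x| |v.1 x|]
      have h3 : |u.1 x + t * v.1 x| ^ r ≤ 2 ^ r * (|u.1 x| ^ r + |v.1 x| ^ r) := by
        refine (Real.rpow_le_rpow (abs_nonneg _) h1 (by linarith)).trans ?_
        rw [Real.mul_rpow zero_le_two (le_max_of_le_left (abs_nonneg _))]
        refine mul_le_mul_of_nonneg_left ?_ (by positivity)
        have hu0 : 0 ≤ |u.1 x| ^ r := by positivity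
        have hv0 : 0 ≤ |v.1 x| ^ r := by positivity
        rcases max_choice |u.1 x| |v.1 x| with hm | hm <;> rw [hm] <;> linarith
      rw [norm_mul, Real.norm_eq_abs, Real.norm_eq_abs]
      calc _ ≤ C * (1 + |u.1 x + t * v.1 x| ^ r) * |v.1 x| :=
            mul_le_mul_of_nonneg_right (h (c x) ((hK x).trans (le_abs_self K)) _) (abs_nonneg _)
        _ ≤ C * (1 + 2 ^ r * (|u.1 x| ^ r + |v.1 x| ^ r)) * |v.1 x| := by gcongr
        _ = _ := by ring)
    hbi
    (Eventually.of_forall fun x t _ => by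
      have h1 : HasDerivAt (fun t : ℝ => u.1 x + t * v.1 x) (v.1 x) t := by
        simpa using ((hasDerivAt_id t).mul_const (v.1 x)).const_add (u.1 x)
      exact (hasDerivAt_logPotential (c x) _).comp t h1)
  simp only [zero_mul, add_zero] at key
  refine ⟨key.1, key.2.congr_of_eventuallyEq (Eventually.of_forall fun t => ?_)⟩
  refine integral_congr_ae ?_
  filter_upwards [Lp.coeFn_add u.1 (t • v.1), Lp.coeFn_smul t v.1] with x h1 h2
  rw [Submodule.coe_add, Submodule.coe_smul, h1, Pi.add_apply, h2, Pi.smul_apply, smul_eq_mul]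

/-- The Euler–Lagrange equation of a minimizer `u` on the unit sphere. The Lagrange multiplier is
found from `t ↦ I(u + t v) - κ s² + s² log s` with `s = ‖u + t v‖`, which is nonnegative by scaling
and vanishes at `t = 0`. -/
theorem form_eq_of_minimizer (D : SobolevForm μ r) (hr : 1 < r) (ε : ℝ) {c : α → ℝ}
    (hc : Measurable c) {K : ℝ} (hK : ∀ x, |c x| ≤ K) {κ : ℝ}
    (hκ : ∀ v : D.domain, ‖v.1‖ = 1 → κ ≤ D.functional ε c v) {u : D.domain} (hu : ‖u.1‖ = 1)
    (huκ : D.functional ε c u = κ) (v : D.domain) :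
    Integrable (fun x => (u.1 x * Real.log |u.1 x| + (κ - c x) * u.1 x) * v.1 x) μ ∧
      ε * D.form u v =
        ∫ x, (u.1 x * Real.log |u.1 x| + (κ - c x) * u.1 x) * v.1 x ∂μ := by
  obtain ⟨hi, hd⟩ := D.hasDerivAt_potential hr hc hK u v
  set G := ∫ x, logPotentialDeriv (c x) (u.1 x) * v.1 x ∂μ with hG
  have huv : Integrable (fun x => u.1 x * v.1 x) μ := (Lp.memLp u.1).integrable_mul (Lp.memLp v.1)
  have hquad : ∀ a b d : ℝ, HasDerivAt (fun t : ℝ => a + 2 * t * b + t ^ 2 * d) (2 * b) 0 := by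
    intro a b d
    have h1 := (((hasDerivAt_id (0 : ℝ)).const_mul 2).mul_const b).const_add a
    have h2 := (hasDerivAt_pow 2 (0 : ℝ)).mul_const d
    refine (h1.add h2).congr_deriv ?_
    simp
  have hform : HasDerivAt (fun t : ℝ => D.form (u + t • v) (u + t • v)) (2 * D.form u v) 0 := by
    refine (hquad (D.form u u) (D.form u v) (D.form v v)).congr_of_eventuallyEq
      (Eventually.of_forall fun t => ?_)
    simp only
    rw [form_add, form_smul, map_smul, smul_eq_mul]
    ring
  have hnorm : HasDerivAt (fun t : ℝ => ‖(u + t • v).1‖ ^ 2) (2 * inner ℝ u.1 v.1) 0 := by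
    refine (hquad (‖u.1‖ ^ 2) (inner ℝ u.1 v.1) (‖v.1‖ ^ 2)).congr_of_eventuallyEq
      (Eventually.of_forall fun t => ?_)
    simp only
    rw [Submodule.coe_add, Submodule.coe_smul, norm_add_sq_real, real_inner_smul_right, norm_smul,
      mul_pow, Real.norm_eq_abs, sq_abs]
    ring
  have hn0 : ‖(u + (0 : ℝ) • v).1‖ ^ 2 = 1 := by simp [hu]
  have hlog : HasDerivAt
      (fun t : ℝ => 1 / 2 * (‖(u + t • v).1‖ ^ 2 * Real.log (‖(u + t • v).1‖ ^ 2)))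
      (inner ℝ u.1 v.1) 0 := by
    have h1 := hnorm.log (by rw [hn0]; exact one_ne_zero)
    refine ((hnorm.mul h1).const_mul (1 / 2)).congr_deriv ?_
    rw [hn0]
    simp
  have hder := (((hform.const_mul ε).add hd).sub (hnorm.const_mul κ)).add hlog
  set H : ℝ → ℝ := fun t => ε * D.form (u + t • v) (u + t • v) + potential μ c (u + t • v).1 -
    κ * ‖(u + t • v).1‖ ^ 2 +
      1 / 2 * (‖(u + t • v).1‖ ^ 2 * Real.log (‖(u + t • v).1‖ ^ 2)) with hH
  have hH0 : H 0 = 0 := by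
    have h1 : H 0 = D.functional ε c u - κ * ‖u.1‖ ^ 2 +
        1 / 2 * (‖u.1‖ ^ 2 * Real.log (‖u.1‖ ^ 2)) := by
      simp only [hH, zero_smul, add_zero]
      rfl
    rw [h1, hu, huκ]
    simp
  have hHnn : ∀ t, 0 ≤ H t := by
    intro t
    have h1 := D.le_functional hr ε hc hK hκ (u + t • v)
    simp only [hH, Real.log_pow, Nat.cast_ofNat]
    unfold functional at h1
    linarith
  have hmin : IsLocalMin H 0 := Eventually.of_forall fun t => by rw [hH0]; exact hHnn t
  have hz := hmin.hasDerivAt_eq_zero hder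
  have hpt : ∀ x, (u.1 x * Real.log |u.1 x| + (κ - c x) * u.1 x) * v.1 x =
      -(1 / 2) * (logPotentialDeriv (c x) (u.1 x) * v.1 x) + (κ - 1 / 2) * (u.1 x * v.1 x) := by
    intro x
    unfold logPotentialDeriv
    ring
  simp only [hpt]
  refine ⟨(hi.const_mul _).add (huv.const_mul _), ?_⟩
  rw [integral_add (hi.const_mul _) (huv.const_mul _), integral_const_mul, integral_const_mul,
    ← inner_eq_integral, ← hG]
  linarith

end SobolevForm

namespace RMetric

section LogFunctional

set_option linter.unusedSectionVars false

variable {n : ℕ} {M : Type*} [TopologicalSpace M] [ChartedSpace (EuclideanSpace ℝ (Fin n)) M]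
  [IsManifold (𝓡 n) ∞ M] [MeasurableSpace M] [BorelSpace M] [T2Space M] [CompactSpace M]

/-! ### The logarithmic functional on a compact manifold -/

/-- The Sobolev inequality with the subcritical exponent `2 + 2/n`, in terms of integrals. -/
theorem exists_integral_rpow_le (hn : 3 ≤ n) (g : RMetric n M) :
    ∃ S : ℝ, 0 < S ∧ ∀ φ : g.sobolevSubmodule,
      Integrable (fun x => |φ.1 x| ^ (2 * (1 + (n : ℝ)⁻¹))) g.vol ∧
      ∫ x, |φ.1 x| ^ (2 * (1 + (n : ℝ)⁻¹)) ∂g.vol ≤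
        (S * (g.dirichletForm φ φ + ‖φ.1‖ ^ 2)) ^ (1 + (n : ℝ)⁻¹) := by
  set r : ℝ := 1 + (n : ℝ)⁻¹ with hr
  have hn0 : (0 : ℝ) < n := by positivity
  have hr0 : 0 < r := by positivity
  set q : NNReal := (2 * r).toNNReal with hq
  have hqr : (q : ℝ) = 2 * r := Real.coe_toNNReal _ (by positivity)
  have hq1 : 1 ≤ q := by
    rw [← NNReal.coe_le_coe, hqr, NNReal.coe_one, hr]
    have : (0 : ℝ) < (n : ℝ)⁻¹ := by positivity
    linarith
  have hq0 : (q : ℝ≥0∞) ≠ 0 := by exact_mod_cast (zero_lt_one.trans_le hq1).ne'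
  have hqn : (2 : ℝ)⁻¹ - (n : ℝ)⁻¹ ≤ (q : ℝ)⁻¹ := by
    have e : (2 : ℝ)⁻¹ - (n : ℝ)⁻¹ - (q : ℝ)⁻¹ = -((n : ℝ) + 2) / (2 * n * (n + 1)) := by
      rw [hqr, hr]
      field_simp
      ring
    have : -((n : ℝ) + 2) / (2 * n * (n + 1)) ≤ 0 :=
      div_nonpos_of_nonpos_of_nonneg (by linarith) (by positivity)
    linarith
  obtain ⟨C, hC⟩ := g.exists_eLpNorm_le hn hq1 hqn
  refine ⟨(C : ℝ) ^ 2 + 1, by positivity, fun φ => ?_⟩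
  set N := g.dirichletForm φ φ + ‖φ.1‖ ^ 2 with hN
  have hN0 : 0 ≤ N := add_nonneg (g.dirichletForm_self_nonneg φ) (sq_nonneg _)
  have hm : MemLp φ.1 q g.vol :=
    ⟨Lp.aestronglyMeasurable _, (hC φ).trans_lt
      (ENNReal.mul_lt_top ENNReal.coe_lt_top ENNReal.ofReal_lt_top)⟩
  have hi := hm.integrable_norm_rpow hq0 ENNReal.coe_ne_top
  have h1 := hC φ
  rw [hm.eLpNorm_eq_integral_rpow_norm hq0 ENNReal.coe_ne_top,
    show (C : ℝ≥0∞) = ENNReal.ofReal C from (ENNReal.ofReal_coe_nnreal).symm,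
    ← ENNReal.ofReal_mul C.coe_nonneg, ENNReal.ofReal_le_ofReal_iff (by positivity)] at h1
  simp only [ENNReal.coe_toReal, hqr, Real.norm_eq_abs] at hi h1
  refine ⟨hi, ?_⟩
  have hJ : 0 ≤ ∫ x, |φ.1 x| ^ (2 * r) ∂g.vol := integral_nonneg fun x => by positivity
  have h2 := Real.rpow_le_rpow (by positivity) h1 (by positivity : 0 ≤ 2 * r)
  rw [Real.rpow_inv_rpow hJ (by positivity), Real.rpow_mul (by positivity), Real.rpow_two, mul_pow,
    Real.sq_sqrt hN0] at h2
  refine h2.trans (Real.rpow_le_rpow (by positivity) ?_ hr0.le)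
  nlinarith

/-- The Dirichlet form of a compact Riemannian manifold. -/
noncomputable abbrev sobolevForm (hn : 3 ≤ n) (g : RMetric n M) :
    SobolevForm g.vol (1 + (n : ℝ)⁻¹) where
  domain := g.sobolevSubmodule
  form := g.dirichletForm
  comm := g.dirichletForm_comm
  nonneg := g.dirichletForm_self_nonneg
  const := (g.exists_integral_rpow_le hn).choose
  const_pos := (g.exists_integral_rpow_le hn).choose_spec.1
  integrable_rpow u := ((g.exists_integral_rpow_le hn).choose_spec.2 u).1
  sobolev u := ((g.exists_integral_rpow_le hn).choose_spec.2 u).2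
  rellich _ hη := g.exists_norm_sq_le hη
  complete _ _ hu hc := g.exists_sobolev_limit hu hc

theorem logIntegrand_eq (g : RMetric n M) (ε : ℝ) (χ : M → ℝ) (φ : Lp ℝ 2 g.vol) (x : M) :
    g.logIntegrand ε χ φ x =
      ε * g.normSq x (g.sobolevGrad φ x) + logPotential (χ x) (φ x) := by
  unfold logIntegrand logPotential
  ring

theorem one_lt_one_add_inv (hn : 3 ≤ n) : (1 : ℝ) < 1 + (n : ℝ)⁻¹ := by
  have : (0 : ℝ) < n := by positivity
  have : (0 : ℝ) < (n : ℝ)⁻¹ := by positivity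
  linarith

theorem integrable_logPotential (hn : 3 ≤ n) {g : RMetric n M} {χ : M → ℝ} (hχ : Continuous χ)
    {φ : Lp ℝ 2 g.vol} (hφ : φ ∈ g.sobolevSpace) :
    Integrable (fun x => logPotential (χ x) (φ x)) g.vol := by
  obtain ⟨K, -, hK⟩ := exists_abs_le_of_continuous hχ
  exact (g.sobolevForm hn).integrable_logPotential (one_lt_one_add_inv hn) hχ.measurable hK ⟨φ, hφ⟩

theorem integrable_logIntegrand (hn : 3 ≤ n) {g : RMetric n M} (ε : ℝ) {χ : M → ℝ}
    (hχ : Continuous χ) {φ : Lp ℝ 2 g.vol} (hφ : φ ∈ g.sobolevSpace) :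
    Integrable (fun x => g.logIntegrand ε χ φ x) g.vol := by
  simp only [logIntegrand_eq]
  exact ((hasSobolevGrad_sobolevGrad hφ).isL2Field.2.const_mul ε).add
    (integrable_logPotential hn hχ hφ)

theorem integrable_sq_mul_log_abs (hn : 3 ≤ n) {g : RMetric n M} {φ : Lp ℝ 2 g.vol}
    (hφ : φ ∈ g.sobolevSpace) : Integrable (fun x => φ x ^ 2 * Real.log |φ x|) g.vol := by
  have h := (integrable_logPotential hn (continuous_const (y := (0 : ℝ))) hφ).neg
  refine h.congr (Eventually.of_forall fun x => ?_)
  simp [logPotential]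

theorem logFunctional_eq (hn : 3 ≤ n) (g : RMetric n M) (ε : ℝ) {χ : M → ℝ} (hχ : Continuous χ)
    {φ : Lp ℝ 2 g.vol} (hφ : φ ∈ g.sobolevSpace) :
    g.logFunctional ε χ φ = (g.sobolevForm hn).functional ε χ ⟨φ, hφ⟩ := by
  unfold logFunctional
  simp only [logIntegrand_eq]
  rw [integral_add ((hasSobolevGrad_sobolevGrad hφ).isL2Field.2.const_mul ε)
    (integrable_logPotential hn hχ hφ), integral_const_mul]
  rfl

theorem sobolevNorm_eq (hn : 3 ≤ n) (g : RMetric n M) (u : g.sobolevSubmodule) :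
    g.sobolevNorm u = Real.sqrt ((g.sobolevForm hn).energy u) := by
  unfold sobolevNorm
  rw [integral_add (hasSobolevGrad_coe u).isL2Field.2 (Lp.memLp u.1).integrable_sq,
    ← norm_sq_eq_integral]
  rfl

theorem exists_abs_logFunctional_sub_lt (hn : 3 ≤ n) (g : RMetric n M) (ε : ℝ) {χ : M → ℝ}
    (hχ : Continuous χ) {φ : Lp ℝ 2 g.vol} (hφ : φ ∈ g.sobolevSpace) {η : ℝ} (hη : 0 < η) :
    ∃ δ > 0, ∀ ψ ∈ g.sobolevSpace, g.sobolevNorm (ψ - φ) < δ →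
      |g.logFunctional ε χ ψ - g.logFunctional ε χ φ| < η := by
  obtain ⟨K, -, hK⟩ := exists_abs_le_of_continuous hχ
  obtain ⟨δ, hδ, h⟩ := (g.sobolevForm hn).continuous_functional (one_lt_one_add_inv hn) ε
    hχ.measurable hK ⟨φ, hφ⟩ hη
  refine ⟨δ, hδ, fun ψ hψ hψδ => ?_⟩
  rw [g.logFunctional_eq hn ε hχ hψ, g.logFunctional_eq hn ε hχ hφ]
  let u : g.sobolevSubmodule := ⟨φ, hφ⟩
  let v : g.sobolevSubmodule := ⟨ψ, hψ⟩
  have e : g.sobolevNorm (ψ - φ) = Real.sqrt ((g.sobolevForm hn).energy (v - u)) :=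
    g.sobolevNorm_eq hn (v - u)
  rw [e] at hψδ
  exact h v hψδ

theorem exists_norm_eq_one [Nonempty M] (g : RMetric n M) :
    ∃ u : g.sobolevSubmodule, ‖u.1‖ = 1 := by
  have h1 : ContMDiff (𝓡 n) 𝓘(ℝ, ℝ) ∞ fun _ : M => (1 : ℝ) := contMDiff_const
  have := g.isOpenPosMeasure_vol
  have h0 : ‖(g.smoothSobolev h1).1‖ ≠ 0 := by
    intro h
    have h2 := g.norm_smoothLp_sq h1
    have h3 : ‖g.smoothLp h1‖ = 0 := h
    rw [h3] at h2
    have h4 : g.vol.real Set.univ = 0 := by simpa using h2.symm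
    rw [measureReal_eq_zero_iff] at h4
    exact (isOpen_univ.measure_pos g.vol Set.univ_nonempty).ne' h4
  refine ⟨‖(g.smoothSobolev h1).1‖⁻¹ • g.smoothSobolev h1, ?_⟩
  rw [Submodule.coe_smul, norm_smul, norm_inv, norm_norm, inv_mul_cancel₀ h0]

/-- The Euler–Lagrange equation, tested against smooth functions by Green's formula. -/
theorem isDistribSolution_of_form_eq {g : RMetric n M} {ε : ℝ} (u : g.sobolevSubmodule)
    {F : M → ℝ} (h : ∀ v : g.sobolevSubmodule, Integrable (fun x => F x * v.1 x) g.vol ∧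
      ε * g.dirichletForm u v = ∫ x, F x * v.1 x ∂g.vol) :
    g.IsDistribSolution ε u.1 F := by
  have h1 : ContMDiff (𝓡 n) 𝓘(ℝ, ℝ) ∞ fun _ : M => (1 : ℝ) := contMDiff_const
  have hcoe : ∀ {ψ : M → ℝ} (hψ : ContMDiff (𝓡 n) 𝓘(ℝ, ℝ) ∞ ψ),
      (fun x => F x * (g.smoothSobolev hψ).1 x) =ᵐ[g.vol] fun x => F x * ψ x := fun hψ => by
    filter_upwards [g.coeFn_smoothLp hψ] with x hx
    exact congrArg (F x * ·) hx
  refine ⟨(Lp.memLp u.1).integrable one_le_two, ?_, fun ψ hψ => ?_⟩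
  · simpa using (h (g.smoothSobolev h1)).1.congr (hcoe h1)
  · have hΔ : MemLp (g.laplacian ψ) 2 g.vol :=
      (g.continuous_laplacian hψ).memLp_of_hasCompactSupport (HasCompactSupport.of_compactSpace _)
    have hi : Integrable (fun x => u.1 x * g.laplacian ψ x) g.vol :=
      (Lp.memLp u.1).integrable_mul hΔ
    have h2 := (h (g.smoothSobolev hψ)).2
    rw [integral_congr_ae (hcoe hψ), dirichletForm_smoothSobolev] at h2
    rw [integral_add (hi.const_mul ε) ((h (g.smoothSobolev hψ)).1.congr (hcoe hψ)),
      integral_const_mul, ← h2]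
    ring

end LogFunctional

end RMetric

theorem mainTheorem4 (n : ℕ) (hn : 3 ≤ n) (M : Type*) [TopologicalSpace M] [T2Space M]
    [CompactSpace M] [Nonempty M] [ChartedSpace (EuclideanSpace ℝ (Fin n)) M]
    [IsManifold (𝓡 n) ∞ M] [MeasurableSpace M] [BorelSpace M] (g : RMetric n M)
    (ε : ℝ) (χ : M → ℝ) (hχ : ContMDiff (𝓡 n) 𝓘(ℝ, ℝ) ∞ χ) :
    -- the functional is well defined on the Sobolev space
    (∀ φ ∈ g.sobolevSpace,
      (∀ X Y : ∀ x : M, TangentSpace (𝓡 n) x, g.HasSobolevGrad φ X → g.HasSobolevGrad φ Y →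
        ∀ᵐ x ∂g.vol, X x = Y x) ∧
      Integrable (fun x => φ x ^ 2 * Real.log |φ x|) g.vol ∧
      Integrable (fun x => g.logIntegrand ε χ φ x) g.vol) ∧
    -- it is continuous in the Sobolev norm
    (∀ φ ∈ g.sobolevSpace, ∀ η > 0, ∃ δ > 0, ∀ ψ ∈ g.sobolevSpace,
      g.sobolevNorm (ψ - φ) < δ →
        |g.logFunctional ε χ ψ - g.logFunctional ε χ φ| < η) ∧
    -- for positive `ε` it has a minimum on the unit sphere, and minimizers solve the equation
    (0 < ε →
      (∃ κ : ℝ, IsLeast (g.logFunctional ε χ '' g.unitSphere) κ) ∧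
      ∀ κ : ℝ, IsLeast (g.logFunctional ε χ '' g.unitSphere) κ →
        ∀ φ ∈ g.unitSphere, g.logFunctional ε χ φ = κ →
          g.IsDistribSolution ε φ
            (fun x => φ x * Real.log |φ x| + (κ - χ x) * φ x)) := by
  obtain ⟨K, -, hK⟩ := RMetric.exists_abs_le_of_continuous hχ.continuous
  have hr := RMetric.one_lt_one_add_inv hn
  have hχm := hχ.continuous.measurable
  set D := g.sobolevForm hn
  have hD : ∀ {φ : Lp ℝ 2 g.vol} (hφ : φ ∈ g.sobolevSpace),
      g.logFunctional ε χ φ = D.functional ε χ ⟨φ, hφ⟩ := fun hφ =>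
    g.logFunctional_eq hn ε hχ.continuous hφ
  refine ⟨fun φ hφ => ⟨fun X Y hX hY => hX.ae_eq hY, RMetric.integrable_sq_mul_log_abs hn hφ,
    RMetric.integrable_logIntegrand hn ε hχ.continuous hφ⟩, fun φ hφ η hη => ?_,
    fun hε => ⟨?_, fun κ hκ φ hφ hφκ => ?_⟩⟩
  · exact g.exists_abs_logFunctional_sub_lt hn ε hχ.continuous hφ hη
  · obtain ⟨u, hu, hmin⟩ := D.exists_minimizer hr hε hχm hK g.exists_norm_eq_one
    refine ⟨_, ⟨u.1, ⟨u.2, hu⟩, rfl⟩, ?_⟩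
    rintro _ ⟨ψ, ⟨hψ, hψ1⟩, rfl⟩
    rw [hD u.2, hD hψ]
    exact hmin ⟨ψ, hψ⟩ hψ1
  · have hmin : ∀ v : D.domain, ‖v.1‖ = 1 → κ ≤ D.functional ε χ v := fun v hv => by
      have h := hκ.2 ⟨v.1, ⟨v.2, hv⟩, rfl⟩
      rwa [hD v.2] at h
    exact RMetric.isDistribSolution_of_form_eq ⟨φ, hφ.1⟩ fun v =>
      D.form_eq_of_minimizer hr ε hχm hK hmin (u := ⟨φ, hφ.1⟩) hφ.2
        ((hD hφ.1).symm.trans hφκ) v
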